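/- Let $d\ge 1$, and let $\hbar=1/(2\pi N)$ with $N\in\{1,2,3,\dots\}$; limits $\hbar\downarrow0$ are limits $N\to\infty$. For $x=(x_q,x_p)$, $y=(y_q,y_p)$ in $\mathbb R^{2d}$ put $\omega(x,y)=x_q\cdot y_p-x_p\cdot y_q$. For $\xi=(\xi_q,\xi_p)\in\mathbb R^{2d}$ let $U_\hbar(\xi)$ be the operator $$U_\hbar(\xi)\psi(q)=\psi(q-\xi_q)\,\exp\Big(\tfrac i\hbar\big(\xi_p\cdot q-\tfrac12\xi_q\cdot\xi_p\big)\Big)$$ on Schwartz functions, extended by duality to $\mathcal S'(\mathbb R^d)$. For $\kappa=(\kappa_q,\kappa_p)\in[0,2\pi)^{2d}$, which may depend on $\hbar$, let $$\mathcal H_\hbar(\kappa)=\{\psi\in\mathcal S'(\mathbb R^d):\ U_\hbar(n)\psi=e^{i\omega(\kappa,n)+i\,n_q\cdot n_p/(2\hbar)}\psi\ \text{ for all } n=(n_q,n_p)\in\mathbb Z^{2d}\},$$ which has dimension $N^d$, with the scalar product (antilinear in the first argument) for which the basis $$\psi^\kappa_r=N^{-d/2}\sum_{k\in\mathbb Z^d}e^{i\kappa_p\cdot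 k}\,\delta_{k+\frac rN+\frac{\kappa_q}{2\pi N}},\qquad r\in\{0,\dots,N-1\}^d,$$ is orthonormal. Let $\mathbb T^{2d}=(\mathbb R/\mathbb Z)^{2d}$. For $f\in C^\infty(\mathbb T^{2d})$ let $$Op^W(f)=\sum_{n\in\mathbb Z^{2d}}\Big(\int_{\mathbb T^{2d}}e^{2\pi i\,\omega(n,x)}f(x)\,dx\Big)\,U_\hbar(n/N)$$ be its Weyl quantization on $\mathcal H_\hbar(\kappa)$. Let $\eta_\hbar(q)=(\pi\hbar)^{-d/4}e^{-|q|^2/(2\hbar)}$ and, for $a\in\mathbb R^{2d}$, let $$\eta^a_{\hbar,\kappa}=\Big(\sum_{n_p\in\mathbb Z^d}e^{-i\kappa_q\cdot n_p}U_\hbar(0,n_p)\Big)\Big(\sum_{n_q\in\mathbb Z^d}e^{i\kappa_p\cdot n_q}U_\hbar(n_q,0)\Big)U_\hbar(a)\eta_\hbar\in\mathcal H_\hbar(\kappa)$$ be the coherent states on the torus. Let $\Psi_\hbar\in\mathcal H_\hbar(\kappa)$ be a family of vectors, one for each $\hbar=1/(2\pi N)$. Consider the property (A) $\langle\Psi_\hbar,Op^W(f)\Psi_\hbar\rangle_{\mathcal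 H_\hbar(\kappa)}\to f(0)$ as $\hbar\downarrow0$, for all $f\in C^\infty(\mathbb T^{2d})$, and, for a family of functions $\chi_\hbar$ on $\mathbb T^{2d}$, the property (B) $\displaystyle\Big\|\Psi_\hbar-(2\pi\hbar)^{-d}\int_{\mathbb T^{2d}}\chi_\hbar(a)\,\langle\eta^a_{\hbar,\kappa},\Psi_\hbar\rangle_{\mathcal H_\hbar(\kappa)}\,\eta^a_{\hbar,\kappa}\,da\Big\|_{\mathcal H_\hbar(\kappa)}\to0$ as $\hbar\downarrow0$. 1. If (A) holds, then there are positive numbers $r_\hbar\to0$ and functions $\chi_\hbar\in C^\infty(\mathbb T^{2d})$ with $0\le\chi_\hbar\le1$, supported in the ball of radius $r_\hbar$ centred at $0$ in $\mathbb T^{2d}$, such that (B) holds. 2. Conversely, if (B) holds for some positive numbers $r_\hbar\to0$ and some functions $\chi_\hbar\in C^\infty(\mathbb T^{2d})$ with $0\le\chi_\hbar\le1$, supported in the ball of radius $r_\hbar$ centred at $0$ in $\mathbb T^{2d}$, and if moreover $\|\Psi_\hbar\|_{\mathcal H_\hbar(\kappa)}\to1$, then (A) holds. -/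

import Mathlib

open MeasureTheory Filter Topology SchwartzMap
open scoped ContDiff

noncomputable section

namespace TorusQuantum

/-! ### Temperate growth of the exponentials that occur below -/

lemma hasDerivAt_cexp_mul (c : ℂ) (s : ℝ) :
    HasDerivAt (fun s : ℝ => Complex.exp (c * s)) (c * Complex.exp (c * s)) s := by
  have h1 : HasDerivAt (fun s : ℝ => c * (s : ℂ)) c s := by
    simpa using (Complex.ofRealCLM.hasDerivAt (x := s)).const_mul c
  simpa [mul_comm] using h1.cexp

lemma iteratedDeriv_cexp_mul (c : ℂ) (n : ℕ) :
    iteratedDeriv n (fun s : ℝ => Complex.exp (c * s))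
      = fun s : ℝ => c ^ n * Complex.exp (c * s) := by
  induction n with
  | zero => simp
  | succ n ih =>
    rw [iteratedDeriv_succ, ih]
    funext s
    rw [((hasDerivAt_cexp_mul c s).const_mul (c ^ n)).deriv]
    ring

lemma hasTemperateGrowth_cexp {E : Type*} [NormedAddCommGroup E] [NormedSpace ℝ E]
    (c : ℂ) {f : E → ℝ} (hf : f.HasTemperateGrowth) (hc : ∀ x, c.re * f x ≤ 0) :
    (fun x => Complex.exp (c * f x)).HasTemperateGrowth := by
  have hopen : IsOpen {s : ℝ | c.re * s < 1} :=
    isOpen_lt (by fun_prop) continuous_const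
  have hsm : ContDiff ℝ ∞ (fun s : ℝ => Complex.exp (c * s)) :=
    (contDiff_const.mul Complex.ofRealCLM.contDiff).cexp
  refine Function.HasTemperateGrowth.comp' (g := fun s : ℝ => Complex.exp (c * s))
    (t := {s : ℝ | c.re * s < 1}) ?_ hopen.uniqueDiffOn hsm.contDiffOn ?_ hf
  · rintro _ ⟨x, rfl⟩
    exact lt_of_le_of_lt (hc x) one_pos
  · intro M
    refine ⟨0, (1 + ‖c‖) ^ M * Real.exp 1, by positivity, fun n hn s hs => ?_⟩
    rw [norm_iteratedFDerivWithin_eq_norm_iteratedDerivWithin,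
      iteratedDerivWithin_eq_iteratedDeriv hopen.uniqueDiffOn
        (hsm.contDiffAt.of_le (mod_cast le_top)) hs, iteratedDeriv_cexp_mul, norm_mul, norm_pow,
      Complex.norm_exp]
    have h1 : ‖c‖ ^ n ≤ (1 + ‖c‖) ^ M :=
      (pow_le_pow_left₀ (norm_nonneg c) (by linarith) n).trans
        (pow_le_pow_right₀ (by linarith [norm_nonneg c]) hn)
    have h2 : (c * (s : ℂ)).re = c.re * s := by simp
    have h3 : Real.exp (c * (s : ℂ)).re ≤ Real.exp 1 := by
      rw [h2]; exact Real.exp_le_exp.mpr (le_of_lt hs)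
    simpa using mul_le_mul h1 h3 (Real.exp_nonneg _) (by positivity)

/-! ### Configuration space, phase space, Planck's constant -/

/-- The configuration space `ℝ^d`. -/
abbrev Config (d : ℕ) := EuclideanSpace ℝ (Fin d)

/-- The phase space `ℝ^{2d}`, whose points are written `x = (q, p)`. -/
abbrev Phase (d : ℕ) := Config d × Config d

/-- An integer vector as a point of `ℝ^d`. -/
def intVec {d : ℕ} (n : Fin d → ℤ) : Config d := WithLp.toLp 2 fun j => (n j : ℝ)

/-- A point of the lattice `ℤ^{2d}` in phase space. -/
def intPhase {d : ℕ} (n : (Fin d → ℤ) × (Fin d → ℤ)) : Phase d := (intVec n.1, intVec n.2)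

/-- The symplectic form `ω(x, y) = x_q · y_p - x_p · y_q`. -/
def symp {d : ℕ} (x y : Phase d) : ℝ := inner ℝ x.1 y.2 - inner ℝ x.2 y.1

/-- `ħ = 1 / (2 π N)`. -/
def hbar (N : ℕ+) : ℝ := 1 / (2 * Real.pi * (N : ℝ))

lemma hbar_pos (N : ℕ+) : 0 < hbar N := by
  have : (0 : ℝ) < (N : ℝ) := by exact_mod_cast N.pos
  have := Real.pi_pos
  unfold hbar; positivity

/-! ### Phase space translations -/

/-- The phase `exp ((i/ħ) (ξ_p · q - ξ_q · ξ_p / 2))`. -/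
def phaseFactor {d : ℕ} (h : ℝ) (ξ : Phase d) (q : Config d) : ℂ :=
  Complex.exp (Complex.I * ((inner ℝ ξ.2 q - inner ℝ ξ.1 ξ.2 / 2) / h : ℝ))

lemma hasTemperateGrowth_phaseFactor {d : ℕ} (h : ℝ) (ξ : Phase d) :
    (phaseFactor h ξ).HasTemperateGrowth := by
  refine hasTemperateGrowth_cexp Complex.I (E := Config d)
    (f := fun q => (inner ℝ ξ.2 q - inner ℝ ξ.1 ξ.2 / 2) / h) ?_ (by simp)
  simp only [div_eq_mul_inv]
  fun_prop

/-- `U_ħ(ξ)` on Schwartz functions: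
`(U_ħ(ξ) ψ)(q) = ψ (q - ξ_q) exp ((i/ħ) (ξ_p · q - ξ_q · ξ_p / 2))`. -/
def translS {d : ℕ} (h : ℝ) (ξ : Phase d) : 𝓢(Config d, ℂ) →L[ℂ] 𝓢(Config d, ℂ) :=
  SchwartzMap.smulLeftCLM ℂ (phaseFactor h ξ) ∘L SchwartzMap.compSubConstCLM ℂ ξ.1

lemma translS_apply {d : ℕ} (h : ℝ) (ξ : Phase d) (ψ : 𝓢(Config d, ℂ)) (q : Config d) :
    translS h ξ ψ q = phaseFactor h ξ q * ψ (q - ξ.1) := by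
  simp [translS, SchwartzMap.smulLeftCLM_apply_apply (hasTemperateGrowth_phaseFactor h ξ)]

/-- `U_ħ(ξ)` on tempered distributions, as the transpose of `U_ħ(-ξ_q, ξ_p)` on Schwartz functions
(for the bilinear pairing `∫ ψ φ`). -/
def transl {d : ℕ} (h : ℝ) (ξ : Phase d) : 𝓢'(Config d, ℂ) →L[ℂ] 𝓢'(Config d, ℂ) :=
  PointwiseConvergenceCLM.precomp _ (translS h (-ξ.1, ξ.2))

lemma transl_apply {d : ℕ} (h : ℝ) (ξ : Phase d) (T : 𝓢'(Config d, ℂ)) (φ : 𝓢(Config d, ℂ)) :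
    transl h ξ T φ = T (translS h (-ξ.1, ξ.2) φ) := rfl

/-- On tempered distributions that come from Schwartz functions, the two definitions agree. -/
lemma transl_coe {d : ℕ} (h : ℝ) (ξ : Phase d) (ψ : 𝓢(Config d, ℂ)) :
    transl h ξ (ψ : 𝓢'(Config d, ℂ)) = (translS h ξ ψ : 𝓢'(Config d, ℂ)) := by
  ext φ
  rw [transl_apply, SchwartzMap.coe_apply, SchwartzMap.coe_apply,
    ← integral_sub_right_eq_self _ ξ.1]
  refine integral_congr_ae (Eventually.of_forall fun q => ?_)
  simp only [translS_apply, smul_eq_mul, sub_neg_eq_add, sub_add_cancel]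
  have : phaseFactor h (-ξ.1, ξ.2) (q - ξ.1) = phaseFactor h ξ q := by
    simp only [phaseFactor, inner_sub_right, inner_neg_left, real_inner_comm ξ.2 ξ.1]
    congr 3
    ring
  rw [this]
  ring

/-! ### The Hilbert spaces of the torus -/

/-- `𝓗_ħ(κ)`: the tempered distributions `T` with
`U_ħ(n) T = exp (i ω(κ, n) + i n_q · n_p / (2 ħ)) T` for all `n ∈ ℤ^{2d}`. -/
def hilb {d : ℕ} (N : ℕ+) (κ : Phase d) : Submodule ℂ 𝓢'(Config d, ℂ) where
  carrier := {T | ∀ n : (Fin d → ℤ) × (Fin d → ℤ), transl (hbar N) (intPhase n) T =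
    Complex.exp (Complex.I *
      (symp κ (intPhase n) + inner ℝ (intVec n.1) (intVec n.2) / (2 * hbar N) : ℝ)) • T}
  add_mem' {S T} hS hT n := by rw [map_add, hS n, hT n, smul_add]
  zero_mem' n := by rw [map_zero, smul_zero]
  smul_mem' c T hT n := by rw [map_smul, hT n, smul_comm]

/-- The basis of `𝓗_ħ(κ)`, indexed by `r ∈ {0, …, N - 1}^d`:
`ψ_r^κ = N^{-d/2} ∑_{k ∈ ℤ^d} exp (i κ_p · k) δ_{k + r/N + κ_q/(2πN)}`
(the series converges in the space of tempered distributions). -/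
def basisVec {d : ℕ} (N : ℕ+) (κ : Phase d) (r : Fin d → Fin (N : ℕ)) : 𝓢'(Config d, ℂ) :=
  ((((N : ℝ) ^ (-(d : ℝ) / 2) : ℝ)) : ℂ) • ∑' k : Fin d → ℤ,
    Complex.exp (Complex.I * (inner ℝ κ.2 (intVec k) : ℝ)) •
      TemperedDistribution.delta
        (intVec k + (N : ℝ)⁻¹ • intVec (fun j => ((r j : ℕ) : ℤ))
          + (2 * Real.pi * (N : ℝ))⁻¹ • κ.1)

/-- The coordinates of an element of `𝓗_ħ(κ)` in the basis `ψ_r^κ`: a right inverse of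
`c ↦ ∑ r, c r • ψ_r^κ`. -/
def coords {d : ℕ} (N : ℕ+) (κ : Phase d) (T : 𝓢'(Config d, ℂ)) :
    EuclideanSpace ℂ (Fin d → Fin (N : ℕ)) :=
  Function.invFun
    (fun c : EuclideanSpace ℂ (Fin d → Fin (N : ℕ)) => ∑ r, c r • basisVec N κ r) T

/-- The scalar product of `𝓗_ħ(κ)` that makes the basis `ψ_r^κ` orthonormal
(antilinear in the first argument). -/
def hInner {d : ℕ} (N : ℕ+) (κ : Phase d) (S T : 𝓢'(Config d, ℂ)) : ℂ :=
  inner ℂ (coords N κ S) (coords N κ T)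

/-- The norm of `𝓗_ħ(κ)`. -/
def hNorm {d : ℕ} (N : ℕ+) (κ : Phase d) (T : 𝓢'(Config d, ℂ)) : ℝ := ‖coords N κ T‖

/-! ### Functions on the torus and their Weyl quantization -/

/-- `f ∈ C^∞(𝕋^{2d})`, as a smooth `ℤ^{2d}`-periodic function on `ℝ^{2d}`. -/
def TorusSmooth {d : ℕ} {F : Type*} [NormedAddCommGroup F] [NormedSpace ℝ F]
    (f : Phase d → F) : Prop :=
  ContDiff ℝ ∞ f ∧ ∀ (x : Phase d) (n : (Fin d → ℤ) × (Fin d → ℤ)), f (x + intPhase n) = f x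

/-- The fundamental domain `[0,1)^{2d}` of the torus. -/
def cube (d : ℕ) : Set (Phase d) :=
  {x | ∀ j, x.1 j ∈ Set.Ico (0 : ℝ) 1 ∧ x.2 j ∈ Set.Ico (0 : ℝ) 1}

/-- The symplectic Fourier transform on the torus, `ξ ↦ ∫_{𝕋^{2d}} exp (i ω(ξ, x)) f(x) dx`. -/
def sympFourier {d : ℕ} (f : Phase d → ℂ) (ξ : Phase d) : ℂ :=
  ∫ x in cube d, Complex.exp (Complex.I * (symp ξ x : ℝ)) * f x

/-- The Weyl quantization of `f ∈ C^∞(𝕋^{2d})`,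
`Op^W(f) T = ∑_{n ∈ ℤ^{2d}} (𝓕 f)(2 π n) U_ħ(ħ 2 π n) T`; here `ħ 2 π n = n / N`. -/
def opW {d : ℕ} (N : ℕ+) (f : Phase d → ℂ) (T : 𝓢'(Config d, ℂ)) : 𝓢'(Config d, ℂ) :=
  ∑' n : (Fin d → ℤ) × (Fin d → ℤ),
    sympFourier f ((2 * Real.pi) • intPhase n) •
      transl (hbar N) (hbar N • ((2 * Real.pi) • intPhase n)) T

/-! ### Coherent states -/

/-- The Gaussian `η_ħ(q) = (π ħ)^{-d/4} exp (-|q|² / (2 ħ))`, i.e. `ħ^{-d/4} η(q / ħ^{1/2})` with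
`η(q) = π^{-d/4} exp (-|q|² / 2)`. -/
def gaussian (d : ℕ) (N : ℕ+) (q : Config d) : ℂ :=
  (((Real.pi * hbar N) ^ (-(d : ℝ) / 4) * Real.exp (-‖q‖ ^ 2 / (2 * hbar N)) : ℝ) : ℂ)

lemma hasTemperateGrowth_gaussian (d : ℕ) (N : ℕ+) : (gaussian d N).HasTemperateGrowth := by
  have h1 : (fun q : Config d => ‖q‖ ^ 2).HasTemperateGrowth :=
    Function.hasTemperateGrowth_norm_sq (Config d)
  have h2 := hasTemperateGrowth_cexp (((-(1 / (2 * hbar N)) : ℝ)) : ℂ) h1 (fun x => by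
    have := hbar_pos N
    rw [Complex.ofReal_re]
    exact mul_nonpos_of_nonpos_of_nonneg (by simp [this.le]) (by positivity))
  have h3 := (Function.HasTemperateGrowth.const (E := Config d)
    ((((Real.pi * hbar N) ^ (-(d : ℝ) / 4) : ℝ)) : ℂ)).mul h2
  have h4 : gaussian d N = (fun _ => ((((Real.pi * hbar N) ^ (-(d : ℝ) / 4) : ℝ)) : ℂ)) *
      fun q : Config d =>
        Complex.exp (((-(1 / (2 * hbar N)) : ℝ) : ℂ) * ((‖q‖ ^ 2 : ℝ) : ℂ)) := by
    funext q
    simp only [gaussian, Pi.mul_apply, Complex.ofReal_mul, Complex.ofReal_exp]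
    congr 2
    push_cast
    ring
  rw [h4]
  exact h3

/-- `η_ħ` as a tempered distribution. -/
def gaussianDist (d : ℕ) (N : ℕ+) : 𝓢'(Config d, ℂ) :=
  (hasTemperateGrowth_gaussian d N).toTemperedDistribution volume

/-- `S_ħ(κ) = (∑_{n_p} exp (-i κ_q · n_p) U_ħ(0, n_p)) (∑_{n_q} exp (i κ_p · n_q) U_ħ(n_q, 0))`,
the sums being over `ℤ^d`; the series converge on Schwartz functions, in the space of tempered
distributions. -/
def project {d : ℕ} (N : ℕ+) (κ : Phase d) (T : 𝓢'(Config d, ℂ)) : 𝓢'(Config d, ℂ) :=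
  ∑' n : Fin d → ℤ, Complex.exp (-Complex.I * (inner ℝ κ.1 (intVec n) : ℝ)) •
    transl (hbar N) (0, intVec n)
      (∑' m : Fin d → ℤ, Complex.exp (Complex.I * (inner ℝ κ.2 (intVec m) : ℝ)) •
        transl (hbar N) (intVec m, 0) T)

/-- The coherent state `η^a_{ħ,κ} = S_ħ(κ) U_ħ(a) η_ħ` on the torus. -/
def coherent {d : ℕ} (N : ℕ+) (κ : Phase d) (a : Phase d) : 𝓢'(Config d, ℂ) :=
  project N κ (transl (hbar N) a (gaussianDist d N))

/-- The coordinates, in the orthonormal basis `ψ_r^κ`, of the restricted superposition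
`(2 π ħ)^{-d} ∫_{𝕋^{2d}} χ(a) ⟨η^a_{ħ,κ}, T⟩ η^a_{ħ,κ} da`. -/
def superposition {d : ℕ} (N : ℕ+) (κ : Phase d) (χ : Phase d → ℝ) (T : 𝓢'(Config d, ℂ)) :
    EuclideanSpace ℂ (Fin d → Fin (N : ℕ)) :=
  ((2 * Real.pi * hbar N) ^ d)⁻¹ • ∫ a in cube d,
    ((χ a : ℂ) * hInner N κ (coherent N κ a) T) • coords N κ (coherent N κ a)

/-! ### The two properties -/

/-- `⟨Ψ_ħ, Op^W(f) Ψ_ħ⟩ → f(0)` for all `f ∈ C^∞(𝕋^{2d})`. -/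
def ConcentratesAtZero {d : ℕ} (κ : ℕ+ → Phase d) (Ψ : ℕ+ → 𝓢'(Config d, ℂ)) : Prop :=
  ∀ f : Phase d → ℂ, TorusSmooth f →
    Tendsto (fun N => hInner N (κ N) (Ψ N) (opW N f (Ψ N))) atTop (𝓝 (f 0))

/-- `r_ħ → 0` are positive numbers, and `χ_ħ ∈ C^∞(𝕋^{2d})`, `0 ≤ χ_ħ ≤ 1`, is supported in the
ball of radius `r_ħ` of the torus (for the Euclidean distance) centred at `0`. -/
structure IsCutoffFamily {d : ℕ} (r : ℕ+ → ℝ) (χ : ℕ+ → Phase d → ℝ) : Prop where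
  pos : ∀ N, 0 < r N
  tendsto : Tendsto r atTop (𝓝 0)
  smooth : ∀ N, TorusSmooth (χ N)
  nonneg : ∀ N a, 0 ≤ χ N a
  le_one : ∀ N a, χ N a ≤ 1
  support : ∀ N a, χ N a ≠ 0 → ∃ n : (Fin d → ℤ) × (Fin d → ℤ),
    ‖a.1 - intVec n.1‖ ^ 2 + ‖a.2 - intVec n.2‖ ^ 2 ≤ r N ^ 2

/-- `‖Ψ_ħ - (2 π ħ)^{-d} ∫ χ_ħ(a) ⟨η^a_{ħ,κ}, Ψ_ħ⟩ η^a_{ħ,κ} da‖ → 0`. -/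
def ApproxBySuperposition {d : ℕ} (κ : ℕ+ → Phase d) (Ψ : ℕ+ → 𝓢'(Config d, ℂ))
    (χ : ℕ+ → Phase d → ℝ) : Prop :=
  Tendsto (fun N => ‖coords N (κ N) (Ψ N) - superposition N (κ N) (χ N) (Ψ N)‖) atTop (𝓝 0)

end TorusQuantum

end

open TorusQuantum

/-!
Write `⟨f⟩_W = ⟨Ψ, Op^W(f) Ψ⟩`, and let `h(a) = (2πħ)^{-d} |⟨η^a_{ħ,κ}, Ψ⟩|²` be the Husimi
density of `Ψ`. A Gaussian integral, unfolded from the torus to `ℝ^d`, shows that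
`∫ e^{2πi ω(a, n)} h(a) da` is `⟨Ψ, U_ħ(n/N) Ψ⟩` times the factor `exp(-π|n|²/(2N))`. For `n = 0`
this gives `∫ h = ‖Ψ‖²`, which is the resolution of the identity by coherent states. Since the
factor tends to `1` and the Fourier coefficients of a smooth `f` are summable, `⟨f⟩_W - ∫ f h → 0`
for bounded `Ψ`, so (A) says that the densities `h` converge weakly to the point mass at `0`.

Let `u` be the error vector in (B). By the resolution of the identity `u` is the superposition of
coherent states with weight `1 - χ`, and hence `‖u‖² ≤ ∫ (1 - χ)² h` and
`∫ (1 - χ) h = ⟨Ψ, u⟩ ≤ ‖Ψ‖ ‖u‖`. So (B) is equivalent to `h` having vanishing mass outside the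
cutoff; in the direct part the radius shrinks along a diagonal sequence.
-/

noncomputable section

namespace TorusQuantum

/-! ### Decay and summation over the lattice -/

/-- The weight `(1 + ‖x‖)^{-M}`, which measures decay at infinity. -/
def decayWeight {E : Type*} [SeminormedAddCommGroup E] (M : ℕ) (x : E) : ℝ := ((1 + ‖x‖) ^ M)⁻¹

section DecayWeight

variable {E : Type*} [SeminormedAddCommGroup E]

lemma decayWeight_nonneg (M : ℕ) (x : E) : 0 ≤ decayWeight M x := by
  unfold decayWeight; positivity

/-- Peetre's inequality. -/
lemma decayWeight_add_le (M : ℕ) (x y : E) :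
    decayWeight M (x + y) ≤ (1 + ‖y‖) ^ M * decayWeight M x := by
  have h : 1 + ‖x‖ ≤ (1 + ‖y‖) * (1 + ‖x + y‖) := by
    have : ‖x‖ ≤ ‖x + y‖ + ‖y‖ := by simpa using norm_sub_le (x + y) y
    nlinarith [norm_nonneg y, norm_nonneg (x + y)]
  unfold decayWeight
  rw [inv_le_iff_one_le_mul₀ (by positivity), mul_right_comm, ← mul_pow, ← div_eq_mul_inv,
    one_le_div (by positivity)]
  gcongr

end DecayWeight

section Lattice

variable {ι : Type*}

/-- The embedding of the lattice `ℤ^ι` into `ℝ^ι`; for `ι = Fin d` it is `intVec`. -/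
def latVec : (ι → ℤ) →+ EuclideanSpace ℝ ι where
  toFun n := WithLp.toLp 2 fun j => (n j : ℝ)
  map_zero' := by ext j; simp
  map_add' m n := by ext j; simp

@[simp] lemma latVec_apply (n : ι → ℤ) (j : ι) : latVec n j = n j := rfl

lemma latVec_injective : Function.Injective (latVec (ι := ι)) := fun m n h => by
  funext j
  simpa using congrArg (fun v => v j) h

variable [Fintype ι]

lemma inner_latVec (n : ι → ℤ) (x : EuclideanSpace ℝ ι) :
    inner ℝ (latVec n) x = ∑ i, (n i : ℝ) * x i := by
  simp [PiLp.inner_apply, mul_comm]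

variable (ι) in
lemma exists_summable_decayWeight_latVec :
    ∃ M, Summable fun n : ι → ℤ => decayWeight M (latVec n) := by
  classical
  let b := (EuclideanSpace.basisFun ι ℝ).toBasis
  let L := Submodule.span ℤ (Set.range b)
  have latVec_mem (n : ι → ℤ) : latVec n ∈ L := by
    have : latVec n = ∑ i, n i • b i := by
      ext j
      simp [b, Finset.sum_apply, Pi.single_apply]
    rw [this]
    exact Submodule.sum_mem _ fun i _ => Submodule.smul_mem _ _ (Submodule.subset_span ⟨i, rfl⟩)
  have hL := (ZLattice.summable_norm_pow_inv L _ (Nat.lt_succ_self _)).comp_injective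
    (i := fun n : ι → ℤ => (⟨latVec n, latVec_mem n⟩ : L))
    fun m n h => latVec_injective (congrArg Subtype.val h)
  refine ⟨Module.finrank ℤ L + 1, hL.of_norm_bounded_eventually ?_⟩
  refine (Set.finite_singleton (0 : ι → ℤ)).subset fun n hn => ?_
  simp only [Set.mem_compl_iff, Set.mem_ofPred_eq] at hn
  by_contra hne
  have hpos : 0 < ‖latVec n‖ := norm_pos_iff.mpr ((map_ne_zero_iff _ latVec_injective).mpr hne)
  refine hn (show ‖decayWeight _ (latVec n)‖ ≤ _ from ?_)
  rw [Real.norm_of_nonneg (decayWeight_nonneg _ _), decayWeight, ← inv_pow]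
  simp only [Function.comp_apply, inv_pow]
  gcongr
  · simp

end Lattice

section SchwartzDecay

variable {E F : Type*} [NormedAddCommGroup E] [NormedSpace ℝ E]
  [NormedAddCommGroup F] [NormedSpace ℝ F]

lemma norm_iteratedFDeriv_le_sup_seminorm_mul_decayWeight (𝕜 : Type*) [NormedField 𝕜]
    [NormedSpace 𝕜 F] [SMulCommClass ℝ 𝕜 F] (φ : 𝓢(E, F)) {i n : ℕ} (hi : i ≤ n) (M : ℕ) (x : E) :
    ‖iteratedFDeriv ℝ i φ x‖ ≤
      2 ^ M * (Finset.Iic (M, n)).sup (schwartzSeminormFamily 𝕜 E F) φ * decayWeight M x := by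
  rw [decayWeight, ← div_eq_mul_inv, le_div_iff₀ (by positivity), mul_comm]
  exact one_add_le_sup_seminorm_apply (m := (M, n)) le_rfl hi φ x

lemma norm_le_sup_seminorm_mul_decayWeight (𝕜 : Type*) [NormedField 𝕜]
    [NormedSpace 𝕜 F] [SMulCommClass ℝ 𝕜 F] (φ : 𝓢(E, F)) (M : ℕ) (x : E) :
    ‖φ x‖ ≤ 2 ^ M * (Finset.Iic (M, 0)).sup (schwartzSeminormFamily 𝕜 E F) φ * decayWeight M x := by
  simpa only [norm_iteratedFDeriv_zero] using
    norm_iteratedFDeriv_le_sup_seminorm_mul_decayWeight 𝕜 φ (le_refl 0) M x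

lemma exists_norm_iteratedFDeriv_le_decayWeight (φ : 𝓢(E, F)) (M n : ℕ) :
    ∃ A, 0 ≤ A ∧ ∀ i ≤ n, ∀ x, ‖iteratedFDeriv ℝ i φ x‖ ≤ A * decayWeight M x :=
  ⟨_, by positivity, fun _ hi x =>
    norm_iteratedFDeriv_le_sup_seminorm_mul_decayWeight ℝ φ hi M x⟩

lemma exists_norm_le_decayWeight (φ : 𝓢(E, F)) (M : ℕ) :
    ∃ A, 0 ≤ A ∧ ∀ x, ‖φ x‖ ≤ A * decayWeight M x :=
  ⟨_, by positivity, norm_le_sup_seminorm_mul_decayWeight ℝ φ M⟩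

end SchwartzDecay

section SchwartzSeries

variable {α 𝕜 E F : Type*} [NormedAddCommGroup E] [NormedSpace ℝ E] [NormedAddCommGroup F]
  [NormedSpace ℝ F] [CompleteSpace F] [NormedField 𝕜] [NormedSpace 𝕜 F] [SMulCommClass ℝ 𝕜 F]
  {f : α → 𝓢(E, F)} (hf : ∀ k n, Summable fun i => SchwartzMap.seminorm 𝕜 k n (f i))

include hf

lemma contDiff_tsum_of_summable_seminorm : ContDiff ℝ ∞ fun x => ∑' i, f i x :=
  contDiff_tsum (N := ⊤) (fun i => (f i).smooth') (fun n _ => hf 0 n) fun n i x _ => by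
    simpa using SchwartzMap.le_seminorm 𝕜 0 n (f i) x

lemma hasSum_iteratedFDeriv_of_summable_seminorm (n : ℕ) (x : E) :
    HasSum (fun i => iteratedFDeriv ℝ n (f i) x)
      (iteratedFDeriv ℝ n (fun y => ∑' i, f i y) x) := by
  have hsmooth (i : α) : ContDiff ℝ ∞ (f i) := (f i).smooth'
  have hle (k : ℕ) (i : α) (y : E) :
      ‖iteratedFDeriv ℝ k (f i) y‖ ≤ SchwartzMap.seminorm 𝕜 0 k (f i) := by
    simpa using SchwartzMap.le_seminorm 𝕜 0 k (f i) y
  rw [iteratedFDeriv_tsum_apply (N := ⊤) hsmooth (fun k _ => hf 0 k)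
    (fun k i y _ => hle k i y) (mod_cast le_top)]
  exact (Summable.of_norm_bounded (hf 0 n) fun i => hle n i x).hasSum

lemma norm_pow_mul_iteratedFDeriv_tsum_le (k n : ℕ) (x : E) :
    ‖x‖ ^ k * ‖iteratedFDeriv ℝ n (fun y => ∑' i, f i y) x‖ ≤
      ∑' i, SchwartzMap.seminorm 𝕜 k n (f i) := by
  rw [← (hasSum_iteratedFDeriv_of_summable_seminorm hf n x).tsum_eq,
    ← Real.norm_of_nonneg (pow_nonneg (norm_nonneg x) k), ← norm_smul, ← tsum_const_smul'']
  refine tsum_of_norm_bounded (hf k n).hasSum fun i => ?_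
  rw [norm_smul, norm_pow, norm_norm]
  exact SchwartzMap.le_seminorm 𝕜 k n (f i) x

lemma exists_schwartzMap_coe_eq_tsum : ∃ G : 𝓢(E, F), ∀ x, G x = ∑' i, f i x :=
  ⟨{ toFun := fun x => ∑' i, f i x
     smooth' := contDiff_tsum_of_summable_seminorm hf
     decay' := fun k n => ⟨_, norm_pow_mul_iteratedFDeriv_tsum_le hf k n⟩ }, fun _ => rfl⟩

lemma hasSum_apply_of_summable_seminorm {G : 𝓢(E, F)} (hG : ∀ x, G x = ∑' i, f i x) (x : E) :
    HasSum (fun i => f i x) (G x) := by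
  rw [hG]
  refine (Summable.of_norm_bounded (hf 0 0) fun i => ?_).hasSum
  simpa using SchwartzMap.le_seminorm 𝕜 0 0 (f i) x

lemma seminorm_le_tsum {G : 𝓢(E, F)} (hG : ∀ x, G x = ∑' i, f i x) (k n : ℕ) :
    SchwartzMap.seminorm 𝕜 k n G ≤ ∑' i, SchwartzMap.seminorm 𝕜 k n (f i) := by
  refine SchwartzMap.seminorm_le_bound 𝕜 k n _ (tsum_nonneg fun _ => apply_nonneg _ _) fun x => ?_
  rw [show ⇑G = _ from funext hG]
  exact norm_pow_mul_iteratedFDeriv_tsum_le hf k n x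

lemma hasSum_of_summable_seminorm {G : 𝓢(E, F)} (hG : ∀ x, G x = ∑' i, f i x) : HasSum f G := by
  rw [HasSum, SummationFilter.unconditional_filter,
    (schwartz_withSeminorms 𝕜 E F).tendsto_nhds]
  rintro ⟨k, n⟩ ε hε
  filter_upwards [(tendsto_tsum_compl_atTop_zero fun i =>
    SchwartzMap.seminorm 𝕜 k n (f i)).eventually (gt_mem_nhds hε)] with s hs
  have htail (x : E) : (G - ∑ i ∈ s, f i) x = ∑' i : {i // i ∉ s}, f i x := by
    refine ((s.hasSum_compl_iff (f := fun i => f i x)).mpr ?_).tsum_eq.symm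
    simpa using hasSum_apply_of_summable_seminorm hf hG x
  change SchwartzMap.seminorm 𝕜 k n _ < ε
  rw [map_sub_rev]
  exact (seminorm_le_tsum (f := fun i : {i // i ∉ s} => f i)
    (fun k n => (hf k n).subtype _) htail k n).trans_lt hs

end SchwartzSeries

section SchwartzProducts

variable {E : Type*} [NormedAddCommGroup E] [NormedSpace ℝ E]

/-- The pointwise product of Schwartz functions. -/
def schwartzMul (θ φ : 𝓢(E, ℂ)) : 𝓢(E, ℂ) := SchwartzMap.smulLeftCLM ℂ θ φ

lemma schwartzMul_apply (θ φ : 𝓢(E, ℂ)) (x : E) : schwartzMul θ φ x = θ x * φ x := by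
  simp [schwartzMul, SchwartzMap.smulLeftCLM_apply_apply θ.hasTemperateGrowth]

/-- The product of `φ` with the translate of `θ` by `a`. -/
def translMul (θ φ : 𝓢(E, ℂ)) (a : E) : 𝓢(E, ℂ) :=
  schwartzMul (SchwartzMap.compSubConstCLM ℂ a θ) φ

lemma translMul_apply (θ φ : 𝓢(E, ℂ)) (a x : E) : translMul θ φ a x = θ (x - a) * φ x := by
  simp [translMul, schwartzMul_apply]

/-- If `θ` decays faster than `(1 + ‖x‖)^{-M}` and `φ` faster than `(1 + ‖x‖)^{-M - k}`, then by
Peetre's inequality the product decays like `(1 + ‖x‖)^{-k}`, with a constant `(1 + ‖a‖)^{-M}`. -/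
lemma exists_seminorm_translMul_le (θ φ : 𝓢(E, ℂ)) (M k n : ℕ) :
    ∃ C, ∀ a, SchwartzMap.seminorm ℂ k n (translMul θ φ a) ≤ C * decayWeight M a := by
  obtain ⟨A, hA, hθ⟩ := exists_norm_iteratedFDeriv_le_decayWeight θ M n
  obtain ⟨B, hB, hφ⟩ := exists_norm_iteratedFDeriv_le_decayWeight φ (M + k) n
  refine ⟨∑ i ∈ Finset.range (n + 1), (n.choose i : ℝ) * (A * B), fun a => ?_⟩
  have hw := decayWeight_nonneg M a
  refine SchwartzMap.seminorm_le_bound ℂ k n _ (by positivity) fun x => ?_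
  have leibniz := norm_iteratedFDeriv_mul_le (𝕜 := ℝ) (n := n) (N := n)
    (f := fun x => θ (x - a)) (g := φ)
    ((θ.smooth n).comp (contDiff_id.sub contDiff_const)) (φ.smooth n) x le_rfl
  rw [show ⇑(translMul θ φ a) = fun x => θ (x - a) * φ x from funext (translMul_apply θ φ a)]
  refine (mul_le_mul_of_nonneg_left leibniz (by positivity)).trans ?_
  rw [Finset.mul_sum, Finset.sum_mul]
  refine Finset.sum_le_sum fun i hi => ?_
  rw [show iteratedFDeriv ℝ i (fun x => θ (x - a)) x = iteratedFDeriv ℝ i θ (x - a) from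
    iteratedFDeriv_comp_sub i a x]
  have peetre : decayWeight M (x - a) ≤ (1 + ‖x‖) ^ M * decayWeight M a := by
    simpa [decayWeight, norm_sub_rev, ← sub_eq_add_neg, add_comm] using decayWeight_add_le M a (-x)
  have hk : ‖x‖ ^ k ≤ (1 + ‖x‖) ^ k := by gcongr; linarith [norm_nonneg x]
  calc ‖x‖ ^ k * (n.choose i * ‖iteratedFDeriv ℝ i θ (x - a)‖ * ‖iteratedFDeriv ℝ (n - i) φ x‖)
      ≤ (1 + ‖x‖) ^ k * (n.choose i * (A * ((1 + ‖x‖) ^ M * decayWeight M a)) *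
          (B * decayWeight (M + k) x)) := by
        gcongr
        · exact (hθ i (Finset.mem_range_succ_iff.mp hi) _).trans (by gcongr)
        · exact hφ _ (Nat.sub_le _ _) x
    _ = n.choose i * (A * B) * decayWeight M a := by
        have : 1 + ‖x‖ ≠ 0 := by positivity
        rw [decayWeight, decayWeight, pow_add]
        field_simp

variable {ι : Type*} [Fintype ι]

lemma exists_hasSum_smul_translMul_latVec (θ φ : 𝓢(EuclideanSpace ℝ ι, ℂ)) {u : (ι → ℤ) → ℂ}
    (hu : ∀ m, ‖u m‖ ≤ 1) :
    ∃ G : 𝓢(EuclideanSpace ℝ ι, ℂ), HasSum (fun m => u m • translMul θ φ (latVec m)) G ∧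
      ∀ x, HasSum (fun m => u m * (θ (x - latVec m) * φ x)) (G x) := by
  obtain ⟨M, hM⟩ := exists_summable_decayWeight_latVec ι
  have hsum (k n : ℕ) :
      Summable fun m => SchwartzMap.seminorm ℂ k n (u m • translMul θ φ (latVec m)) := by
    obtain ⟨C, hC⟩ := exists_seminorm_translMul_le θ φ M k n
    refine Summable.of_nonneg_of_le (fun _ => apply_nonneg _ _) (fun m => ?_) (hM.mul_left C)
    rw [map_smul_eq_mul]
    exact (mul_le_of_le_one_left (apply_nonneg _ _) (hu m)).trans (hC _)
  obtain ⟨G, hG⟩ := exists_schwartzMap_coe_eq_tsum hsum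
  refine ⟨G, hasSum_of_summable_seminorm hsum hG, fun x => ?_⟩
  simpa [translMul_apply] using hasSum_apply_of_summable_seminorm hsum hG x

end SchwartzProducts

section TemperedSeries

variable {α E : Type*} [NormedAddCommGroup E] [NormedSpace ℝ E] {f : α → 𝓢'(E, ℂ)}

lemma hasSum_tempered_iff {S : 𝓢'(E, ℂ)} : HasSum f S ↔ ∀ φ, HasSum (fun i => f i φ) (S φ) := by
  simp only [HasSum, PointwiseConvergenceCLM.tendsto_iff_forall_tendsto]
  refine forall_congr' fun φ => ?_
  rw [show (fun s : Finset α => (∑ i ∈ s, f i) φ) = fun s => ∑ i ∈ s, f i φ from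
    funext fun s => map_sum (PointwiseConvergenceCLM.evalCLM (RingHom.id ℂ) ℂ φ) f s]

lemma summable_tempered_of_le_seminorm {w : α → ℝ} (hw : Summable w) (s : Finset (ℕ × ℕ))
    (hf : ∀ i φ, ‖f i φ‖ ≤ w i * s.sup (schwartzSeminormFamily ℂ E ℂ) φ) : Summable f := by
  have hs (φ : 𝓢(E, ℂ)) : Summable fun i => f i φ :=
    Summable.of_norm_bounded (hw.mul_right _) fun i => hf i φ
  have hbound (φ : 𝓢(E, ℂ)) :
      ‖∑' i, f i φ‖ ≤ (∑' i, ‖w i‖) * s.sup (schwartzSeminormFamily ℂ E ℂ) φ :=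
    tsum_of_norm_bounded (hw.norm.hasSum.mul_right _) fun i => (hf i φ).trans <| by
      gcongr
      exact Real.le_norm_self _
  let S : 𝓢(E, ℂ) →L[ℂ] ℂ := SchwartzMap.mkCLMtoNormedSpace (fun φ => ∑' i, f i φ)
    (fun φ ψ => by simp only [map_add, (hs φ).tsum_add (hs ψ)])
    (fun a φ => by simp only [map_smul, smul_eq_mul, tsum_mul_left, RingHom.id_apply])
    ⟨s, _, tsum_nonneg fun _ => norm_nonneg _, hbound⟩
  exact ⟨S, hasSum_tempered_iff.mpr fun φ => (hs φ).hasSum⟩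

end TemperedSeries

/-! ### The character `t ↦ exp (2πit)` and the unit cube -/

/-- The standard character `t ↦ exp (2πit)` of `ℝ`, with values in `ℂ`. -/
def ec (t : ℝ) : ℂ := Real.fourierChar t

lemma ec_eq_exp (t : ℝ) : ec t = Complex.exp (((2 * Real.pi * t : ℝ) : ℂ) * Complex.I) :=
  Real.fourierChar_apply t

lemma ec_add (s t : ℝ) : ec (s + t) = ec s * ec t := by
  simp only [ec, AddChar.map_add_eq_mul, Circle.coe_mul]

@[simp] lemma ec_zero : ec 0 = 1 := by simp [ec]

@[simp] lemma norm_ec (t : ℝ) : ‖ec t‖ = 1 := Circle.norm_coe _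

lemma ec_neg (t : ℝ) : ec (-t) = (ec t)⁻¹ := by
  simp only [ec, AddChar.map_neg_eq_inv, Circle.coe_inv]

lemma ec_sub (s t : ℝ) : ec (s - t) = ec s * ec (-t) := by rw [sub_eq_add_neg, ec_add]

lemma ec_ne_zero (t : ℝ) : ec t ≠ 0 := Circle.coe_ne_zero _

lemma conj_ec (t : ℝ) : (starRingEnd ℂ) (ec t) = ec (-t) := by
  rw [ec_neg, ec, ← Circle.coe_inv_eq_conj, Circle.coe_inv]

@[simp] lemma ec_intCast (n : ℤ) : ec n = 1 := by
  rw [ec_eq_exp, Complex.exp_eq_one_iff]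
  exact ⟨n, by push_cast; ring⟩

lemma ec_eq_of_eq_add_intCast {s t : ℝ} (n : ℤ) (h : s = t + n) : ec s = ec t := by
  rw [h, ec_add, ec_intCast, mul_one]

@[fun_prop] lemma continuous_ec : Continuous ec := by unfold ec; fun_prop

lemma ec_sum {α : Type*} (s : Finset α) (f : α → ℝ) : ec (∑ i ∈ s, f i) = ∏ i ∈ s, ec (f i) := by
  classical
  induction s using Finset.induction_on with
  | empty => simp
  | insert a s ha ih => rw [Finset.sum_insert ha, Finset.prod_insert ha, ec_add, ih]

section UnitCube

variable {ι : Type*}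

variable (ι) in
/-- The unit cube `[0, 1)^ι`, a fundamental domain for the lattice `ℤ^ι`. -/
def unitCube : Set (EuclideanSpace ℝ ι) := {x | ∀ j, x j ∈ Set.Ico (0 : ℝ) 1}

lemma sub_latVec_mem_unitCube_iff {x : EuclideanSpace ℝ ι} {m : ι → ℤ} :
    x - latVec m ∈ unitCube ι ↔ m = fun i => ⌊x i⌋ := by
  rw [eq_comm, funext_iff]
  refine forall_congr' fun i => ?_
  rw [Int.floor_eq_iff]
  simp [sub_lt_iff_lt_add']

lemma unitCube_eq_preimage_univ_pi :
    unitCube ι = (MeasurableEquiv.toLp 2 (ι → ℝ)).symm ⁻¹' Set.univ.pi fun _ => Set.Ico 0 1 := by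
  ext x; simp [unitCube]

lemma measurableSet_unitCube [Countable ι] : MeasurableSet (unitCube ι) := by
  rw [unitCube_eq_preimage_univ_pi]
  exact (MeasurableSet.univ_pi fun _ => measurableSet_Ico).preimage (MeasurableEquiv.measurable _)

variable [Fintype ι]

lemma ec_inner_latVec_add_latVec (n m : ι → ℤ) (x : EuclideanSpace ℝ ι) :
    ec (inner ℝ (latVec n) (x + latVec m)) = ec (inner ℝ (latVec n) x) := by
  refine ec_eq_of_eq_add_intCast (∑ i, n i * m i) ?_
  rw [inner_add_right, inner_latVec n (latVec m)]
  push_cast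
  rfl

lemma norm_le_sqrt_card {x : EuclideanSpace ℝ ι} (hx : ∀ i, |x i| ≤ 1) :
    ‖x‖ ≤ √(Fintype.card ι) := by
  rw [EuclideanSpace.norm_eq]
  refine Real.sqrt_le_sqrt ((Finset.sum_le_sum fun i _ => ?_).trans_eq (b := ∑ _i : ι, 1) (by simp))
  exact pow_le_one₀ (norm_nonneg _) (hx i)

lemma norm_le_of_mem_unitCube {x : EuclideanSpace ℝ ι} (hx : x ∈ unitCube ι) :
    ‖x‖ ≤ √(Fintype.card ι) :=
  norm_le_sqrt_card fun i => abs_le.mpr ⟨by linarith [(hx i).1], (hx i).2.le⟩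

lemma volume_unitCube : volume (unitCube ι) = 1 := by
  rw [unitCube_eq_preimage_univ_pi]
  refine ((PiLp.volume_preserving_ofLp ι).measure_preimage
    (MeasurableSet.univ_pi fun _ => measurableSet_Ico).nullMeasurableSet).trans ?_
  simp [volume_pi_pi]

instance : IsProbabilityMeasure ((volume : Measure (EuclideanSpace ℝ ι)).restrict (unitCube ι)) :=
  ⟨by rw [Measure.restrict_apply_univ, volume_unitCube]⟩

variable {E : Type*} [NormedAddCommGroup E] [NormedSpace ℝ E]

/- `Ioc 0 (0 + 1)` is the form of the fundamental domain in `UnitAddTorus.integral_preimage`. -/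
lemma setIntegral_unitCube (f : EuclideanSpace ℝ ι → E) :
    ∫ x in unitCube ι, f x =
      ∫ x in {x : ι → ℝ | ∀ i, x i ∈ Set.Ioc (0 : ℝ) (0 + 1)}, f (WithLp.toLp 2 x) := by
  have hae : {x : ι → ℝ | ∀ i, x i ∈ Set.Ioc (0 : ℝ) (0 + 1)} =ᵐ[volume]
      Set.univ.pi fun _ => Set.Ico 0 1 := by
    rw [show {x : ι → ℝ | ∀ i, x i ∈ Set.Ioc (0 : ℝ) (0 + 1)} = Set.univ.pi fun _ => Set.Ioc 0 1 by
      ext x; simp]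
    exact Measure.univ_pi_Ioc_ae_eq_Icc.trans Measure.univ_pi_Ico_ae_eq_Icc.symm
  rw [setIntegral_congr_set hae, unitCube_eq_preimage_univ_pi,
    ← (PiLp.volume_preserving_ofLp ι).setIntegral_preimage_emb
      (MeasurableEquiv.toLp 2 (ι → ℝ)).symm.measurableEmbedding]
  rfl

lemma hasSum_integral_unitCube_add_latVec {F : EuclideanSpace ℝ ι → E} (hF : Integrable F) :
    HasSum (fun m : ι → ℤ => ∫ x in unitCube ι, F (x + latVec m)) (∫ x, F x) := by
  let s : (ι → ℤ) → Set (EuclideanSpace ℝ ι) := fun m => (· - latVec m) ⁻¹' unitCube ι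
  have mem_s (m : ι → ℤ) (x : EuclideanSpace ℝ ι) : x ∈ s m ↔ m = fun i => ⌊x i⌋ :=
    sub_latVec_mem_unitCube_iff
  have pairwise_disjoint : Pairwise (Function.onFun Disjoint s) := fun m n hmn =>
    Set.disjoint_left.mpr fun x hm hn => hmn (((mem_s m x).mp hm).trans ((mem_s n x).mp hn).symm)
  have iUnion_eq : ⋃ m, s m = Set.univ :=
    Set.eq_univ_of_forall fun x => Set.mem_iUnion.mpr ⟨_, (mem_s _ x).mpr rfl⟩
  have h := hasSum_integral_iUnion (μ := volume)
    (fun m => measurableSet_unitCube.preimage (measurable_sub_const (latVec m)))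
    pairwise_disjoint hF.integrableOn
  rw [iUnion_eq, Measure.restrict_univ] at h
  refine h.congr_fun fun m => ?_
  rw [← (measurePreserving_sub_right volume (latVec m)).setIntegral_preimage_emb
    (measurableEmbedding_subRight _) (fun x => F (x + latVec m)) (unitCube ι)]
  simp

end UnitCube

/-! ### Fourier series and Poisson summation on `ℝ^ι` -/

section FourierSeries

variable {ι : Type*} {F : EuclideanSpace ℝ ι → ℂ}

lemma exists_continuousMap_unitAddTorus_coe_eq (hF : Continuous F)
    (hper : ∀ x m, F (x + latVec m) = F x) :
    ∃ f : C(UnitAddTorus ι, ℂ), ∀ x : ι → ℝ, f (fun i => (x i : UnitAddCircle)) =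
      F (WithLp.toLp 2 x) := by
  let π : C(ι → ℝ, UnitAddTorus ι) := ⟨fun x i => (x i : UnitAddCircle), by fun_prop⟩
  have hπ : Topology.IsQuotientMap π :=
    (IsOpenQuotientMap.piMap fun _ => QuotientAddGroup.isOpenQuotientMap_mk).isQuotientMap
  let g : C(ι → ℝ, ℂ) := ⟨fun x => F (WithLp.toLp 2 x), hF.comp (PiLp.continuous_toLp 2 _)⟩
  have hg : Function.FactorsThrough g π := fun x y hxy => by
    have (i : ι) : ∃ m : ℤ, y i + m = x i := by
      obtain ⟨m, hm⟩ := AddSubgroup.mem_zmultiples_iff.mp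
        (QuotientAddGroup.eq_iff_sub_mem.mp (congrFun hxy i))
      exact ⟨m, by rw [zsmul_one] at hm; linarith⟩
    choose m hm using this
    have hxm : WithLp.toLp 2 x = WithLp.toLp 2 y + latVec m := by
      ext i
      exact (hm i).symm
    simp only [g, ContinuousMap.coe_mk, hxm, hper]
  exact ⟨hπ.lift g hg, fun x => congrArg (· x) (hπ.lift_comp g hg)⟩

variable [Fintype ι]

/-- The Fourier coefficients of a `ℤ^ι`-periodic function on `ℝ^ι`. -/
def cubeCoeff (F : EuclideanSpace ℝ ι → ℂ) (n : ι → ℤ) : ℂ :=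
  ∫ x in unitCube ι, ec (-inner ℝ (latVec n) x) * F x

lemma mFourier_coe_eq_ec (n : ι → ℤ) (x : ι → ℝ) :
    UnitAddTorus.mFourier n (fun i => (x i : UnitAddCircle)) =
      ec (inner ℝ (latVec n) (WithLp.toLp 2 x)) := by
  rw [inner_latVec, ec_sum, UnitAddTorus.mFourier]
  simp only [ContinuousMap.coe_mk]
  refine Finset.prod_congr rfl fun i _ => ?_
  rw [fourier_coe_apply, ec_eq_exp]
  congr 1
  push_cast
  ring

lemma integral_unitCube_ec_inner_latVec (n : ι → ℤ) :
    ∫ x in unitCube ι, ec (inner ℝ (latVec n) x) = if n = 0 then 1 else 0 := by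
  have h := orthonormal_iff_ite.mp (UnitAddTorus.orthonormal_mFourier (d := ι)) 0 n
  simp only [UnitAddTorus.mFourierLp, ContinuousMap.inner_toLp, UnitAddTorus.mFourier_zero] at h
  rw [setIntegral_unitCube, if_congr eq_comm rfl rfl, ← h]
  refine Eq.trans ?_ (UnitAddTorus.integral_preimage _ fun _ => 0).symm
  simp [← mFourier_coe_eq_ec]

theorem hasSum_cubeCoeff_mul_ec (hF : Continuous F) (hper : ∀ x m, F (x + latVec m) = F x)
    (hs : Summable (cubeCoeff F)) (x : EuclideanSpace ℝ ι) :
    HasSum (fun n => cubeCoeff F n * ec (inner ℝ (latVec n) x)) (F x) := by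
  obtain ⟨f, hf⟩ := exists_continuousMap_unitAddTorus_coe_eq hF hper
  have hcoeff : UnitAddTorus.mFourierCoeff f = cubeCoeff F := by
    funext n
    rw [UnitAddTorus.mFourierCoeff_eq_integral _ n fun _ => 0, cubeCoeff, setIntegral_unitCube]
    simp only [smul_eq_mul, mFourier_coe_eq_ec, map_neg, inner_neg_left, hf]
  have h := UnitAddTorus.hasSum_mFourier_series_apply_of_summable (f := f) (hcoeff ▸ hs)
    (fun i => (x i : UnitAddCircle))
  simpa only [hcoeff, smul_eq_mul, mFourier_coe_eq_ec, hf] using h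

end FourierSeries

section Poisson

lemma hasSum_integral_of_norm_le {α X E : Type*} [Countable α] [MeasurableSpace X] {μ : Measure X}
    [IsFiniteMeasure μ] [NormedAddCommGroup E] [NormedSpace ℝ E] [CompleteSpace E]
    {f : α → X → E} {v : α → ℝ} (hv : Summable v) (hm : ∀ i, AEStronglyMeasurable (f i) μ)
    (hf : ∀ i, ∀ᵐ x ∂μ, ‖f i x‖ ≤ v i) :
    HasSum (fun i => ∫ x, f i x ∂μ) (∫ x, ∑' i, f i x ∂μ) := by
  refine hasSum_integral_of_dominated_convergence (fun i _ => v i) hm hf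
    (Eventually.of_forall fun _ => hv) (integrable_const _) ?_
  filter_upwards [ae_all_iff.mpr hf] with x hx
  exact (Summable.of_norm_bounded hv hx).hasSum

lemma tsum_add_latVec_add_latVec {ι E : Type*} [AddCommMonoid E] [TopologicalSpace E]
    (φ : EuclideanSpace ℝ ι → E) (x : EuclideanSpace ℝ ι) (m : ι → ℤ) :
    ∑' k : ι → ℤ, φ (x + latVec m + latVec k) = ∑' k : ι → ℤ, φ (x + latVec k) := by
  rw [← (Equiv.addLeft m).tsum_eq fun k => φ (x + latVec k)]
  simp [add_assoc]

variable {ι : Type*} [Fintype ι]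

lemma exists_summable_norm_add_latVec_le {E : Type*} [NormedAddCommGroup E] [NormedSpace ℝ E]
    (φ : 𝓢(EuclideanSpace ℝ ι, E)) (R : ℝ) :
    ∃ v : (ι → ℤ) → ℝ, Summable v ∧ ∀ x, ‖x‖ ≤ R → ∀ m, ‖φ (x + latVec m)‖ ≤ v m := by
  obtain ⟨M, hM⟩ := exists_summable_decayWeight_latVec ι
  obtain ⟨A, hA, hφ⟩ := exists_norm_le_decayWeight φ M
  refine ⟨fun m => A * ((1 + R) ^ M * decayWeight M (latVec m)), (hM.mul_left _).mul_left A,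
    fun x hx m => (hφ _).trans ?_⟩
  rw [add_comm x]
  have := decayWeight_nonneg M (latVec m)
  refine mul_le_mul_of_nonneg_left ((decayWeight_add_le M (latVec m) x).trans ?_) hA
  gcongr

lemma summable_add_latVec {E : Type*} [NormedAddCommGroup E] [NormedSpace ℝ E] [CompleteSpace E]
    (φ : 𝓢(EuclideanSpace ℝ ι, E)) (x : EuclideanSpace ℝ ι) :
    Summable fun m : ι → ℤ => φ (x + latVec m) := by
  obtain ⟨v, hv, hb⟩ := exists_summable_norm_add_latVec_le φ ‖x‖
  exact Summable.of_norm_bounded hv fun m => hb x le_rfl m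

lemma continuous_tsum_add_latVec {E : Type*} [NormedAddCommGroup E] [NormedSpace ℝ E]
    [CompleteSpace E] (φ : 𝓢(EuclideanSpace ℝ ι, E)) :
    Continuous fun x => ∑' m : ι → ℤ, φ (x + latVec m) := by
  refine continuous_iff_continuousAt.mpr fun x => ?_
  obtain ⟨v, hv, hb⟩ := exists_summable_norm_add_latVec_le φ (‖x‖ + 1)
  have : ContinuousOn (fun x => ∑' m : ι → ℤ, φ (x + latVec m)) (Metric.ball x 1) :=
    continuousOn_tsum (fun m => by fun_prop) hv fun m y hy =>
      hb y (norm_le_norm_add_const_of_dist_le (Metric.mem_ball.mp hy).le) m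
  exact this.continuousAt (Metric.ball_mem_nhds x one_pos)

lemma fourier_eq_integral_ec_mul {E : Type*} [NormedAddCommGroup E] [InnerProductSpace ℝ E]
    [FiniteDimensional ℝ E] [MeasurableSpace E] [BorelSpace E] (φ : 𝓢(E, ℂ)) (y : E) :
    FourierTransform.fourier φ y = ∫ x, ec (-inner ℝ y x) * φ x := by
  rw [SchwartzMap.fourier_coe, Real.fourier_eq]
  simp only [real_inner_comm y]
  rfl

lemma integrable_ec_mul {E : Type*} [NormedAddCommGroup E] [InnerProductSpace ℝ E]
    [FiniteDimensional ℝ E] [MeasurableSpace E] [BorelSpace E] (φ : 𝓢(E, ℂ)) (y : E) :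
    Integrable fun x => ec (-inner ℝ y x) * φ x :=
  φ.integrable.norm.mono' (by fun_prop) (Eventually.of_forall fun x => by simp)

lemma cubeCoeff_tsum_add_latVec (φ : 𝓢(EuclideanSpace ℝ ι, ℂ)) :
    cubeCoeff (fun x => ∑' m, φ (x + latVec m)) =
      fun n => FourierTransform.fourier φ (latVec n) := by
  funext n
  rw [fourier_eq_integral_ec_mul]
  have unfolded := hasSum_integral_unitCube_add_latVec (integrable_ec_mul φ (latVec n))
  obtain ⟨v, hv, hb⟩ := exists_summable_norm_add_latVec_le φ √(Fintype.card ι)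
  have exchanged := hasSum_integral_of_norm_le (μ := volume.restrict (unitCube ι))
    (f := fun m x => ec (-inner ℝ (latVec n) (x + latVec m)) * φ (x + latVec m)) hv
    (fun m => by fun_prop) (fun m => by
      filter_upwards [ae_restrict_mem measurableSet_unitCube] with x hx
      simpa using hb x (norm_le_of_mem_unitCube hx) m)
  rw [← exchanged.unique unfolded, cubeCoeff]
  simp only [← inner_neg_left, ← map_neg, ec_inner_latVec_add_latVec, tsum_mul_left]

theorem hasSum_fourier_mul_ec (φ : 𝓢(EuclideanSpace ℝ ι, ℂ)) (x : EuclideanSpace ℝ ι) :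
    HasSum (fun n : ι → ℤ => FourierTransform.fourier φ (latVec n) * ec (inner ℝ (latVec n) x))
      (∑' m : ι → ℤ, φ (x + latVec m)) := by
  have hs : Summable (cubeCoeff fun x => ∑' m : ι → ℤ, φ (x + latVec m)) := by
    rw [cubeCoeff_tsum_add_latVec]
    simpa using summable_add_latVec (FourierTransform.fourier φ) 0
  simpa only [cubeCoeff_tsum_add_latVec] using hasSum_cubeCoeff_mul_ec
    (continuous_tsum_add_latVec φ) (tsum_add_latVec_add_latVec φ) hs x

end Poisson

/-! ### A smooth partition of unity along the lattice -/

/-- A smooth function on `ℝ`, supported in `[-1, 1]`, whose integer translates sum to `1`. -/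
def stepBump (s : ℝ) : ℝ := Real.smoothTransition (s + 1) - Real.smoothTransition s

lemma stepBump_eq_zero {s : ℝ} (h : 1 ≤ |s|) : stepBump s = 0 := by
  rcases le_abs.mp h with h | h
  · rw [stepBump, Real.smoothTransition.one_of_one_le (by linarith),
      Real.smoothTransition.one_of_one_le h, sub_self]
  · rw [stepBump, Real.smoothTransition.zero_of_nonpos (by linarith),
      Real.smoothTransition.zero_of_nonpos (by linarith), sub_zero]

lemma stepBump_add_intCast_eq_zero {s : ℝ} {k : ℤ}
    (hk : k ∉ ({-⌊s⌋ - 1, -⌊s⌋} : Finset ℤ)) : stepBump (s + k) = 0 := by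
  refine stepBump_eq_zero (le_abs.mpr ?_)
  simp only [Finset.mem_insert, Finset.mem_singleton, not_or] at hk
  rcases lt_or_ge k (-⌊s⌋) with h | h
  · have : (k : ℝ) ≤ -⌊s⌋ - 2 := by exact_mod_cast (show k ≤ -⌊s⌋ - 2 by omega)
    exact Or.inr (by linarith [Int.lt_floor_add_one s])
  · have : (-⌊s⌋ + 1 : ℝ) ≤ k := by exact_mod_cast (show -⌊s⌋ + 1 ≤ k by omega)
    exact Or.inl (by linarith [Int.floor_le s])

lemma sum_stepBump_add_intCast (s : ℝ) :
    ∑ k ∈ ({-⌊s⌋ - 1, -⌊s⌋} : Finset ℤ), stepBump (s + k) = 1 := by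
  have h0 := Int.fract_nonneg s
  have h1 := Int.fract_lt_one s
  have left : s + (-⌊s⌋ - 1 : ℤ) = Int.fract s - 1 := by rw [Int.fract]; push_cast; ring
  have right : s + (-⌊s⌋ : ℤ) = Int.fract s := by rw [Int.fract]; push_cast; ring
  rw [Finset.sum_pair (by omega), left, right, stepBump, stepBump,
    Real.smoothTransition.zero_of_nonpos (x := Int.fract s - 1) (by linarith),
    Real.smoothTransition.one_of_one_le (x := Int.fract s + 1) (by linarith), sub_add_cancel]
  ring

lemma contDiff_stepBump : ContDiff ℝ ∞ stepBump :=
  (Real.smoothTransition.contDiff.comp (contDiff_id.add contDiff_const)).sub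
    Real.smoothTransition.contDiff

section Partition

variable (ι : Type*) [Fintype ι]

/-- A smooth compactly supported function on `ℝ^ι` whose lattice translates sum to `1`. -/
def latticeBump (x : EuclideanSpace ℝ ι) : ℂ := ((∏ i, stepBump (x i) : ℝ) : ℂ)

variable {ι}

lemma latticeBump_eq_zero {x : EuclideanSpace ℝ ι} {i : ι} (h : stepBump (x i) = 0) :
    latticeBump ι x = 0 := by
  rw [latticeBump, Finset.prod_eq_zero (Finset.mem_univ i) h, Complex.ofReal_zero]

lemma hasSum_latticeBump_add_latVec (x : EuclideanSpace ℝ ι) :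
    HasSum (fun m : ι → ℤ => latticeBump ι (x + latVec m)) 1 := by
  classical
  let t (i : ι) : Finset ℤ := {-⌊x i⌋ - 1, -⌊x i⌋}
  have hzero : ∀ m ∉ Fintype.piFinset t, latticeBump ι (x + latVec m) = 0 := fun m hm => by
    obtain ⟨i, hi⟩ := not_forall.mp (mt Fintype.mem_piFinset.mpr hm)
    exact latticeBump_eq_zero (stepBump_add_intCast_eq_zero hi)
  have hsum : ∑ m ∈ Fintype.piFinset t, latticeBump ι (x + latVec m) = 1 := by
    have h := Finset.prod_univ_sum t fun i k => stepBump (x i + k)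
    simp only [t, sum_stepBump_add_intCast, Finset.prod_const_one] at h
    simp only [latticeBump, PiLp.add_apply, latVec_apply]
    rw [← Complex.ofReal_sum, ← h, Complex.ofReal_one]
  exact hsum ▸ hasSum_sum_of_ne_finset_zero hzero

lemma contDiff_latticeBump : ContDiff ℝ ∞ (latticeBump ι) :=
  Complex.ofRealCLM.contDiff.comp <| contDiff_prod fun i _ => contDiff_stepBump.comp
    (EuclideanSpace.proj i : EuclideanSpace ℝ ι →L[ℝ] ℝ).contDiff

lemma hasCompactSupport_latticeBump : HasCompactSupport (latticeBump ι) := by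
  refine HasCompactSupport.intro (isCompact_closedBall (0 : EuclideanSpace ℝ ι)
    √(Fintype.card ι)) fun x hx => ?_
  contrapose! hx
  exact mem_closedBall_zero_iff.mpr <| norm_le_sqrt_card fun i =>
    (lt_of_not_ge fun hi => hx (latticeBump_eq_zero (stepBump_eq_zero hi))).le

/-- A smooth periodic function is the periodization of its product with `latticeBump`, so its
Fourier coefficients are values of the Fourier transform of a Schwartz function. -/
lemma summable_cubeCoeff {F : EuclideanSpace ℝ ι → ℂ} (hF : ContDiff ℝ ∞ F)
    (hper : ∀ x m, F (x + latVec m) = F x) : Summable (cubeCoeff F) := by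
  have hc : HasCompactSupport fun x => latticeBump ι x * F x :=
    hasCompactSupport_latticeBump.mul_right
  let φ : 𝓢(EuclideanSpace ℝ ι, ℂ) := hc.toSchwartzMap (contDiff_latticeBump.mul hF)
  have hφ : (fun x => ∑' m : ι → ℤ, φ (x + latVec m)) = F := by
    funext x
    change ∑' m : ι → ℤ, latticeBump ι (x + latVec m) * F (x + latVec m) = F x
    simp only [hper, tsum_mul_right, (hasSum_latticeBump_add_latVec x).tsum_eq, one_mul]
  rw [← hφ, cubeCoeff_tsum_add_latVec]
  simpa using summable_add_latVec (FourierTransform.fourier φ) 0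

end Partition

/-! ### Symplectic Fourier series on phase space -/

section PhaseFourier

variable {d : ℕ}

lemma intVec_eq_latVec (n : Fin d → ℤ) : intVec n = latVec n := rfl

lemma cube_eq_prod : cube d = unitCube (Fin d) ×ˢ unitCube (Fin d) := by
  ext x
  exact forall_and

/-- The linear coordinates `(q, p)` of phase space as a measurable equivalence with `ℝ^{2d}`. -/
def phaseEquiv (d : ℕ) : EuclideanSpace ℝ (Fin d ⊕ Fin d) ≃ᵐ Phase d :=
  ((MeasurableEquiv.toLp 2 (Fin d ⊕ Fin d → ℝ)).symm.trans
    (MeasurableEquiv.sumPiEquivProdPi fun _ => ℝ)).trans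
    ((MeasurableEquiv.toLp 2 (Fin d → ℝ)).prodCongr (MeasurableEquiv.toLp 2 (Fin d → ℝ)))

lemma phaseEquiv_apply (y : EuclideanSpace ℝ (Fin d ⊕ Fin d)) :
    phaseEquiv d y = (WithLp.toLp 2 fun j => y (Sum.inl j), WithLp.toLp 2 fun j => y (Sum.inr j)) :=
  rfl

lemma contDiff_phaseEquiv : ContDiff ℝ ∞ (phaseEquiv d) :=
  ContDiff.prodMk
    (contDiff_piLp 2 |>.mpr fun _ =>
      (EuclideanSpace.proj _ : EuclideanSpace ℝ (Fin d ⊕ Fin d) →L[ℝ] ℝ).contDiff)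
    (contDiff_piLp 2 |>.mpr fun _ =>
      (EuclideanSpace.proj _ : EuclideanSpace ℝ (Fin d ⊕ Fin d) →L[ℝ] ℝ).contDiff)

lemma measurePreserving_phaseEquiv : MeasurePreserving (phaseEquiv d) volume volume :=
  ((PiLp.volume_preserving_toLp (Fin d)).prod (PiLp.volume_preserving_toLp (Fin d))).comp <|
    (volume_measurePreserving_sumPiEquivProdPi fun _ : Fin d ⊕ Fin d => ℝ).comp <|
      PiLp.volume_preserving_ofLp (Fin d ⊕ Fin d)

/-- The frequency `(n_p, -n_q)`, whose inner product with `x` is `-ω(n, x)`. -/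
def freqEquiv (d : ℕ) : ((Fin d → ℤ) × (Fin d → ℤ)) ≃ (Fin d ⊕ Fin d → ℤ) :=
  ((Equiv.prodComm _ _).trans ((Equiv.refl _).prodCongr (Equiv.neg _))).trans
    (Equiv.sumArrowEquivProdArrow _ _ _).symm

lemma inner_freqEquiv (n : (Fin d → ℤ) × (Fin d → ℤ)) (y : EuclideanSpace ℝ (Fin d ⊕ Fin d)) :
    inner ℝ (latVec (freqEquiv d n)) y = -symp (intPhase n) (phaseEquiv d y) := by
  have inl (j : Fin d) : freqEquiv d n (Sum.inl j) = n.2 j := rfl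
  have inr (j : Fin d) : freqEquiv d n (Sum.inr j) = -n.1 j := rfl
  simp only [inner_latVec, Fintype.sum_sum_type, symp, intPhase, intVec_eq_latVec, inl, inr,
    phaseEquiv_apply, Int.cast_neg, neg_mul, Finset.sum_neg_distrib]
  ring

lemma exp_symp_eq_ec (n : (Fin d → ℤ) × (Fin d → ℤ)) (x : Phase d) :
    Complex.exp (Complex.I * (symp ((2 * Real.pi) • intPhase n) x : ℝ)) =
      ec (symp (intPhase n) x) := by
  rw [ec_eq_exp]
  congr 1
  simp only [symp, Prod.smul_fst, Prod.smul_snd, inner_smul_left]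
  push_cast
  simp
  ring

lemma sympFourier_eq_cubeCoeff (f : Phase d → ℂ) (n : (Fin d → ℤ) × (Fin d → ℤ)) :
    sympFourier f ((2 * Real.pi) • intPhase n) = cubeCoeff (f ∘ phaseEquiv d) (freqEquiv d n) := by
  have hcube : phaseEquiv d ⁻¹' cube d = unitCube (Fin d ⊕ Fin d) := by
    ext y
    simp only [phaseEquiv_apply, cube, unitCube, Set.mem_preimage, Set.mem_ofPred_eq, Sum.forall,
      forall_and]
  rw [sympFourier, cubeCoeff, ← measurePreserving_phaseEquiv.setIntegral_preimage_emb
    (phaseEquiv d).measurableEmbedding, hcube]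
  simp only [exp_symp_eq_ec, inner_freqEquiv, neg_neg, Function.comp_apply]

lemma TorusSmooth.comp_phaseEquiv_add_latVec {f : Phase d → ℂ} (hf : TorusSmooth f)
    (x : EuclideanSpace ℝ (Fin d ⊕ Fin d)) (m : Fin d ⊕ Fin d → ℤ) :
    (f ∘ phaseEquiv d) (x + latVec m) = (f ∘ phaseEquiv d) x :=
  hf.2 (phaseEquiv d x) (m ∘ Sum.inl, m ∘ Sum.inr)

lemma TorusSmooth.summable_cubeCoeff {f : Phase d → ℂ} (hf : TorusSmooth f) :
    Summable (cubeCoeff (f ∘ phaseEquiv d)) :=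
  TorusQuantum.summable_cubeCoeff (hf.1.comp contDiff_phaseEquiv) hf.comp_phaseEquiv_add_latVec

theorem TorusSmooth.summable_sympFourier {f : Phase d → ℂ} (hf : TorusSmooth f) :
    Summable fun n : (Fin d → ℤ) × (Fin d → ℤ) =>
      sympFourier f ((2 * Real.pi) • intPhase n) := by
  simpa only [sympFourier_eq_cubeCoeff] using!
    hf.summable_cubeCoeff.comp_injective (freqEquiv d).injective

theorem TorusSmooth.hasSum_sympFourier {f : Phase d → ℂ} (hf : TorusSmooth f) (x : Phase d) :
    HasSum (fun n : (Fin d → ℤ) × (Fin d → ℤ) =>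
      sympFourier f ((2 * Real.pi) • intPhase n) * ec (-symp (intPhase n) x)) (f x) := by
  have h := hasSum_cubeCoeff_mul_ec (hf.1.comp contDiff_phaseEquiv).continuous
    hf.comp_phaseEquiv_add_latVec hf.summable_cubeCoeff ((phaseEquiv d).symm x)
  simpa only [Function.comp_def, inner_freqEquiv, sympFourier_eq_cubeCoeff,
    MeasurableEquiv.apply_symm_apply] using (freqEquiv d).hasSum_iff.mpr h

end PhaseFourier

/-! ### Quasi-periodic sequences -/

/-- The coordinate space of `𝓗_ħ(κ)`. -/
abbrev Coord (d : ℕ) (N : ℕ+) := EuclideanSpace ℂ (Fin d → Fin (N : ℕ))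

section Sequences

variable {d : ℕ} (N : ℕ+) (κ : Phase d)

/-- The representative in `{0, …, N - 1}^d` of a residue modulo `N`. -/
def rep {N : ℕ+} (r : Fin d → Fin (N : ℕ)) : Fin d → ℤ := fun j => ((r j : ℕ) : ℤ)

/-- Division with remainder by `N` in `ℤ^d`: quotient and remainder. -/
def divEquiv : (Fin d → ℤ) ≃ (Fin d → ℤ) × (Fin d → Fin (N : ℕ)) :=
  (Equiv.piCongrRight fun _ => Int.divModEquiv (N : ℕ)).trans (Equiv.arrowProdEquivProdArrow _ _ _)

lemma divEquiv_symm_apply (k : Fin d → ℤ) (r : Fin d → Fin (N : ℕ)) :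
    (divEquiv N).symm (k, r) = rep r + (N : ℤ) • k := by
  funext j
  change k j * ((N : ℕ) : ℤ) + ((r j : ℕ) : ℤ) = _
  simp [rep, mul_comm, add_comm]

lemma divEquiv_rep_add (k : Fin d → ℤ) (r : Fin d → Fin (N : ℕ)) :
    divEquiv N (rep r + (N : ℤ) • k) = (k, r) := by
  rw [← divEquiv_symm_apply, Equiv.apply_symm_apply]

lemma rep_add_divEquiv (j : Fin d → ℤ) :
    rep (divEquiv N j).2 + (N : ℤ) • (divEquiv N j).1 = j := by
  rw [← divEquiv_symm_apply, Prod.mk.eta, Equiv.symm_apply_apply]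

variable {N} in
lemma hasSum_of_hasSum_coset {f : (Fin d → ℤ) → ℂ} (hf : Summable f)
    {g : (Fin d → Fin (N : ℕ)) → ℂ} (hg : ∀ r, HasSum (fun k => f (rep r + (N : ℤ) • k)) (g r)) :
    HasSum f (∑ r, g r) := by
  let e : (Fin d → Fin (N : ℕ)) × (Fin d → ℤ) ≃ (Fin d → ℤ) :=
    (Equiv.prodComm _ _).trans (divEquiv N).symm
  have fiberwise := (e.hasSum_iff.mpr hf.hasSum).prod_fiberwise fun r => by
    simpa [e, divEquiv_symm_apply] using hg r
  rw [(hasSum_fintype g).unique fiberwise]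
  exact hf.hasSum

lemma exists_eq_rep_add (j : Fin d → ℤ) : ∃ k r, j = rep (N := N) r + (N : ℤ) • k :=
  ⟨_, _, (rep_add_divEquiv N j).symm⟩

/-- The phase `exp (i κ_p · k)`. -/
def pChar (k : Fin d → ℤ) : ℂ := ec (inner ℝ κ.2 (intVec k) / (2 * Real.pi))

lemma exp_I_mul (t : ℝ) : Complex.exp (Complex.I * t) = ec (t / (2 * Real.pi)) := by
  rw [ec_eq_exp, mul_div_cancel₀ _ (by positivity), mul_comm]

lemma exp_neg_I_mul (t : ℝ) : Complex.exp (-Complex.I * t) = ec (-(t / (2 * Real.pi))) := by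
  rw [← neg_div, ← exp_I_mul, Complex.ofReal_neg, neg_mul_comm]

lemma pChar_add (k l : Fin d → ℤ) : pChar κ (k + l) = pChar κ k * pChar κ l := by
  simp only [pChar, intVec_eq_latVec, map_add, inner_add_right, add_div, ec_add]

@[simp] lemma pChar_zero : pChar κ 0 = 1 := by
  simp [pChar, intVec_eq_latVec]

lemma pChar_neg (k : Fin d → ℤ) : pChar κ (-k) = (starRingEnd ℂ) (pChar κ k) := by
  simp only [pChar, intVec_eq_latVec, map_neg, inner_neg_right, neg_div, conj_ec]

@[simp] lemma norm_pChar (k : Fin d → ℤ) : ‖pChar κ k‖ = 1 := norm_ec _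

/-- The relation `b (j + N k) = exp (i κ_p · k) b j`, which characterizes the weights of the
delta functions that make up an element of `𝓗_ħ(κ)`. -/
def QuasiPeriodic (b : (Fin d → ℤ) → ℂ) : Prop :=
  ∀ j k, b (j + (N : ℤ) • k) = pChar κ k * b j

/-- The quasi-periodic extension of a coordinate vector. -/
def extend (c : Coord d N) (j : Fin d → ℤ) : ℂ :=
  pChar κ (divEquiv N j).1 * c (divEquiv N j).2

/-- The coordinate vector of a quasi-periodic sequence: its values on `{0, …, N - 1}^d`. -/
def restr (b : (Fin d → ℤ) → ℂ) : Coord d N := WithLp.toLp 2 fun r => b (rep r)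

variable {N κ}

@[simp] lemma restr_apply (b : (Fin d → ℤ) → ℂ) (r : Fin d → Fin (N : ℕ)) :
    restr N b r = b (rep r) := rfl

lemma extend_rep_add (c : Coord d N) (k : Fin d → ℤ) (r : Fin d → Fin (N : ℕ)) :
    extend N κ c (rep r + (N : ℤ) • k) = pChar κ k * c r := by
  rw [extend, divEquiv_rep_add]

lemma extend_rep (c : Coord d N) (r : Fin d → Fin (N : ℕ)) : extend N κ c (rep r) = c r := by
  simpa using extend_rep_add (κ := κ) c 0 r

lemma quasiPeriodic_extend (c : Coord d N) : QuasiPeriodic N κ (extend N κ c) := by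
  intro j k
  obtain ⟨l, r, rfl⟩ := exists_eq_rep_add N j
  rw [add_assoc, ← smul_add, extend_rep_add, extend_rep_add, add_comm, pChar_add, mul_assoc]

lemma QuasiPeriodic.extend_restr {b : (Fin d → ℤ) → ℂ} (hb : QuasiPeriodic N κ b) :
    extend N κ (restr N b) = b := by
  funext j
  obtain ⟨l, r, rfl⟩ := exists_eq_rep_add N j
  rw [extend_rep_add, hb, restr_apply]

lemma restr_extend (c : Coord d N) : restr N (extend N κ c) = c := by
  ext r
  rw [restr_apply, extend_rep]

lemma extend_smul (a : ℂ) (c : Coord d N) : extend N κ (a • c) = a • extend N κ c := by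
  funext j
  simp [extend, mul_left_comm]

lemma norm_extend_le (c : Coord d N) (j : Fin d → ℤ) : ‖extend N κ c j‖ ≤ ‖c‖ := by
  rw [extend, norm_mul, norm_pChar, one_mul]
  exact PiLp.norm_apply_le c _

lemma sum_rep_add_of_periodic {F : Type*} [AddCommMonoid F] {h : (Fin d → ℤ) → F}
    (hh : ∀ j k, h (j + (N : ℤ) • k) = h j) (n : Fin d → ℤ) :
    ∑ r : Fin d → Fin (N : ℕ), h (rep r + n) = ∑ r : Fin d → Fin (N : ℕ), h (rep r) := by
  let σ (r : Fin d → Fin (N : ℕ)) := (divEquiv N (rep r + n)).2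
  have hσ (r) : ∃ k, rep r + n = rep (σ r) + (N : ℤ) • k := ⟨_, (rep_add_divEquiv N _).symm⟩
  have σ_injective : Function.Injective σ := by
    intro r s hrs
    obtain ⟨k, hk⟩ := hσ r
    obtain ⟨l, hl⟩ := hσ s
    have congruent : rep r = rep s + (N : ℤ) • (k - l) := by
      rw [eq_sub_of_add_eq hk, eq_sub_of_add_eq hl, hrs, smul_sub]
      abel
    calc r = (divEquiv N (rep r)).2 := by
          simpa using (congrArg Prod.snd (divEquiv_rep_add N 0 r)).symm
      _ = s := by rw [congruent, divEquiv_rep_add]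
  refine Fintype.sum_bijective σ (Finite.injective_iff_bijective.mp σ_injective) _ _ fun r => ?_
  obtain ⟨k, hk⟩ := hσ r
  rw [hk, hh]

end Sequences

/-! ### Combinations of the basis vectors -/

lemma decayWeight_smul_le {E : Type*} [SeminormedAddCommGroup E] [NormedSpace ℝ E] (M : ℕ) {c : ℝ}
    (hc : 0 < c) (hc' : c ≤ 1) (x : E) :
    decayWeight M (c • x) ≤ (c ^ M)⁻¹ * decayWeight M x := by
  rw [decayWeight, decayWeight, norm_smul, Real.norm_of_nonneg hc.le, ← mul_inv, ← mul_pow]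
  gcongr
  rw [mul_add, mul_one]
  gcongr

section Synthesis

variable {d : ℕ} (N : ℕ+) (κ : Phase d)

/-- The points `(j + κ_q / (2π)) / N` that carry the elements of `𝓗_ħ(κ)`. -/
def node (j : Fin d → ℤ) : Config d :=
  (N : ℝ)⁻¹ • intVec j + (2 * Real.pi * (N : ℝ))⁻¹ • κ.1

lemma natCast_pos : (0 : ℝ) < ((N : ℕ) : ℝ) := by exact_mod_cast N.pos

variable {N κ}

lemma node_add (j n : Fin d → ℤ) : node N κ (j + n) = node N κ j + (N : ℝ)⁻¹ • intVec n := by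
  simp only [node, intVec_eq_latVec, map_add, smul_add]
  abel

lemma intVec_smul (k : Fin d → ℤ) : intVec ((N : ℤ) • k) = (N : ℝ) • intVec k := by
  ext i; simp [intVec]

lemma node_add_smul (j k : Fin d → ℤ) : node N κ (j + (N : ℤ) • k) = node N κ j + intVec k := by
  rw [node_add, intVec_smul, inv_smul_smul₀ (natCast_pos N).ne']

variable (N κ) in
lemma exists_norm_apply_node_le : ∃ (v : (Fin d → ℤ) → ℝ) (s : Finset (ℕ × ℕ)), Summable v ∧
    ∀ (φ : 𝓢(Config d, ℂ)) j,
      ‖φ (node N κ j)‖ ≤ v j * s.sup (schwartzSeminormFamily ℂ (Config d) ℂ) φ := by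
  obtain ⟨M, hM⟩ := exists_summable_decayWeight_latVec (Fin d)
  set a : Config d := (2 * Real.pi * (N : ℝ))⁻¹ • κ.1
  have inv_le_one : (N : ℝ)⁻¹ ≤ 1 := inv_le_one_of_one_le₀ (by exact_mod_cast N.pos)
  have decay (j : Fin d → ℤ) : decayWeight M (node N κ j) ≤
      (1 + ‖a‖) ^ M * ((((N : ℝ)⁻¹) ^ M)⁻¹ * decayWeight M (latVec j)) :=
    (decayWeight_add_le M _ a).trans <| by
      gcongr
      exact decayWeight_smul_le M (inv_pos.mpr (natCast_pos N)) inv_le_one _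
  refine ⟨fun j => 2 ^ M * ((1 + ‖a‖) ^ M * ((((N : ℝ)⁻¹) ^ M)⁻¹ * decayWeight M (latVec j))),
    Finset.Iic (M, 0), ((hM.mul_left _).mul_left _).mul_left _, fun φ j => ?_⟩
  refine (norm_le_sup_seminorm_mul_decayWeight ℂ φ M _).trans ?_
  rw [mul_right_comm]
  exact mul_le_mul_of_nonneg_right (mul_le_mul_of_nonneg_left (decay j) (by positivity))
    (apply_nonneg _ _)

variable (N κ) in
/-- The vector of `𝓗_ħ(κ)` with given coordinates, as a tempered distribution. -/
def synth (c : Coord d N) : 𝓢'(Config d, ℂ) := ∑ r, c r • basisVec N κ r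

variable (N d) in
/-- The normalisation `N^{-d/2}` of the basis. -/
def normConst : ℝ := (N : ℝ) ^ (-(d : ℝ) / 2)

lemma normConst_pos : 0 < normConst d N := Real.rpow_pos_of_pos (natCast_pos N) _

lemma normConst_sq : normConst d N ^ 2 = ((N : ℝ) ^ d)⁻¹ := by
  rw [normConst, ← Real.rpow_natCast, ← Real.rpow_mul (natCast_pos N).le]
  rw [← Real.rpow_natCast, ← Real.rpow_neg (natCast_pos N).le]
  congr 1
  push_cast
  ring

lemma summable_mul_apply_node {b : (Fin d → ℤ) → ℂ} {C : ℝ} (hb : ∀ j, ‖b j‖ ≤ C)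
    (φ : 𝓢(Config d, ℂ)) : Summable fun j => b j * φ (node N κ j) := by
  obtain ⟨v, s, hv, hφ⟩ := exists_norm_apply_node_le N κ
  refine Summable.of_norm_bounded ((hv.mul_right
    (s.sup (schwartzSeminormFamily ℂ (Config d) ℂ) φ)).mul_left C) fun j => ?_
  rw [norm_mul]
  exact mul_le_mul (hb j) (hφ φ j) (norm_nonneg _) ((norm_nonneg _).trans (hb j))

lemma rep_add_smul_injective (r : Fin d → Fin (N : ℕ)) :
    Function.Injective fun k : Fin d → ℤ => rep r + (N : ℤ) • k := fun k l h => by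
  simpa only [divEquiv_rep_add] using congrArg (fun j => (divEquiv N j).1) h

lemma intVec_add_smul_rep_add_smul (r : Fin d → Fin (N : ℕ)) (k : Fin d → ℤ) :
    intVec k + (N : ℝ)⁻¹ • intVec (rep r) + (2 * Real.pi * (N : ℝ))⁻¹ • κ.1 =
      node N κ (rep r + (N : ℤ) • k) := by
  rw [node_add_smul, node, add_comm, add_left_comm, ← add_assoc, add_comm]
  abel

lemma hasSum_basisVec_apply (r : Fin d → Fin (N : ℕ)) (φ : 𝓢(Config d, ℂ)) :
    HasSum (fun k => (normConst d N : ℂ) * (pChar κ k * φ (node N κ (rep r + (N : ℤ) • k))))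
      (basisVec N κ r φ) := by
  obtain ⟨v, s, hv, hφ⟩ := exists_norm_apply_node_le N κ
  have basisVec_eq : basisVec N κ r = (normConst d N : ℂ) • ∑' k : Fin d → ℤ,
      pChar κ k • TemperedDistribution.delta (node N κ (rep r + (N : ℤ) • k)) := by
    simp only [basisVec, exp_I_mul, ← intVec_add_smul_rep_add_smul]
    rfl
  have summable_delta : Summable fun k : Fin d → ℤ =>
      pChar κ k • TemperedDistribution.delta (node N κ (rep r + (N : ℤ) • k)) := by
    refine summable_tempered_of_le_seminorm (hv.comp_injective (rep_add_smul_injective r)) s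
      fun k φ => ?_
    change ‖pChar κ k * φ (node N κ _)‖ ≤ _
    rw [norm_mul, norm_pChar, one_mul]
    exact hφ φ _
  rw [basisVec_eq]
  exact (hasSum_tempered_iff.mp summable_delta.hasSum φ).mul_left (normConst d N : ℂ)

lemma synth_apply_eq_sum (c : Coord d N) (φ : 𝓢(Config d, ℂ)) :
    synth N κ c φ = ∑ r, c r * basisVec N κ r φ :=
  map_sum (PointwiseConvergenceCLM.evalCLM (RingHom.id ℂ) ℂ φ) (fun r => c r • basisVec N κ r) _

lemma hasSum_synth_apply (c : Coord d N) (φ : 𝓢(Config d, ℂ)) :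
    HasSum (fun j => (normConst d N : ℂ) * (extend N κ c j * φ (node N κ j)))
      (synth N κ c φ) := by
  rw [synth_apply_eq_sum]
  refine hasSum_of_hasSum_coset
    ((summable_mul_apply_node (norm_extend_le (κ := κ) c) φ).mul_left _) fun r => ?_
  refine ((hasSum_basisVec_apply (κ := κ) r φ).mul_left (c r)).congr_fun fun k => ?_
  rw [extend_rep_add]
  ring

lemma eq_synth_of_hasSum {c : Coord d N} {T : 𝓢'(Config d, ℂ)}
    (h : ∀ φ, HasSum (fun j => (normConst d N : ℂ) * (extend N κ c j * φ (node N κ j))) (T φ)) :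
    T = synth N κ c := by
  ext φ
  exact (h φ).unique (hasSum_synth_apply c φ)

variable (N κ) in
/-- `synth` as a continuous linear map. -/
def synthCLM : Coord d N →L[ℂ] 𝓢'(Config d, ℂ) where
  toFun := synth N κ
  map_add' c c' := by
    ext φ
    change _ = synth N κ c φ + synth N κ c' φ
    simp only [synth_apply_eq_sum, PiLp.add_apply, add_mul, Finset.sum_add_distrib]
  map_smul' a c := by
    ext φ
    change _ = a * synth N κ c φ
    simp only [synth_apply_eq_sum, PiLp.smul_apply, smul_eq_mul, Finset.mul_sum, mul_assoc]
  cont := by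
    refine PointwiseConvergenceCLM.continuous_of_continuous_eval fun φ => ?_
    change Continuous fun c => synth N κ c φ
    simp only [synth_apply_eq_sum]
    fun_prop

@[simp] lemma synthCLM_apply (c : Coord d N) : synthCLM N κ c = synth N κ c := rfl

lemma one_le_norm_latVec {ι : Type*} [Fintype ι] {n : ι → ℤ} (hn : n ≠ 0) : 1 ≤ ‖latVec n‖ := by
  obtain ⟨i, hi⟩ := Function.ne_iff.mp hn
  refine le_trans ?_ (PiLp.norm_apply_le (latVec n) i)
  rw [latVec_apply, Real.norm_eq_abs]
  exact_mod_cast Int.one_le_abs hi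

lemma inv_le_dist_node {i j : Fin d → ℤ} (hij : i ≠ j) :
    (N : ℝ)⁻¹ ≤ dist (node N κ i) (node N κ j) := by
  have node_sub : node N κ i - node N κ j = (N : ℝ)⁻¹ • latVec (i - j) := by
    simp only [node, intVec_eq_latVec, map_sub, smul_sub]
    abel
  rw [dist_eq_norm, node_sub, norm_smul, norm_inv, Real.norm_of_nonneg (natCast_pos N).le]
  exact le_mul_of_one_le_right (by positivity) (one_le_norm_latVec (sub_ne_zero.mpr hij))

lemma exists_schwartzMap_apply_node_eq_single (j₀ : Fin d → ℤ) :
    ∃ φ : 𝓢(Config d, ℂ), φ (node N κ j₀) = 1 ∧ ∀ j, j ≠ j₀ → φ (node N κ j) = 0 := by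
  have hN := natCast_pos N
  let B : ContDiffBump (node N κ j₀) :=
    ⟨(2 * (N : ℝ))⁻¹, (N : ℝ)⁻¹, by positivity, by gcongr; linarith⟩
  have compactSupport : HasCompactSupport fun x => ((B x : ℝ) : ℂ) :=
    B.hasCompactSupport.comp_left Complex.ofReal_zero
  have smooth : ContDiff ℝ ∞ fun x => ((B x : ℝ) : ℂ) :=
    Complex.ofRealCLM.contDiff.comp B.contDiff
  refine ⟨compactSupport.toSchwartzMap smooth, ?_, fun j hj => ?_⟩
  · change ((B (node N κ j₀) : ℝ) : ℂ) = 1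
    rw [B.one_of_mem_closedBall (Metric.mem_closedBall_self B.rIn_pos.le), Complex.ofReal_one]
  · change ((B (node N κ j) : ℝ) : ℂ) = 0
    rw [B.zero_of_le_dist (inv_le_dist_node hj), Complex.ofReal_zero]

lemma synth_injective : Function.Injective (synth N κ) := by
  intro c c' h
  ext r
  obtain ⟨φ, φ_self, φ_other⟩ := exists_schwartzMap_apply_node_eq_single (N := N) (κ := κ) (rep r)
  have synth_apply_φ (c : Coord d N) : synth N κ c φ = (normConst d N : ℂ) * c r := by
    refine (hasSum_synth_apply c φ).unique ?_
    have := hasSum_single (f := fun j => (normConst d N : ℂ) * (extend N κ c j * φ (node N κ j)))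
      (rep r) fun j hj => by rw [φ_other j hj, mul_zero, mul_zero]
    simpa [φ_self, extend_rep] using this
  have normConst_ne_zero : (normConst d N : ℂ) ≠ 0 := by exact_mod_cast normConst_pos.ne'
  refine mul_left_cancel₀ normConst_ne_zero ?_
  rw [← synth_apply_φ, ← synth_apply_φ, h]

lemma coords_synth (c : Coord d N) : coords N κ (synth N κ c) = c :=
  Function.leftInverse_invFun synth_injective c

end Synthesis

/-! ### Translations on quasi-periodic sequences -/

section Translations

variable {d : ℕ} {N : ℕ+} {κ : Phase d}

lemma phaseFactor_eq_ec (ξ : Phase d) (q : Config d) :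
    phaseFactor (hbar N) ξ q = ec (N * (inner ℝ ξ.2 q - inner ℝ ξ.1 ξ.2 / 2)) := by
  rw [phaseFactor, exp_I_mul]
  congr 1
  have := natCast_pos N
  rw [hbar]
  field_simp

variable (N κ) in
/-- The action of `U_ħ(n / N)` on quasi-periodic sequences. -/
def shiftSeq (n : (Fin d → ℤ) × (Fin d → ℤ)) (b : (Fin d → ℤ) → ℂ) (j : Fin d → ℤ) : ℂ :=
  ec (inner ℝ (intVec n.2) (node N κ j) - inner ℝ (intVec n.1) (intVec n.2) / (2 * N)) *
    b (j - n.1)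

lemma QuasiPeriodic.shiftSeq {b : (Fin d → ℤ) → ℂ} (hb : QuasiPeriodic N κ b)
    (n : (Fin d → ℤ) × (Fin d → ℤ)) : QuasiPeriodic N κ (shiftSeq N κ n b) := by
  intro j k
  simp only [TorusQuantum.shiftSeq]
  rw [show j + (N : ℤ) • k - n.1 = j - n.1 + (N : ℤ) • k by abel, hb, node_add_smul, ec_sub,
    intVec_eq_latVec, intVec_eq_latVec k, ec_inner_latVec_add_latVec, ec_sub]
  ring

variable (N κ) in
/-- The action of `U_ħ(n / N)` on coordinates. -/
def shiftCoord (n : (Fin d → ℤ) × (Fin d → ℤ)) (c : Coord d N) : Coord d N :=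
  restr N (shiftSeq N κ n (extend N κ c))

lemma extend_shiftCoord (n : (Fin d → ℤ) × (Fin d → ℤ)) (c : Coord d N) :
    extend N κ (shiftCoord N κ n c) = shiftSeq N κ n (extend N κ c) :=
  ((quasiPeriodic_extend c).shiftSeq n).extend_restr

lemma norm_shiftCoord (n : (Fin d → ℤ) × (Fin d → ℤ)) (c : Coord d N) :
    ‖shiftCoord N κ n c‖ = ‖c‖ := by
  have shift_invariant := sum_rep_add_of_periodic (N := N) (h := fun j => ‖extend N κ c j‖ ^ 2)
    (fun j k => by rw [quasiPeriodic_extend, norm_mul, norm_pChar, one_mul]) (-n.1)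
  simp only [extend_rep] at shift_invariant
  rw [EuclideanSpace.norm_eq, EuclideanSpace.norm_eq, ← shift_invariant]
  congr 1
  refine Finset.sum_congr rfl fun r _ => ?_
  rw [shiftCoord, restr_apply, shiftSeq, norm_mul, norm_ec, one_mul, sub_eq_add_neg]

lemma node_sub_add_smul (j n : Fin d → ℤ) :
    node N κ (j - n) + (N : ℝ)⁻¹ • intVec n = node N κ j := by
  rw [← node_add, sub_add_cancel]

lemma phaseFactor_node_sub (n : (Fin d → ℤ) × (Fin d → ℤ)) (j : Fin d → ℤ) :
    phaseFactor (hbar N) (-((N : ℝ)⁻¹ • intPhase n).1, ((N : ℝ)⁻¹ • intPhase n).2)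
        (node N κ (j - n.1)) =
      ec (inner ℝ (intVec n.2) (node N κ j) -
        inner ℝ (intVec n.1) (intVec n.2) / (2 * N)) := by
  have hN := (natCast_pos N).ne'
  rw [phaseFactor_eq_ec, eq_sub_of_add_eq (node_sub_add_smul j n.1)]
  congr 1
  simp only [Prod.smul_fst, Prod.smul_snd, intPhase, inner_smul_left, inner_smul_right,
    inner_sub_right, inner_neg_left, real_inner_comm (intVec n.1) (intVec n.2), map_inv₀,
    conj_trivial]
  field_simp
  ring

lemma transl_synth (n : (Fin d → ℤ) × (Fin d → ℤ)) (c : Coord d N) :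
    transl (hbar N) ((N : ℝ)⁻¹ • intPhase n) (synth N κ c) = synth N κ (shiftCoord N κ n c) := by
  refine eq_synth_of_hasSum fun φ => ?_
  rw [extend_shiftCoord, transl_apply]
  have h := hasSum_synth_apply (κ := κ) c
    (translS (hbar N) (-((N : ℝ)⁻¹ • intPhase n).1, ((N : ℝ)⁻¹ • intPhase n).2) φ)
  rw [← (Equiv.subRight n.1).hasSum_iff] at h
  refine h.congr_fun fun j => ?_
  simp only [Function.comp_apply, Equiv.subRight_apply, shiftSeq, translS_apply, sub_neg_eq_add]
  rw [phaseFactor_node_sub, Prod.smul_fst, intPhase, node_sub_add_smul]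
  ring

lemma hbar_smul (n : (Fin d → ℤ) × (Fin d → ℤ)) :
    hbar N • ((2 * Real.pi) • intPhase n) = (N : ℝ)⁻¹ • intPhase n := by
  rw [smul_smul, hbar]
  congr 1
  have := natCast_pos N
  field_simp

lemma hasSum_coords_opW_synth {f : Phase d → ℂ} (hf : TorusSmooth f) (c : Coord d N) :
    HasSum (fun n => sympFourier f ((2 * Real.pi) • intPhase n) • shiftCoord N κ n c)
      (coords N κ (opW N f (synth N κ c))) := by
  have hs : Summable fun n => sympFourier f ((2 * Real.pi) • intPhase n) • shiftCoord N κ n c := by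
    refine Summable.of_norm ?_
    simp only [norm_smul, norm_shiftCoord]
    exact hf.summable_sympFourier.norm.mul_right _
  have opW_eq : opW N f (synth N κ c) = synth N κ
      (∑' n, sympFourier f ((2 * Real.pi) • intPhase n) • shiftCoord N κ n c) := by
    rw [opW, ← synthCLM_apply (∑' n, _), ← ((synthCLM N κ).hasSum hs.hasSum).tsum_eq]
    refine tsum_congr fun n => ?_
    rw [hbar_smul, transl_synth, map_smul, synthCLM_apply]
  rw [opW_eq, coords_synth]
  exact hs.hasSum

lemma inner_intVec_intVec (m n : Fin d → ℤ) :
    inner ℝ (intVec m) (intVec n) = ((∑ i, m i * n i : ℤ) : ℝ) := by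
  rw [intVec_eq_latVec, inner_latVec]
  push_cast
  rfl

lemma shiftSeq_smul_extend (n : (Fin d → ℤ) × (Fin d → ℤ)) (c : Coord d N) :
    shiftSeq N κ ((N : ℤ) • n) (extend N κ c) =
      ec ((symp κ (intPhase n) + inner ℝ (intVec n.1) (intVec n.2) / (2 * hbar N)) /
        (2 * Real.pi)) • extend N κ c := by
  have hN := (natCast_pos N).ne'
  funext j
  simp only [shiftSeq, Pi.smul_apply, smul_eq_mul]
  have period : extend N κ c (j - ((N : ℤ) • n).1) = pChar κ (-n.1) * extend N κ c j := by
    rw [← quasiPeriodic_extend, Prod.smul_fst, smul_neg, sub_eq_add_neg]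
  rw [period, ← mul_assoc, pChar, ← ec_add]
  congr 1
  refine ec_eq_of_eq_add_intCast (∑ i, n.2 i * j i - N * ∑ i, n.1 i * n.2 i) ?_
  rw [Int.cast_sub, Int.cast_mul, ← inner_intVec_intVec, ← inner_intVec_intVec]
  simp only [Prod.smul_fst, Prod.smul_snd, intVec_smul, show intVec (-n.1) = -intVec n.1 from
    map_neg latVec _, node, symp, intPhase, hbar, inner_add_right, inner_smul_left,
    inner_smul_right, inner_neg_right, real_inner_comm κ.1 (intVec n.2), conj_trivial,
    Int.cast_natCast]
  field_simp
  ring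

lemma synth_mem_hilb (c : Coord d N) : synth N κ c ∈ hilb N κ := by
  intro n
  have intPhase_eq : intPhase n = (N : ℝ)⁻¹ • intPhase ((N : ℤ) • n) := by
    ext i <;> simp [intPhase, intVec, (natCast_pos N).ne']
  conv_lhs => rw [intPhase_eq]
  rw [transl_synth, ← synthCLM_apply, ← synthCLM_apply, ← map_smul, exp_I_mul, shiftCoord,
    shiftSeq_smul_extend, ← extend_smul, restr_extend]

end Translations

/-! ### The basis vectors span `𝓗_ħ(κ)` -/

section Characters

variable {E : Type*} [NormedAddCommGroup E] [InnerProductSpace ℝ E]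

lemma ec_eq_cexp_mul (t : ℝ) : ec t = Complex.exp ((2 * Real.pi * Complex.I) * t) := by
  rw [ec_eq_exp]
  push_cast
  ring_nf

lemma contDiff_ec : ContDiff ℝ ∞ ec := by
  simp only [funext ec_eq_cexp_mul]
  exact (contDiff_const.mul Complex.ofRealCLM.contDiff).cexp

lemma norm_iteratedFDeriv_ec (n : ℕ) (t : ℝ) :
    ‖iteratedFDeriv ℝ n ec t‖ = (2 * Real.pi) ^ n := by
  rw [norm_iteratedFDeriv_eq_norm_iteratedDeriv, funext ec_eq_cexp_mul, iteratedDeriv_cexp_mul]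
  simp only [← ec_eq_cexp_mul, norm_mul, norm_ec, norm_pow]
  simp [abs_of_pos Real.pi_pos]

lemma norm_iteratedFDeriv_ec_inner_le (y x : E) (n : ℕ) :
    ‖iteratedFDeriv ℝ n (fun x => ec (inner ℝ y x)) x‖ ≤ (2 * Real.pi * ‖y‖) ^ n := by
  have chain : iteratedFDeriv ℝ n (fun x => ec (inner ℝ y x)) x = _ :=
    ContinuousLinearMap.iteratedFDeriv_comp_right (innerSL ℝ y) contDiff_ec x (mod_cast le_top)
  rw [chain, mul_pow, ← norm_iteratedFDeriv_ec n (innerSL ℝ y x)]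
  refine (ContinuousMultilinearMap.norm_compContinuousLinearMap_le _ _).trans ?_
  simp

lemma hasTemperateGrowth_ec_inner (y : E) : (fun x => ec (inner ℝ y x)).HasTemperateGrowth := by
  simp only [ec_eq_cexp_mul]
  exact hasTemperateGrowth_cexp _ (f := fun x => inner ℝ y x) (by fun_prop) (by simp)

/-- Multiplication of a Schwartz function by the character `x ↦ exp (2πi y · x)`. -/
def charMul (y : E) : 𝓢(E, ℂ) →L[ℂ] 𝓢(E, ℂ) :=
  SchwartzMap.smulLeftCLM ℂ fun x => ec (inner ℝ y x)

lemma charMul_apply (y : E) (φ : 𝓢(E, ℂ)) (x : E) : charMul y φ x = ec (inner ℝ y x) * φ x := by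
  simp [charMul, SchwartzMap.smulLeftCLM_apply_apply (hasTemperateGrowth_ec_inner y)]

lemma exists_seminorm_charMul_le (φ : 𝓢(E, ℂ)) (k n : ℕ) :
    ∃ C, ∀ y, SchwartzMap.seminorm ℂ k n (charMul y φ) ≤ C * (1 + 2 * Real.pi * ‖y‖) ^ n := by
  obtain ⟨A, hA, hφ⟩ := exists_norm_iteratedFDeriv_le_decayWeight φ k n
  refine ⟨∑ i ∈ Finset.range (n + 1), n.choose i * A, fun y => ?_⟩
  refine SchwartzMap.seminorm_le_bound ℂ k n _ (by positivity) fun x => ?_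
  rw [show (⇑(charMul y φ) : E → ℂ) = fun x => ec (inner ℝ y x) * φ x from
    funext (charMul_apply y φ)]
  have leibniz := norm_iteratedFDeriv_mul_le (𝕜 := ℝ) (n := n) (N := n)
    (f := fun x => ec (inner ℝ y x)) (g := φ)
    ((contDiff_ec.comp (innerSL ℝ y).contDiff).of_le (mod_cast le_top)) (φ.smooth n) x le_rfl
  refine (mul_le_mul_of_nonneg_left leibniz (by positivity)).trans ?_
  rw [Finset.mul_sum, Finset.sum_mul]
  refine Finset.sum_le_sum fun i hi => ?_
  have ec_le : ‖iteratedFDeriv ℝ i (fun x => ec (inner ℝ y x)) x‖ ≤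
      (1 + 2 * Real.pi * ‖y‖) ^ n := by
    refine (norm_iteratedFDeriv_ec_inner_le y x i).trans ?_
    refine (pow_le_pow_left₀ (by positivity) (le_add_of_nonneg_left zero_le_one) i).trans ?_
    exact pow_le_pow_right₀ (le_add_of_nonneg_right (by positivity))
      (Finset.mem_range_succ_iff.mp hi)
  have φ_le : ‖x‖ ^ k * ‖iteratedFDeriv ℝ (n - i) φ x‖ ≤ A := by
    calc _ ≤ (1 + ‖x‖) ^ k * (A * decayWeight k x) := by
          gcongr
          · linarith
          · exact hφ (n - i) (Nat.sub_le _ _) x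
      _ = A := by rw [decayWeight]; field_simp
  calc _ = n.choose i * ‖iteratedFDeriv ℝ i (fun x => ec (inner ℝ y x)) x‖ *
        (‖x‖ ^ k * ‖iteratedFDeriv ℝ (n - i) φ x‖) := by ring
    _ ≤ n.choose i * (1 + 2 * Real.pi * ‖y‖) ^ n * A := by gcongr
    _ = _ := by ring

end Characters

section Span

variable {d : ℕ} {N : ℕ+} {κ : Phase d}

lemma apply_compSubConst_of_mem_hilb {T : 𝓢'(Config d, ℂ)} (hT : T ∈ hilb N κ) (m : Fin d → ℤ)
    (φ : 𝓢(Config d, ℂ)) :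
    T (SchwartzMap.compSubConstCLM ℂ (latVec m) φ) = pChar κ m * T φ := by
  have h := congrArg (fun S : 𝓢'(Config d, ℂ) => S φ) (hT (-m, 0))
  have translS_eq : translS (hbar N) (-(intPhase (-m, 0)).1, (intPhase (-m, 0)).2) φ =
      SchwartzMap.compSubConstCLM ℂ (latVec m) φ := by
    ext q
    rw [translS_apply, phaseFactor_eq_ec]
    simp [intPhase, intVec_eq_latVec]
  simp only [transl_apply, translS_eq] at h
  rw [h, exp_I_mul, pChar]
  change ec _ * T φ = _
  simp [symp, intPhase, intVec_eq_latVec]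

lemma apply_charMul_of_mem_hilb {T : 𝓢'(Config d, ℂ)} (hT : T ∈ hilb N κ) (k : Fin d → ℤ)
    (φ : 𝓢(Config d, ℂ)) :
    T (charMul ((N : ℝ) • latVec k) φ) = ec (inner ℝ κ.1 (intVec k) / (2 * Real.pi)) * T φ := by
  have h := congrArg (fun S : 𝓢'(Config d, ℂ) => S φ) (hT (0, k))
  have translS_eq : translS (hbar N) (-(intPhase (0, k)).1, (intPhase (0, k)).2) φ =
      charMul ((N : ℝ) • latVec k) φ := by
    ext q
    rw [translS_apply, phaseFactor_eq_ec, charMul_apply]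
    simp [intPhase, intVec_eq_latVec, inner_smul_left]
  simp only [transl_apply, translS_eq] at h
  rw [h, exp_I_mul]
  change ec _ * T φ = _
  simp [symp, intPhase, intVec_eq_latVec]

variable (d) in
/-- The partition function `latticeBump` as a Schwartz function. -/
def latticeBumpS : 𝓢(Config d, ℂ) :=
  hasCompactSupport_latticeBump.toSchwartzMap contDiff_latticeBump

lemma latticeBumpS_apply (x : Config d) : latticeBumpS d x = latticeBump (Fin d) x := rfl

variable (κ) in
/-- The Bloch momentum `κ_p / (2π)`. -/
def bloch : Config d := (2 * Real.pi)⁻¹ • κ.2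

lemma pChar_eq_ec_bloch (m : Fin d → ℤ) : pChar κ m = ec (inner ℝ (bloch κ) (latVec m)) := by
  rw [pChar, bloch, real_inner_smul_left, intVec_eq_latVec, div_eq_inv_mul]

variable (κ) in
/-- The localized exponentials `exp (i (2 π l - κ_p) · x) θ(x)`, dual to the Fourier coefficients
of quasi-periodic functions. -/
def localExp (l : Fin d → ℤ) : 𝓢(Config d, ℂ) :=
  charMul (latVec l - bloch κ) (latticeBumpS d)

lemma hasSum_apply_tempered {α E : Type*} [NormedAddCommGroup E] [NormedSpace ℝ E]
    {f : α → 𝓢(E, ℂ)} {G : 𝓢(E, ℂ)} (h : HasSum f G) (T : 𝓢'(E, ℂ)) :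
    HasSum (fun i => T (f i)) (T G) :=
  h.map T.toLinearMap.toAddMonoidHom T.cont

lemma translMul_eq_compSubConst_translMul {E : Type*} [NormedAddCommGroup E] [NormedSpace ℝ E]
    (θ φ : 𝓢(E, ℂ)) (a : E) :
    translMul θ φ a = SchwartzMap.compSubConstCLM ℂ a (translMul φ θ (-a)) := by
  ext x
  simp [translMul_apply, mul_comm]

lemma hasSum_translMul_latticeBumpS (φ : 𝓢(Config d, ℂ)) :
    HasSum (fun m => translMul (latticeBumpS d) φ (latVec m)) φ := by
  obtain ⟨G, hG, hGx⟩ := exists_hasSum_smul_translMul_latVec (latticeBumpS d) φ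
    (u := fun _ => 1) (by simp)
  suffices G = φ by simpa only [one_smul, this] using hG
  ext x
  refine (hGx x).unique ?_
  have h := (Equiv.neg _).hasSum_iff.mpr ((hasSum_latticeBump_add_latVec x).mul_right (φ x))
  rw [one_mul] at h
  refine h.congr_fun fun m => ?_
  simp [← sub_eq_add_neg, latticeBumpS_apply]

variable (κ) in
/-- Moving the translations from the partition of unity to `φ`: the values on `𝓗_ħ(κ)` of `φ` and
of its quasi-periodization, cut off by `latticeBumpS`, agree. -/
lemma exists_cutoff_quasiPeriodization (φ : 𝓢(Config d, ℂ)) : ∃ G : 𝓢(Config d, ℂ),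
    (∀ {N : ℕ+}, ∀ T ∈ hilb N κ, T G = T φ) ∧ ∀ x,
      HasSum (fun m => pChar κ m * (φ (x + latVec m) * latticeBumpS d x)) (G x) := by
  obtain ⟨G, hG, hGx⟩ := exists_hasSum_smul_translMul_latVec φ (latticeBumpS d)
    (u := fun m => pChar κ (-m)) (by simp)
  refine ⟨G, fun T hT => ?_, fun x => ?_⟩
  · have hTG := (Equiv.neg _).hasSum_iff.mpr (hasSum_apply_tempered hG T)
    refine hTG.unique ((hasSum_apply_tempered (hasSum_translMul_latticeBumpS φ) T).congr_fun
      fun m => ?_)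
    rw [translMul_eq_compSubConst_translMul, apply_compSubConst_of_mem_hilb hT,
      Function.comp_apply, map_smul, smul_eq_mul]
    simp
  · refine ((Equiv.neg _).hasSum_iff.mpr (hGx x)).congr_fun fun m => ?_
    simp

variable (κ) in
lemma exists_seminorm_localExp_le (k n : ℕ) : ∃ C, ∀ l,
    SchwartzMap.seminorm ℂ k n (localExp κ l) ≤ C * (1 + ‖latVec l‖) ^ n := by
  obtain ⟨C, hC⟩ := exists_seminorm_charMul_le (latticeBumpS d) k n
  have hC0 : 0 ≤ C := by simpa using (apply_nonneg _ _).trans (hC 0)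
  refine ⟨C * (1 + 2 * Real.pi * (1 + ‖bloch κ‖)) ^ n, fun l => (hC _).trans ?_⟩
  rw [mul_assoc C, ← mul_pow]
  gcongr
  have hp : 0 ≤ 2 * Real.pi * (‖bloch κ‖ * ‖latVec l‖) := by positivity
  calc 1 + 2 * Real.pi * ‖latVec l - bloch κ‖
      ≤ 1 + 2 * Real.pi * (‖latVec l‖ + ‖bloch κ‖) := by gcongr; exact norm_sub_le _ _
    _ ≤ (1 + 2 * Real.pi * (1 + ‖bloch κ‖)) * (1 + ‖latVec l‖) := by
      nlinarith [norm_nonneg (latVec l), Real.pi_pos]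

variable (κ) in
lemma summable_seminorm_smul_localExp (ψ : 𝓢(Config d, ℂ)) (k n : ℕ) :
    Summable fun l => SchwartzMap.seminorm ℂ k n (ψ (latVec l) • localExp κ l) := by
  obtain ⟨C, hC⟩ := exists_seminorm_localExp_le κ k n
  obtain ⟨M, hM⟩ := exists_summable_decayWeight_latVec (Fin d)
  obtain ⟨A, hA, hψ⟩ := exists_norm_le_decayWeight ψ (M + n)
  refine Summable.of_nonneg_of_le (fun _ => apply_nonneg _ _) (fun l => ?_) (hM.mul_left (A * C))
  rw [map_smul_eq_mul]
  calc ‖ψ (latVec l)‖ * SchwartzMap.seminorm ℂ k n (localExp κ l)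
      ≤ (A * decayWeight (M + n) (latVec l)) * (C * (1 + ‖latVec l‖) ^ n) :=
        mul_le_mul (hψ _) (hC l) (apply_nonneg _ _)
          (mul_nonneg hA (decayWeight_nonneg _ _))
    _ = A * C * decayWeight M (latVec l) := by
        rw [decayWeight, decayWeight, pow_add]
        field_simp

/-- Poisson summation expands the quasi-periodization of `φ` in the exponentials
`exp (i (2 π l - κ_p) · x)`. -/
lemma hasSum_fourier_mul_localExp_apply {φ G : 𝓢(Config d, ℂ)}
    (hG : ∀ x, HasSum (fun m => pChar κ m * (φ (x + latVec m) * latticeBumpS d x)) (G x))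
    (x : Config d) :
    HasSum (fun l => (FourierTransform.fourier (charMul (bloch κ) φ) (latVec l) • localExp κ l) x)
      (G x) := by
  have poisson := (hasSum_fourier_mul_ec (charMul (bloch κ) φ) x).mul_left
    (ec (-inner ℝ (bloch κ) x) * latticeBumpS d x)
  have quasiPeriodization : G x = ec (-inner ℝ (bloch κ) x) * latticeBumpS d x *
      ∑' m, charMul (bloch κ) φ (x + latVec m) := by
    rw [← tsum_mul_left, ← (hG x).tsum_eq]
    refine tsum_congr fun m => ?_
    rw [charMul_apply, inner_add_right, ec_add, pChar_eq_ec_bloch, ec_neg]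
    field [ec_ne_zero (inner ℝ (bloch κ) x)]
  rw [quasiPeriodization]
  refine poisson.congr_fun fun l => ?_
  rw [smul_apply, localExp, charMul_apply, inner_sub_left, ec_sub, smul_eq_mul]
  ring

lemma hasSum_fourier_mul_apply_localExp {T : 𝓢'(Config d, ℂ)} (hT : T ∈ hilb N κ)
    (φ : 𝓢(Config d, ℂ)) :
    HasSum (fun l => FourierTransform.fourier (charMul (bloch κ) φ) (latVec l) *
      T (localExp κ l)) (T φ) := by
  obtain ⟨G, hTG, hG⟩ := exists_cutoff_quasiPeriodization κ φ
  have expansion := hasSum_of_summable_seminorm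
    (summable_seminorm_smul_localExp κ (FourierTransform.fourier (charMul (bloch κ) φ)))
    fun x => (hasSum_fourier_mul_localExp_apply hG x).tsum_eq.symm
  rw [← hTG T hT]
  refine (hasSum_apply_tempered expansion T).congr_fun fun l => ?_
  exact (map_smul T _ (localExp κ l)).symm

lemma apply_localExp_add_smul {T : 𝓢'(Config d, ℂ)} (hT : T ∈ hilb N κ) (l k : Fin d → ℤ) :
    T (localExp κ (l + (N : ℤ) • k)) =
      ec (inner ℝ κ.1 (intVec k) / (2 * Real.pi)) * T (localExp κ l) := by
  rw [← apply_charMul_of_mem_hilb hT]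
  congr 1
  ext x
  rw [charMul_apply, localExp, localExp, charMul_apply, charMul_apply, ← mul_assoc, ← ec_add,
    ← inner_add_left, map_add, ← intVec_eq_latVec ((N : ℤ) • k), intVec_smul, intVec_eq_latVec]
  congr 3
  abel

variable (N κ) in
/-- The values of a distribution on the localized exponentials with frequencies in
`{0, …, N - 1}^d`. -/
def localCoeffs : 𝓢'(Config d, ℂ) →ₗ[ℂ] Coord d N where
  toFun T := WithLp.toLp 2 fun r => T (localExp κ (rep r))
  map_add' _ _ := rfl
  map_smul' _ _ := rfl

lemma eq_zero_of_localCoeffs_eq_zero {T : 𝓢'(Config d, ℂ)} (hT : T ∈ hilb N κ)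
    (h : localCoeffs N κ T = 0) : T = 0 := by
  ext φ
  refine (hasSum_fourier_mul_apply_localExp hT φ).unique ?_
  refine HasSum.congr_fun (f := fun _ => 0) hasSum_zero fun l => ?_
  obtain ⟨k, r, rfl⟩ := exists_eq_rep_add N l
  have apply_rep : T (localExp κ (rep r)) = 0 := congrArg (fun v : Coord d N => v r) h
  rw [apply_localExp_add_smul hT, apply_rep, mul_zero, mul_zero]

/-- `𝓗_ħ(κ)` embeds by `localCoeffs` into a space of the same dimension as the span of the basis
vectors. -/
theorem exists_eq_synth {T : 𝓢'(Config d, ℂ)} (hT : T ∈ hilb N κ) : ∃ c, T = synth N κ c := by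
  let L : Coord d N →ₗ[ℂ] Coord d N := localCoeffs N κ ∘ₗ (synthCLM N κ).toLinearMap
  have L_injective : Function.Injective L := by
    refine (injective_iff_map_eq_zero L).mpr fun c hc => synth_injective (κ := κ) ?_
    exact (eq_zero_of_localCoeffs_eq_zero (synth_mem_hilb c) hc).trans (synthCLM N κ).map_zero.symm
  obtain ⟨c, hc⟩ := LinearMap.injective_iff_surjective.mp L_injective (localCoeffs N κ T)
  refine ⟨c, sub_eq_zero.mp ?_⟩
  refine eq_zero_of_localCoeffs_eq_zero (Submodule.sub_mem _ hT (synth_mem_hilb c)) ?_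
  rw [map_sub, sub_eq_zero]
  exact hc.symm

end Span

/-! ### Projection of Schwartz functions to `𝓗_ħ(κ)` -/

section Gaussian

variable {E : Type*} [NormedAddCommGroup E]

lemma exists_pow_mul_exp_neg_mul_sq_le {c : ℝ} (hc : 0 < c) (m : ℕ) :
    ∃ C, ∀ r : ℝ, 0 ≤ r → (1 + r) ^ m * Real.exp (-c * r ^ 2) ≤ C := by
  refine ⟨Real.exp c * (m.factorial * (2 / c) ^ m), fun r hr => ?_⟩
  have exponent_le : -c * r ^ 2 ≤ c + -(c * (1 + r) ^ 2 / 2) := by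
    nlinarith [mul_nonneg hc.le (sq_nonneg (r - 1))]
  have exp_ge := Real.pow_div_factorial_le_exp (x := c * (1 + r) ^ 2 / 2) (by positivity) m
  rw [div_le_iff₀ (by positivity)] at exp_ge
  have pow_le : (1 + r) ^ m ≤ (2 / c) ^ m * (c * (1 + r) ^ 2 / 2) ^ m := by
    rw [← mul_pow]
    refine pow_le_pow_left₀ (by positivity) ?_ m
    field_simp
    nlinarith
  calc (1 + r) ^ m * Real.exp (-c * r ^ 2)
      ≤ ((2 / c) ^ m * (Real.exp (c * (1 + r) ^ 2 / 2) * m.factorial)) *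
        Real.exp (c + -(c * (1 + r) ^ 2 / 2)) := by
        gcongr
        exact pow_le.trans (by gcongr)
    _ = Real.exp c * (m.factorial * (2 / c) ^ m) := by
        rw [Real.exp_add, Real.exp_neg]
        field_simp

lemma exists_norm_iteratedFDeriv_cexp_mul_le [NormedSpace ℝ E] (c : ℂ) {f : E → ℝ}
    (hf : f.HasTemperateGrowth) (n : ℕ) :
    ∃ p D, 0 ≤ D ∧ ∀ x, ‖iteratedFDeriv ℝ n (fun x => Complex.exp (c * f x)) x‖ ≤
      D * (1 + ‖x‖) ^ p * Real.exp (c.re * f x) := by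
  obtain ⟨p, D, hD0, hD⟩ := hf.norm_iteratedFDeriv_le_uniform n
  refine ⟨p * n, n.factorial * (1 + ‖c‖) ^ n * (1 + D) ^ n, by positivity, fun x => ?_⟩
  have one_le : 1 ≤ (1 + ‖x‖) ^ p := one_le_pow₀ (by simp)
  have contDiff_cexp : ContDiff ℝ ∞ (fun s : ℝ => Complex.exp (c * s)) :=
    (contDiff_const.mul Complex.ofRealCLM.contDiff).cexp
  refine (norm_iteratedFDeriv_comp_le contDiff_cexp hf.1 (n := n) (mod_cast le_top) x
    (C := (1 + ‖c‖) ^ n * Real.exp (c.re * f x)) (D := (1 + D) * (1 + ‖x‖) ^ p)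
    (fun i hi => ?_) fun i hi hin => ?_).trans_eq ?_
  · rw [norm_iteratedFDeriv_eq_norm_iteratedDeriv, iteratedDeriv_cexp_mul, norm_mul, norm_pow,
      Complex.norm_exp, Complex.re_mul_ofReal]
    gcongr
    exact (pow_le_pow_left₀ (norm_nonneg c) (by simp) i).trans (pow_le_pow_right₀ (by simp) hi)
  · calc ‖iteratedFDeriv ℝ i f x‖ ≤ (1 + D) * (1 + ‖x‖) ^ p :=
          (hD i hin x).trans (by gcongr; simp)
      _ ≤ ((1 + D) * (1 + ‖x‖) ^ p) ^ i := le_self_pow₀ (by nlinarith) (by omega)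
  · rw [pow_mul, mul_pow]
    ring

variable [InnerProductSpace ℝ E]

/-- The function `x ↦ exp (-c |x|²)`, `0 < c`, as a Schwartz function. -/
def expNegMulSq {c : ℝ} (hc : 0 < c) : 𝓢(E, ℂ) where
  toFun x := Complex.exp (((-c : ℝ) : ℂ) * ((‖x‖ ^ 2 : ℝ) : ℂ))
  smooth' := (contDiff_const.mul (Complex.ofRealCLM.contDiff.comp (contDiff_norm_sq ℝ))).cexp
  decay' k n := by
    obtain ⟨p, D, hD, deriv_le⟩ := exists_norm_iteratedFDeriv_cexp_mul_le ((-c : ℝ) : ℂ)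
      (Function.hasTemperateGrowth_norm_sq E) n
    obtain ⟨B, hB⟩ := exists_pow_mul_exp_neg_mul_sq_le hc (k + p)
    refine ⟨D * B, fun x => ?_⟩
    calc _ ≤ (1 + ‖x‖) ^ k * (D * (1 + ‖x‖) ^ p * Real.exp (-c * ‖x‖ ^ 2)) := by
          gcongr
          · simp
          · exact deriv_le x
      _ = D * ((1 + ‖x‖) ^ (k + p) * Real.exp (-c * ‖x‖ ^ 2)) := by ring
      _ ≤ D * B := by gcongr; exact hB _ (norm_nonneg x)

lemma expNegMulSq_apply {c : ℝ} (hc : 0 < c) (x : E) :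
    expNegMulSq hc x = Real.exp (-c * ‖x‖ ^ 2) := by
  rw [Complex.ofReal_exp, Complex.ofReal_mul]
  rfl

variable (d : ℕ) (N : ℕ+)

/-- The Gaussian `η_ħ` as a Schwartz function. -/
def gaussianS : 𝓢(Config d, ℂ) :=
  (((Real.pi * hbar N) ^ (-(d : ℝ) / 4) : ℝ) : ℂ) •
    expNegMulSq (one_div_pos.mpr (mul_pos two_pos (hbar_pos N)))

lemma gaussianS_apply (q : Config d) : gaussianS d N q = gaussian d N q := by
  rw [gaussianS, smul_apply, expNegMulSq_apply, smul_eq_mul, gaussian, Complex.ofReal_mul]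
  congr 3
  ring

lemma gaussianDist_eq : gaussianDist d N = (gaussianS d N : 𝓢'(Config d, ℂ)) := by
  ext φ
  rw [SchwartzMap.coe_apply]
  simp only [gaussianS_apply]
  exact Function.HasTemperateGrowth.toTemperedDistribution_apply volume
    (hasTemperateGrowth_gaussian d N) φ

end Gaussian

section Project

variable {d : ℕ} {N : ℕ+} {κ : Phase d}

variable (N κ) in
/-- The quasi-periodization of a Schwartz function, sampled at the nodes. -/
def projSeq (ψ : 𝓢(Config d, ℂ)) (j : Fin d → ℤ) : ℂ :=
  normConst d N * ∑' m : Fin d → ℤ, pChar κ m * ψ (node N κ j - intVec m)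

lemma summable_pChar_mul (ψ : 𝓢(Config d, ℂ)) (x : Config d) :
    Summable fun m : Fin d → ℤ => pChar κ m * ψ (x - intVec m) := by
  refine Summable.of_norm ?_
  simp only [norm_mul, norm_pChar, one_mul]
  refine ((Equiv.neg _).summable_iff.mpr (summable_add_latVec ψ x).norm).congr fun m => ?_
  simp [intVec_eq_latVec, sub_eq_add_neg]

lemma quasiPeriodic_projSeq (ψ : 𝓢(Config d, ℂ)) : QuasiPeriodic N κ (projSeq N κ ψ) := by
  intro j k
  rw [projSeq, ← (Equiv.addRight k).tsum_eq fun m => pChar κ m *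
    ψ (node N κ (j + (N : ℤ) • k) - intVec m), projSeq, mul_left_comm,
    ← tsum_mul_left (a := pChar κ k)]
  congr! 3 with m
  have shift : node N κ (j + (N : ℤ) • k) - intVec (m + k) = node N κ j - intVec m := by
    simp only [node_add_smul, intVec_eq_latVec, map_add]
    abel
  rw [Equiv.coe_addRight, pChar_add, shift]
  ring

variable (N κ) in
/-- The coordinates of the projection of a Schwartz function. -/
def projCoord (ψ : 𝓢(Config d, ℂ)) : Coord d N := restr N (projSeq N κ ψ)

lemma transl_config (m : Fin d → ℤ) (ψ : 𝓢(Config d, ℂ)) :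
    transl (hbar N) (intVec m, 0) (ψ : 𝓢'(Config d, ℂ)) =
      (SchwartzMap.compSubConstCLM ℂ (latVec m) ψ : 𝓢(Config d, ℂ)) := by
  rw [transl_coe]
  congr 1
  ext q
  rw [translS_apply, phaseFactor_eq_ec]
  simp [intVec_eq_latVec]

lemma transl_momentum_apply (n : Fin d → ℤ) (T : 𝓢'(Config d, ℂ)) (φ : 𝓢(Config d, ℂ)) :
    transl (hbar N) (0, intVec n) T φ = T (charMul ((N : ℝ) • latVec n) φ) := by
  rw [transl_apply]
  congr 1
  ext q
  rw [translS_apply, phaseFactor_eq_ec, charMul_apply]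
  simp [intVec_eq_latVec, inner_smul_left]

lemma exists_norm_coe_compSubConst_apply_le (ψ : 𝓢(Config d, ℂ)) (M : ℕ) :
    ∃ C, ∀ (a : Config d) (φ : 𝓢(Config d, ℂ)),
      ‖((SchwartzMap.compSubConstCLM ℂ a ψ : 𝓢(Config d, ℂ)) : 𝓢'(Config d, ℂ)) φ‖ ≤
        C * decayWeight M a *
          (Finset.Iic (M, 0)).sup (schwartzSeminormFamily ℂ (Config d) ℂ) φ := by
  set K := (volume : Measure (Config d)).integrablePower
  have rpow_eq (x : Config d) : (1 + ‖x‖) ^ (-(K : ℝ)) = decayWeight K x := by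
    rw [Real.rpow_neg (by positivity), Real.rpow_natCast, decayWeight]
  have integrable : Integrable (decayWeight K : Config d → ℝ) :=
    (Measure.integrable_pow_neg_integrablePower (volume : Measure (Config d))).congr
      (Eventually.of_forall rpow_eq)
  obtain ⟨A, _, hψ⟩ := exists_norm_le_decayWeight ψ (M + K)
  refine ⟨2 ^ M * (A * ∫ q : Config d, decayWeight K q), fun a φ => ?_⟩
  set p := (Finset.Iic (M, 0)).sup (schwartzSeminormFamily ℂ (Config d) ℂ) φ
  have : 0 ≤ p := apply_nonneg _ _
  have norm_le (q : Config d) : ‖φ q • (SchwartzMap.compSubConstCLM ℂ a ψ) q‖ ≤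
      2 ^ M * p * A * decayWeight M a * decayWeight K (q - a) := by
    rw [norm_smul, SchwartzMap.compSubConstCLM_apply]
    have peetre := decayWeight_add_le M a (q - a)
    rw [add_sub_cancel] at peetre
    calc ‖φ q‖ * ‖ψ (q - a)‖
        ≤ (2 ^ M * p * ((1 + ‖q - a‖) ^ M * decayWeight M a)) *
          (A * decayWeight (M + K) (q - a)) := by
          have := decayWeight_nonneg M a
          refine mul_le_mul ((norm_le_sup_seminorm_mul_decayWeight ℂ φ M q).trans ?_) (hψ _)
            (norm_nonneg _) (by positivity)
          gcongr
      _ = 2 ^ M * p * A * decayWeight M a * decayWeight K (q - a) := by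
          simp only [decayWeight, pow_add]
          field_simp
  rw [SchwartzMap.coe_apply]
  calc _ ≤ ∫ q, 2 ^ M * p * A * decayWeight M a * decayWeight K (q - a) :=
        norm_integral_le_of_norm_le ((integrable.comp_sub_right a).const_mul _)
          (Eventually.of_forall norm_le)
    _ = _ := by
        rw [integral_const_mul, integral_sub_right_eq_self (decayWeight K : Config d → ℝ) a]
        ring

lemma summable_smul_transl_config (ψ : 𝓢(Config d, ℂ)) :
    Summable fun m : Fin d → ℤ =>
      pChar κ m • transl (hbar N) (intVec m, 0) (ψ : 𝓢'(Config d, ℂ)) := by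
  obtain ⟨M, hM⟩ := exists_summable_decayWeight_latVec (Fin d)
  obtain ⟨C, hC⟩ := exists_norm_coe_compSubConst_apply_le ψ M
  refine summable_tempered_of_le_seminorm (hM.mul_left C) (Finset.Iic (M, 0)) fun m φ => ?_
  rw [transl_config]
  change ‖pChar κ m * ((SchwartzMap.compSubConstCLM ℂ (latVec m) ψ : 𝓢(Config d, ℂ)) :
    𝓢'(Config d, ℂ)) φ‖ ≤ _
  rw [norm_mul, norm_pChar, one_mul]
  exact hC (latVec m) φ

/-- The quasi-periodization, multiplied by a Schwartz function `φ`, is a Schwartz function, to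
which Poisson summation applies. -/
lemma exists_tsum_transl_config_apply_eq_integral (ψ φ : 𝓢(Config d, ℂ)) :
    ∃ G : 𝓢(Config d, ℂ),
      (∑' m : Fin d → ℤ, pChar κ m • transl (hbar N) (intVec m, 0) (ψ : 𝓢'(Config d, ℂ))) φ =
        ∫ q, G q ∧
      ∀ x, HasSum (fun m => pChar κ m * (ψ (x - latVec m) * φ x)) (G x) := by
  obtain ⟨G, hG, hGx⟩ := exists_hasSum_smul_translMul_latVec ψ φ fun m => (norm_pChar κ m).le
  refine ⟨G, ?_, hGx⟩
  have integral_hasSum := (SchwartzMap.integralCLM ℂ (volume : Measure (Config d))).hasSum hG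
  rw [SchwartzMap.integralCLM_apply] at integral_hasSum
  refine (hasSum_tempered_iff.mp (summable_smul_transl_config (N := N) ψ).hasSum φ).unique
    (integral_hasSum.congr_fun fun m => ?_)
  rw [transl_config, map_smul, SchwartzMap.integralCLM_apply]
  change pChar κ m * ((SchwartzMap.compSubConstCLM ℂ (latVec m) ψ : 𝓢(Config d, ℂ)) :
    𝓢'(Config d, ℂ)) φ = pChar κ m * _
  rw [SchwartzMap.coe_apply]
  simp only [translMul_apply, SchwartzMap.compSubConstCLM_apply, smul_eq_mul, mul_comm]

variable (N κ) in
/-- The function `y ↦ G (y / N + κ_q / (2 π N))`, whose values on `ℤ^d` are the values of `G` at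
the nodes. -/
def nodeRescale (G : 𝓢(Config d, ℂ)) : 𝓢(Config d, ℂ) :=
  SchwartzMap.compCLMOfContinuousLinearEquiv ℂ
    (ContinuousLinearEquiv.smulLeft (Units.mk0 ((N : ℝ)⁻¹) (inv_ne_zero (natCast_pos N).ne')))
    (SchwartzMap.compSubConstCLM ℂ (-((2 * Real.pi * (N : ℝ))⁻¹ • κ.1)) G)

lemma nodeRescale_apply (G : 𝓢(Config d, ℂ)) (y : Config d) :
    nodeRescale N κ G y = G ((N : ℝ)⁻¹ • y + (2 * Real.pi * (N : ℝ))⁻¹ • κ.1) := by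
  change G ((N : ℝ)⁻¹ • y - -((2 * Real.pi * (N : ℝ))⁻¹ • κ.1)) = _
  rw [sub_neg_eq_add]

lemma fourier_nodeRescale_latVec_neg (G : 𝓢(Config d, ℂ)) (n : Fin d → ℤ) :
    FourierTransform.fourier (nodeRescale N κ G) (latVec (-n)) = ((N : ℝ) ^ d : ℝ) *
      (ec (-(inner ℝ κ.1 (intVec n) / (2 * Real.pi))) *
        ∫ q, charMul ((N : ℝ) • latVec n) G q) := by
  have hN := natCast_pos N
  set a : Config d := (2 * Real.pi * (N : ℝ))⁻¹ • κ.1 with ha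
  let f : Config d → ℂ := fun q => ec (-(inner ℝ κ.1 (intVec n) / (2 * Real.pi))) *
    charMul ((N : ℝ) • latVec n) G (q + a)
  have integrand_eq (y : Config d) :
      ec (-inner ℝ (latVec (-n)) y) * nodeRescale N κ G y = f ((N : ℝ)⁻¹ • y) := by
    simp only [f, nodeRescale_apply, charMul_apply, ← mul_assoc, ← ec_add]
    congr 2
    simp only [map_neg, inner_neg_left, neg_neg, inner_add_right, inner_smul_left,
      inner_smul_right, ha, intVec_eq_latVec, real_inner_comm κ.1 (latVec n),
      conj_trivial]
    field
  simp only [fourier_eq_integral_ec_mul, integrand_eq]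
  rw [Measure.integral_comp_inv_smul_of_nonneg _ _ hN.le, finrank_euclideanSpace,
    Fintype.card_fin, Complex.real_smul]
  simp only [f]
  rw [integral_const_mul, integral_add_right_eq_self (fun q => charMul ((N : ℝ) • latVec n) G q)]

lemma hasSum_poisson_node (G : 𝓢(Config d, ℂ)) :
    HasSum (fun n : Fin d → ℤ =>
      ec (-(inner ℝ κ.1 (intVec n) / (2 * Real.pi))) * ∫ q, charMul ((N : ℝ) • latVec n) G q)
      (((N : ℝ) ^ d : ℝ)⁻¹ * ∑' j, G (node N κ j)) := by
  have poisson := hasSum_fourier_mul_ec (nodeRescale N κ G) 0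
  simp only [inner_zero_right, ec_zero, mul_one, zero_add, nodeRescale_apply] at poisson
  have hN : (((N : ℝ) ^ d : ℝ) : ℂ) ≠ 0 :=
    Complex.ofReal_ne_zero.mpr (pow_pos (natCast_pos N) d).ne'
  rw [Complex.ofReal_inv]
  refine (((Equiv.neg _).hasSum_iff.mpr poisson).mul_left _).congr_fun fun n => ?_
  rw [Function.comp_apply, Equiv.neg_apply, fourier_nodeRescale_latVec_neg,
    inv_mul_cancel_left₀ hN]

lemma synth_projCoord_apply (ψ φ : 𝓢(Config d, ℂ)) {G : Config d → ℂ}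
    (hG : ∀ x, HasSum (fun m => pChar κ m * (ψ (x - latVec m) * φ x)) (G x)) :
    synth N κ (projCoord N κ ψ) φ = ((N : ℝ) ^ d : ℝ)⁻¹ * ∑' j, G (node N κ j) := by
  have h := hasSum_synth_apply (κ := κ) (projCoord N κ ψ) φ
  rw [projCoord, (quasiPeriodic_projSeq ψ).extend_restr] at h
  rw [projCoord, ← h.tsum_eq, ← tsum_mul_left]
  refine tsum_congr fun j => ?_
  rw [← (hG (node N κ j)).tsum_eq, projSeq, ← normConst_sq]
  simp only [← mul_assoc]
  rw [tsum_mul_right]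
  push_cast
  simp only [intVec_eq_latVec]
  ring

theorem project_coe (ψ : 𝓢(Config d, ℂ)) :
    project N κ (ψ : 𝓢'(Config d, ℂ)) = synth N κ (projCoord N κ ψ) := by
  simp only [project, exp_I_mul, exp_neg_I_mul]
  refine HasSum.tsum_eq (hasSum_tempered_iff.mpr fun φ => ?_)
  obtain ⟨G, -, hG⟩ := exists_tsum_transl_config_apply_eq_integral (N := N) (κ := κ) ψ φ
  rw [synth_projCoord_apply ψ φ hG]
  refine (hasSum_poisson_node G).congr_fun fun n => ?_
  obtain ⟨G', tsum_apply, hG'⟩ := exists_tsum_transl_config_apply_eq_integral (N := N) (κ := κ) ψ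
    (charMul ((N : ℝ) • latVec n) φ)
  have G'_eq : G' = charMul ((N : ℝ) • latVec n) G := by
    ext x
    refine (hG' x).unique ?_
    rw [charMul_apply, charMul_apply]
    refine ((hG x).mul_left (ec (inner ℝ ((N : ℝ) • latVec n) x))).congr_fun fun m => ?_
    ring
  change ec _ * transl (hbar N) (0, intVec n) _ φ = _
  rw [transl_momentum_apply, ← G'_eq]
  exact congrArg _ tsum_apply

theorem hasSum_inner_projCoord (ψ : 𝓢(Config d, ℂ)) (c : Coord d N) :
    HasSum (fun j => (normConst d N : ℂ) *
      (extend N κ c j * (starRingEnd ℂ) (ψ (node N κ j)))) (inner ℂ (projCoord N κ ψ) c) := by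
  have summable : Summable fun j => (normConst d N : ℂ) *
      (extend N κ c j * (starRingEnd ℂ) (ψ (node N κ j))) := by
    refine Summable.mul_left _ (Summable.of_norm ?_)
    simpa only [norm_mul, RCLike.norm_conj] using
      (summable_mul_apply_node (N := N) (κ := κ) (norm_extend_le (κ := κ) c) ψ).norm
  rw [PiLp.inner_apply]
  refine hasSum_of_hasSum_coset summable fun r => ?_
  have hasSum_projSeq := (Complex.hasSum_conj' (f := _) (x := _)).mpr
    ((summable_pChar_mul (κ := κ) ψ (node N κ (rep r))).hasSum.mul_left (normConst d N : ℂ))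
  rw [RCLike.inner_apply]
  refine ((Equiv.neg _).hasSum_iff.mpr (hasSum_projSeq.mul_left (c r))).congr_fun fun k => ?_
  rw [extend_rep_add, node_add_smul]
  simp only [Function.comp_apply, Equiv.neg_apply, pChar_neg, map_mul, Complex.conj_conj,
    intVec_eq_latVec, map_neg, sub_neg_eq_add, Complex.conj_ofReal]
  ring

end Project

/-! ### The Gaussian integral behind the anti-Wick symbol -/

section GaussianIntegral

variable {d : ℕ} {N : ℕ+}

lemma continuous_gaussian : Continuous (gaussian d N) := by
  simpa only [← funext (gaussianS_apply d N)] using (gaussianS d N).continuous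

lemma conj_gaussian (q : Config d) : (starRingEnd ℂ) (gaussian d N q) = gaussian d N q :=
  Complex.conj_ofReal _

lemma gaussian_mul_gaussian (x y : Config d) :
    gaussian d N x * gaussian d N y = ((Real.pi * hbar N) ^ (-(d : ℝ) / 2) *
      Real.exp (-(‖x‖ ^ 2 + ‖y‖ ^ 2) / (2 * hbar N)) : ℝ) := by
  rw [gaussian, gaussian, ← Complex.ofReal_mul, mul_mul_mul_comm,
    ← Real.rpow_add (mul_pos Real.pi_pos (hbar_pos N)), ← Real.exp_add]
  ring_nf

lemma gaussian_neg_add_mul_gaussian_sub (u w : Config d) :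
    gaussian d N (-(u + w)) * gaussian d N (w - u) =
      Real.exp (-(‖w‖ ^ 2 / hbar N)) * gaussian d N u ^ 2 := by
  have parallelogram : ‖-(u + w)‖ ^ 2 + ‖w - u‖ ^ 2 = 2 * (‖u‖ ^ 2 + ‖w‖ ^ 2) := by
    rw [norm_neg, add_comm u w, parallelogram_law_with_norm ℝ w u]
    ring
  have exponent : -(2 * (‖u‖ ^ 2 + ‖w‖ ^ 2)) / (2 * hbar N) =
      -(‖w‖ ^ 2 / hbar N) + -(‖u‖ ^ 2 + ‖u‖ ^ 2) / (2 * hbar N) := by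
    have := (hbar_pos N).ne'
    field_simp
    ring
  rw [sq (gaussian d N u), gaussian_mul_gaussian, gaussian_mul_gaussian, parallelogram, exponent,
    Real.exp_add, ← Complex.ofReal_mul]
  congr 1
  ring

lemma gaussian_sq_mul_ec (l u : Config d) :
    ec (inner ℝ l u) * gaussian d N u ^ 2 = ((Real.pi * hbar N) ^ (-(d : ℝ) / 2) : ℝ) *
      Complex.exp (-((hbar N : ℝ)⁻¹ : ℂ) * ‖u‖ ^ 2 + 2 * Real.pi * Complex.I * inner ℝ l u) := by
  rw [sq (gaussian d N u), gaussian_mul_gaussian, Complex.exp_add, ec_eq_cexp_mul,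
    Complex.ofReal_mul, Complex.ofReal_exp]
  have exponent : ((-(‖u‖ ^ 2 + ‖u‖ ^ 2) / (2 * hbar N) : ℝ) : ℂ) =
      -((hbar N : ℝ)⁻¹ : ℂ) * ‖u‖ ^ 2 := by
    have : (hbar N : ℂ) ≠ 0 := Complex.ofReal_ne_zero.mpr (hbar_pos N).ne'
    push_cast
    field_simp
    ring
  rw [exponent]
  ring

lemma inv_hbar_re_pos : 0 < ((hbar N : ℝ)⁻¹ : ℂ).re := by
  rw [← Complex.ofReal_inv, Complex.ofReal_re]
  exact inv_pos.mpr (hbar_pos N)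

lemma integrable_ec_mul_gaussian_sq (l : Config d) :
    Integrable fun u => ec (inner ℝ l u) * gaussian d N u ^ 2 := by
  simp only [gaussian_sq_mul_ec]
  exact (GaussianFourier.integrable_cexp_neg_mul_sq_norm_add inv_hbar_re_pos _ l).const_mul _

lemma integral_ec_mul_gaussian_sq (l : Config d) :
    ∫ u, ec (inner ℝ l u) * gaussian d N u ^ 2 = Real.exp (-(hbar N * Real.pi ^ 2 * ‖l‖ ^ 2)) := by
  have hh := hbar_pos N
  simp only [gaussian_sq_mul_ec]
  rw [integral_const_mul, GaussianFourier.integral_cexp_neg_mul_sq_norm_add inv_hbar_re_pos,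
    finrank_euclideanSpace, Fintype.card_fin]
  have normalization : (Real.pi / ((hbar N : ℝ)⁻¹ : ℂ)) ^ ((d : ℂ) / 2) =
      ((Real.pi * hbar N) ^ ((d : ℝ) / 2) : ℝ) := by
    rw [Complex.ofReal_cpow (by positivity)]
    push_cast
    rw [div_inv_eq_mul]
  have exponent : (2 * Real.pi * Complex.I) ^ 2 * (‖l‖ : ℂ) ^ 2 / (4 * ((hbar N : ℝ)⁻¹ : ℂ)) =
      ((-(hbar N * Real.pi ^ 2 * ‖l‖ ^ 2) : ℝ) : ℂ) := by
    rw [mul_pow, Complex.I_sq, mul_comm (4 : ℂ), ← div_div, div_inv_eq_mul]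
    push_cast
    ring
  rw [normalization, exponent, ← mul_assoc, ← Complex.ofReal_mul, ← Real.rpow_add (by positivity),
    neg_div, neg_add_cancel, Real.rpow_zero, Complex.ofReal_one, one_mul, Complex.ofReal_exp]

variable (N) in
/-- The eigenvalue of anti-Wick smoothing on the character with frequency `n`: the anti-Wick
quantization of that character is `antiWickFactor N n` times its Weyl quantization. -/
def antiWickFactor (n : (Fin d → ℤ) × (Fin d → ℤ)) : ℝ :=
  Real.exp (-(Real.pi * (‖latVec n.1‖ ^ 2 + ‖latVec n.2‖ ^ 2) / (2 * N)))

variable (N) in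
/-- The product of two Gaussians at lattice nodes whose `y`-integral gives the matrix entries of
the anti-Wick quantization of the character with frequency `n`. -/
def positionTerm (n : (Fin d → ℤ) × (Fin d → ℤ)) (x y : Config d) : ℂ :=
  ec (inner ℝ (latVec n.2) y) *
    (gaussian d N (x - y) * gaussian d N (x + (N : ℝ)⁻¹ • latVec n.1 - y))

lemma positionTerm_add_midpoint (n : (Fin d → ℤ) × (Fin d → ℤ)) (x u : Config d) :
    positionTerm N n x (u + (x + (2 * (N : ℝ))⁻¹ • latVec n.1)) =
      ec (inner ℝ (latVec n.2) x + inner ℝ (latVec n.1) (latVec n.2) / (2 * N)) *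
      Real.exp (-(Real.pi * ‖latVec n.1‖ ^ 2 / (2 * N))) *
      (ec (inner ℝ (latVec n.2) u) * gaussian d N u ^ 2) := by
  have hN := (natCast_pos N).ne'
  set w := (2 * (N : ℝ))⁻¹ • latVec n.1 with hw
  have left_arg : x - (u + (x + w)) = -(u + w) := by abel
  have right_arg : x + (N : ℝ)⁻¹ • latVec n.1 - (u + (x + w)) = w - u := by
    have : (N : ℝ)⁻¹ • latVec n.1 = w + w := by
      rw [hw, ← two_smul ℝ ((2 * (N : ℝ))⁻¹ • latVec n.1), smul_smul]
      field_simp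
    rw [this]
    abel
  have norm_w : ‖w‖ ^ 2 / hbar N = Real.pi * ‖latVec n.1‖ ^ 2 / (2 * N) := by
    rw [hw, norm_smul, mul_pow, norm_inv, Real.norm_of_nonneg (by positivity), hbar]
    field_simp
  have phase : (inner ℝ (latVec n.2) (u + (x + w)) : ℝ) = (inner ℝ (latVec n.2) x +
      inner ℝ (latVec n.1) (latVec n.2) / (2 * N)) + inner ℝ (latVec n.2) u := by
    rw [hw, inner_add_right, inner_add_right, inner_smul_right,
      real_inner_comm (latVec n.2) (latVec n.1)]
    field_simp
    ring
  rw [positionTerm, left_arg, right_arg, gaussian_neg_add_mul_gaussian_sub, norm_w, phase, ec_add]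
  ring

lemma integrable_positionTerm (n : (Fin d → ℤ) × (Fin d → ℤ)) (x : Config d) :
    Integrable (positionTerm N n x) := by
  refine (((integrable_ec_mul_gaussian_sq (N := N) (latVec n.2)).const_mul
    (ec (inner ℝ (latVec n.2) x + inner ℝ (latVec n.1) (latVec n.2) / (2 * N)) *
      Real.exp (-(Real.pi * ‖latVec n.1‖ ^ 2 / (2 * N))))).comp_sub_right
    (x + (2 * (N : ℝ))⁻¹ • latVec n.1)).congr (Eventually.of_forall fun y => ?_)
  simp only
  rw [← positionTerm_add_midpoint, sub_add_cancel]

lemma integral_positionTerm (n : (Fin d → ℤ) × (Fin d → ℤ)) (x : Config d) :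
    ∫ y, positionTerm N n x y =
      ec (inner ℝ (latVec n.2) x + inner ℝ (latVec n.1) (latVec n.2) / (2 * N)) *
        antiWickFactor N n := by
  rw [← integral_add_right_eq_self _ (x + (2 * (N : ℝ))⁻¹ • latVec n.1)]
  simp only [positionTerm_add_midpoint]
  rw [integral_const_mul, integral_ec_mul_gaussian_sq, mul_assoc, ← Complex.ofReal_mul,
    ← Real.exp_add, antiWickFactor, hbar]
  have := (natCast_pos N).ne'
  congr 3
  field_simp
  ring

lemma positionTerm_add_latVec (n : (Fin d → ℤ) × (Fin d → ℤ)) (x y : Config d)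
    (k : Fin d → ℤ) :
    positionTerm N n (x + latVec k) y = positionTerm N n x (y + latVec (-k)) := by
  rw [positionTerm, positionTerm, ec_inner_latVec_add_latVec, map_neg]
  congr 3 <;> abel

lemma hasSum_integral_unitCube_positionTerm (n : (Fin d → ℤ) × (Fin d → ℤ)) (x : Config d) :
    HasSum (fun k => ∫ y in unitCube (Fin d), positionTerm N n (x + latVec k) y)
      (ec (inner ℝ (latVec n.2) x + inner ℝ (latVec n.1) (latVec n.2) / (2 * N)) *
        antiWickFactor N n) := by
  simp only [positionTerm_add_latVec, ← integral_positionTerm n x]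
  exact (Equiv.neg _).hasSum_iff.mpr
    (hasSum_integral_unitCube_add_latVec (integrable_positionTerm n x))

end GaussianIntegral

/-! ### Overlaps with coherent states -/

section Overlap

variable {d : ℕ} {N : ℕ+} {κ : Phase d}

variable (N) in
/-- The translated Gaussian `U_ħ(a) η_ħ`. -/
def wave (a : Phase d) : 𝓢(Config d, ℂ) := translS (hbar N) a (gaussianS d N)

lemma wave_apply (a : Phase d) (q : Config d) :
    wave N a q = ec (N * (inner ℝ a.2 q - inner ℝ a.1 a.2 / 2)) * gaussian d N (q - a.1) := by
  rw [wave, translS_apply, phaseFactor_eq_ec, gaussianS_apply]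

variable (N κ) in
/-- The coordinates of the coherent state `η^a_{ħ,κ}` in the basis `ψ_r^κ`. -/
def cohCoord (a : Phase d) : Coord d N := projCoord N κ (wave N a)

lemma coherent_eq (a : Phase d) : coherent N κ a = synth N κ (cohCoord N κ a) := by
  rw [coherent, gaussianDist_eq, transl_coe, project_coe]
  rfl

lemma coords_coherent (a : Phase d) : coords N κ (coherent N κ a) = cohCoord N κ a := by
  rw [coherent_eq, coords_synth]

variable (N κ) in
lemma exists_summable_norm_apply_node_sub_le (ψ : 𝓢(Config d, ℂ)) (R : ℝ) :
    ∃ v : (Fin d → ℤ) → ℝ, Summable v ∧ ∀ y, ‖y‖ ≤ R → ∀ j, ‖ψ (node N κ j - y)‖ ≤ v j := by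
  have hN := natCast_pos N
  obtain ⟨v, hv, hb⟩ := exists_summable_norm_add_latVec_le (nodeRescale N κ ψ) (N * R)
  refine ⟨v, hv, fun y hy j => ?_⟩
  have norm_le : ‖-((N : ℝ) • y)‖ ≤ N * R := by
    rw [norm_neg, norm_smul, Real.norm_of_nonneg hN.le]
    gcongr
  have arg_eq : (N : ℝ)⁻¹ • (-((N : ℝ) • y) + latVec j) + (2 * Real.pi * (N : ℝ))⁻¹ • κ.1 =
      node N κ j - y := by
    rw [smul_add, smul_neg, inv_smul_smul₀ hN.ne', node, intVec_eq_latVec]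
    abel
  simpa only [nodeRescale_apply, arg_eq] using hb _ norm_le j

variable (N κ) in
/-- The part of the `j`-th term of `⟨η^a_{ħ,κ}, c⟩` that depends on the position `y = a_q`
only, see `hasSum_overlap`. -/
def overlapTerm (c : Coord d N) (j : Fin d → ℤ) (y : Config d) : ℂ :=
  normConst d N * (extend N κ c j * gaussian d N (node N κ j - y))

@[fun_prop] lemma continuous_overlapTerm (c : Coord d N) (j : Fin d → ℤ) :
    Continuous (overlapTerm N κ c j) :=
  continuous_const.mul (continuous_const.mul
    (continuous_gaussian.comp (continuous_const.sub continuous_id)))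

variable (κ) in
lemma exists_summable_norm_overlapTerm_le (c : Coord d N) (R : ℝ) :
    ∃ v : (Fin d → ℤ) → ℝ, Summable v ∧ ∀ y, ‖y‖ ≤ R → ∀ j, ‖overlapTerm N κ c j y‖ ≤ v j := by
  obtain ⟨v, hv, hb⟩ := exists_summable_norm_apply_node_sub_le N κ (gaussianS d N) R
  refine ⟨fun j => normConst d N * (‖c‖ * v j), (hv.mul_left _).mul_left _, fun y hy j => ?_⟩
  rw [overlapTerm, norm_mul, norm_mul, Complex.norm_real, Real.norm_of_nonneg normConst_pos.le,
    ← gaussianS_apply]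
  exact mul_le_mul_of_nonneg_left (mul_le_mul (norm_extend_le c j) (hb y hy j) (norm_nonneg _)
    (norm_nonneg _)) normConst_pos.le

lemma hasSum_overlap (a : Phase d) (c : Coord d N) :
    HasSum (fun j => ec (N * (inner ℝ a.1 a.2 / 2)) *
      (overlapTerm N κ c j a.1 * ec (-(N * inner ℝ a.2 (node N κ j)))))
      (inner ℂ (cohCoord N κ a) c) := by
  refine (hasSum_inner_projCoord (wave N a) c).congr_fun fun j => ?_
  have phase : -((N : ℝ) * (inner ℝ a.2 (node N κ j) - inner ℝ a.1 a.2 / 2)) =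
    N * (inner ℝ a.1 a.2 / 2) + -(N * inner ℝ a.2 (node N κ j)) := by ring
  rw [wave_apply, map_mul, conj_gaussian, conj_ec, overlapTerm, phase, ec_add]
  ring

lemma continuous_overlap (c : Coord d N) :
    Continuous fun a : Phase d => inner ℂ (cohCoord N κ a) c := by
  refine continuous_iff_continuousAt.mpr fun a => ?_
  obtain ⟨v, hv, hb⟩ := exists_summable_norm_overlapTerm_le κ c (‖a‖ + 1)
  have : ContinuousOn (fun a : Phase d => inner ℂ (cohCoord N κ a) c) (Metric.ball a 1) := by
    simp only [fun a : Phase d => (hasSum_overlap (κ := κ) a c).tsum_eq.symm]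
    refine continuousOn_tsum (fun j => by fun_prop) hv fun j y hy => ?_
    rw [norm_mul, norm_ec, one_mul, norm_mul, norm_ec, mul_one]
    exact hb _ ((norm_fst_le y).trans
      (norm_le_norm_add_const_of_dist_le (Metric.mem_ball.mp hy).le)) j
  exact this.continuousAt (Metric.ball_mem_nhds a one_pos)

lemma continuous_cohCoord : Continuous (cohCoord N κ) := by
  refine (PiLp.continuous_toLp 2 _).comp (continuous_pi fun r => ?_)
  refine (Complex.continuous_conj.comp
    (continuous_overlap (κ := κ) (EuclideanSpace.single r (1 : ℂ)))).congr fun a => ?_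
  simp only [Function.comp_apply, EuclideanSpace.inner_single_right, one_mul, RCLike.conj_conj]
  rfl

lemma natCast_mul_inner_node_sub (y : Config d) (j k : Fin d → ℤ) :
    (N : ℝ) * inner ℝ y (node N κ k) - N * inner ℝ y (node N κ j) =
      inner ℝ (latVec (k - j)) y := by
  have hN := (natCast_pos N).ne'
  rw [real_inner_comm _ (latVec (k - j)), map_sub, inner_sub_right]
  simp only [node, inner_add_right, inner_smul_right, intVec_eq_latVec]
  field_simp
  ring

/-- Expanding the square leaves a Fourier series in `a_p` whose coefficients depend on `a_q`
only; the integral over `a_p` selects `p.2 = p.1 + n.1`. -/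
lemma hasSum_normSq_overlap (n : (Fin d → ℤ) × (Fin d → ℤ)) (a : Phase d) (c : Coord d N) :
    HasSum (fun p : (Fin d → ℤ) × (Fin d → ℤ) =>
      ec (inner ℝ (latVec n.2) a.1) *
        (overlapTerm N κ c p.1 a.1 * (starRingEnd ℂ) (overlapTerm N κ c p.2 a.1)) *
        ec (inner ℝ (latVec (p.2 - p.1 - n.1)) a.2))
      (ec (-symp (intPhase n) a) * ((‖inner ℂ (cohCoord N κ a) c‖ ^ 2 : ℝ) : ℂ)) := by
  have overlap := hasSum_overlap (κ := κ) a c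
  have overlap_conj := Complex.hasSum_conj'.mpr overlap
  have summable := summable_mul_of_summable_norm overlap.summable.norm overlap_conj.summable.norm
  have product := (overlap.mul overlap_conj summable).mul_left (ec (-symp (intPhase n) a))
  rw [Complex.mul_conj, Complex.normSq_eq_norm_sq] at product
  refine product.congr_fun fun p => ?_
  rw [map_mul, map_mul, conj_ec, conj_ec]
  have phases : ec (inner ℝ (latVec n.2) a.1) * ec (inner ℝ (latVec (p.2 - p.1 - n.1)) a.2) =
      ec (-symp (intPhase n) a) * (ec (N * (inner ℝ a.1 a.2 / 2)) *
        ec (-(N * inner ℝ a.2 (node N κ p.1))) * ec (-(N * (inner ℝ a.1 a.2 / 2))) *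
        ec (- -(N * inner ℝ a.2 (node N κ p.2)))) := by
    simp only [← ec_add]
    congr 1
    rw [map_sub latVec (p.2 - p.1), inner_sub_left,
      ← natCast_mul_inner_node_sub (N := N) (κ := κ)]
    simp only [symp, intPhase, intVec_eq_latVec]
    ring
  linear_combination (overlapTerm N κ c p.1 a.1 *
    (starRingEnd ℂ) (overlapTerm N κ c p.2 a.1)) * phases

end Overlap

/-! ### The anti-Wick symbol of the translations -/

section AntiWick

variable {d : ℕ} {N : ℕ+} {κ : Phase d}

lemma integral_cube_mul (f g : Config d → ℂ) :
    ∫ a in cube d, f a.1 * g a.2 =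
      (∫ y in unitCube (Fin d), f y) * ∫ y in unitCube (Fin d), g y := by
  rw [cube_eq_prod]
  exact setIntegral_prod_mul f g _ _

instance : IsProbabilityMeasure (volume.restrict (cube d)) := by
  rw [cube_eq_prod, Measure.volume_eq_prod, ← Measure.prod_restrict]
  infer_instance

lemma measurableSet_cube : MeasurableSet (cube d) := by
  rw [cube_eq_prod]
  exact measurableSet_unitCube.prod measurableSet_unitCube

lemma ae_cube {p : Phase d → Prop} (h : ∀ a ∈ cube d, p a) :
    ∀ᵐ a ∂(volume.restrict (cube d)), p a :=
  (ae_restrict_iff' measurableSet_cube).mpr (Eventually.of_forall h)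

lemma norm_le_of_mem_cube {a : Phase d} (ha : a ∈ cube d) : ‖a‖ ≤ √(Fintype.card (Fin d)) := by
  rw [cube_eq_prod] at ha
  exact norm_prod_le_iff.mpr ⟨norm_le_of_mem_unitCube ha.1, norm_le_of_mem_unitCube ha.2⟩

lemma hasSum_integral_cube_overlap_pairs (n : (Fin d → ℤ) × (Fin d → ℤ)) (c : Coord d N) :
    HasSum (fun p : (Fin d → ℤ) × (Fin d → ℤ) =>
      ∫ a in cube d, ec (inner ℝ (latVec n.2) a.1) *
        (overlapTerm N κ c p.1 a.1 * (starRingEnd ℂ) (overlapTerm N κ c p.2 a.1)) *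
        ec (inner ℝ (latVec (p.2 - p.1 - n.1)) a.2))
      (∫ a in cube d,
        ec (-symp (intPhase n) a) * ((‖inner ℂ (cohCoord N κ a) c‖ ^ 2 : ℝ) : ℂ)) := by
  obtain ⟨v, hv, hb⟩ := exists_summable_norm_overlapTerm_le κ c (√(Fintype.card (Fin d)))
  have hv0 (j : Fin d → ℤ) : 0 ≤ v j := (norm_nonneg _).trans (hb 0 (by simp) j)
  have hb' {a : Phase d} (ha : a ∈ cube d) :=
    hb a.1 ((norm_fst_le a).trans (norm_le_of_mem_cube ha))
  simp only [← (hasSum_normSq_overlap n _ c).tsum_eq]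
  refine hasSum_integral_of_norm_le (hv.mul_of_nonneg hv hv0 hv0) (fun p => ?_)
    fun p => ae_cube fun a ha => ?_
  · have term_continuous (j : Fin d → ℤ) : Continuous fun a : Phase d => overlapTerm N κ c j a.1 :=
      (continuous_overlapTerm c j).comp continuous_fst
    refine Continuous.aestronglyMeasurable (Continuous.mul (Continuous.mul (by fun_prop) ?_)
      (by fun_prop))
    exact (term_continuous p.1).mul (Complex.continuous_conj.comp (term_continuous p.2))
  · rw [norm_mul, norm_mul, norm_ec, norm_ec, one_mul, mul_one, norm_mul, RCLike.norm_conj]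
    exact mul_le_mul (hb' ha _) (hb' ha _) (norm_nonneg _) (hv0 _)

lemma hasSum_integral_unitCube_overlap (n : (Fin d → ℤ) × (Fin d → ℤ)) (c : Coord d N) :
    HasSum (fun j => ∫ y in unitCube (Fin d), ec (inner ℝ (latVec n.2) y) *
        (overlapTerm N κ c j y * (starRingEnd ℂ) (overlapTerm N κ c (j + n.1) y)))
      (∫ a in cube d,
        ec (-symp (intPhase n) a) * ((‖inner ℂ (cohCoord N κ a) c‖ ^ 2 : ℝ) : ℂ)) := by
  have momentum_integral (p : (Fin d → ℤ) × (Fin d → ℤ)) :=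
    integral_cube_mul (fun y => ec (inner ℝ (latVec n.2) y) *
      (overlapTerm N κ c p.1 y * (starRingEnd ℂ) (overlapTerm N κ c p.2 y)))
      (fun y => ec (inner ℝ (latVec (p.2 - p.1 - n.1)) y))
  simp only [integral_unitCube_ec_inner_latVec] at momentum_integral
  have pairs := hasSum_integral_cube_overlap_pairs (κ := κ) n c
  simp only [momentum_integral] at pairs
  have graph_injective : Function.Injective fun j : Fin d → ℤ => (j, j + n.1) :=
    fun j k hjk => congrArg Prod.fst hjk
  rw [← graph_injective.hasSum_iff] at pairs
  · simpa [Function.comp_def] using pairs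
  · rintro ⟨j, k⟩ hjk
    have off_graph : k - j - n.1 ≠ 0 := fun h => hjk ⟨j, by
      rw [sub_sub, sub_eq_zero] at h
      exact Prod.ext rfl h.symm⟩
    rw [if_neg off_graph, mul_zero]

lemma overlapTerm_mul_conj (n : (Fin d → ℤ) × (Fin d → ℤ)) (c : Coord d N) (j : Fin d → ℤ)
    (y : Config d) :
    ec (inner ℝ (latVec n.2) y) *
        (overlapTerm N κ c j y * (starRingEnd ℂ) (overlapTerm N κ c (j + n.1) y)) =
      (normConst d N : ℂ) ^ 2 * (extend N κ c j * (starRingEnd ℂ) (extend N κ c (j + n.1))) *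
        positionTerm N n (node N κ j) y := by
  rw [overlapTerm, overlapTerm, map_mul, map_mul, conj_gaussian, Complex.conj_ofReal,
    positionTerm, node_add, intVec_eq_latVec]
  ring

lemma QuasiPeriodic.mul_conj_add_smul {b b' : (Fin d → ℤ) → ℂ} (hb : QuasiPeriodic N κ b)
    (hb' : QuasiPeriodic N κ b') (i j k : Fin d → ℤ) :
    b (i + (N : ℤ) • k) * (starRingEnd ℂ) (b' (j + (N : ℤ) • k)) =
      b i * (starRingEnd ℂ) (b' j) := by
  have unitary : pChar κ k * (starRingEnd ℂ) (pChar κ k) = 1 := by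
    rw [Complex.mul_conj, Complex.normSq_eq_norm_sq, norm_pChar, one_pow, Complex.ofReal_one]
  rw [hb, hb', map_mul]
  linear_combination (b i * (starRingEnd ℂ) (b' j)) * unitary

lemma integral_cube_char_mul_normSq_overlap_eq_sum (n : (Fin d → ℤ) × (Fin d → ℤ))
    (c : Coord d N) :
    ∫ a in cube d, ec (-symp (intPhase n) a) * ((‖inner ℂ (cohCoord N κ a) c‖ ^ 2 : ℝ) : ℂ) =
      ∑ r : Fin d → Fin (N : ℕ), (normConst d N : ℂ) ^ 2 *
        (extend N κ c (rep r) * (starRingEnd ℂ) (extend N κ c (rep r + n.1))) *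
        (ec (inner ℝ (latVec n.2) (node N κ (rep r)) +
          inner ℝ (latVec n.1) (latVec n.2) / (2 * N)) * antiWickFactor N n) := by
  have series := hasSum_integral_unitCube_overlap (κ := κ) n c
  simp only [overlapTerm_mul_conj, integral_const_mul] at series
  refine series.unique (hasSum_of_hasSum_coset series.summable fun r => ?_)
  have periodic := (quasiPeriodic_extend (κ := κ) c).mul_conj_add_smul (quasiPeriodic_extend c)
    (rep r) (rep r + n.1)
  simp only [node_add_smul, intVec_eq_latVec, add_right_comm _ _ n.1, periodic]
  exact (hasSum_integral_unitCube_positionTerm n (node N κ (rep r))).mul_left _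

lemma inner_shiftCoord_eq_sum (n : (Fin d → ℤ) × (Fin d → ℤ)) (c : Coord d N) :
    inner ℂ c (shiftCoord N κ n c) =
      ∑ r : Fin d → Fin (N : ℕ),
        extend N κ c (rep r) * (starRingEnd ℂ) (extend N κ c (rep r + n.1)) *
        ec (inner ℝ (latVec n.2) (node N κ (rep r)) +
          inner ℝ (latVec n.1) (latVec n.2) / (2 * N)) := by
  have hb := quasiPeriodic_extend (κ := κ) c
  have shifted := sum_rep_add_of_periodic (N := N) (h := fun j =>
    shiftSeq N κ n (extend N κ c) j * (starRingEnd ℂ) (extend N κ c j))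
    (fun j k => (hb.shiftSeq n).mul_conj_add_smul hb j j k) n.1
  have inner_eq : inner ℂ c (shiftCoord N κ n c) = ∑ r : Fin d → Fin (N : ℕ),
      shiftSeq N κ n (extend N κ c) (rep r) * (starRingEnd ℂ) (extend N κ c (rep r)) := by
    simp only [PiLp.inner_apply, RCLike.inner_apply, extend_rep]
    rfl
  rw [inner_eq, ← shifted]
  refine Finset.sum_congr rfl fun r _ => ?_
  have phase : (inner ℝ (intVec n.2) (node N κ (rep r) + (N : ℝ)⁻¹ • intVec n.1) -
      inner ℝ (intVec n.1) (intVec n.2) / (2 * N) : ℝ) =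
      inner ℝ (latVec n.2) (node N κ (rep r)) + inner ℝ (latVec n.1) (latVec n.2) / (2 * N) := by
    rw [inner_add_right, inner_smul_right, intVec_eq_latVec, intVec_eq_latVec,
      real_inner_comm (latVec n.1) (latVec n.2)]
    field_simp
    ring
  rw [shiftSeq, add_sub_cancel_right, node_add, phase]
  ring

theorem integral_cube_char_mul_normSq_overlap (n : (Fin d → ℤ) × (Fin d → ℤ)) (c : Coord d N) :
    ((N : ℝ) ^ d : ℝ) * ∫ a in cube d,
        ec (-symp (intPhase n) a) * ((‖inner ℂ (cohCoord N κ a) c‖ ^ 2 : ℝ) : ℂ) =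
      antiWickFactor N n * inner ℂ c (shiftCoord N κ n c) := by
  have normalization : (((N : ℝ) ^ d : ℝ) : ℂ) * (normConst d N : ℂ) ^ 2 = 1 := by
    rw [← Complex.ofReal_pow, normConst_sq, ← Complex.ofReal_mul,
      mul_inv_cancel₀ (pow_pos (natCast_pos N) d).ne', Complex.ofReal_one]
  rw [integral_cube_char_mul_normSq_overlap_eq_sum, inner_shiftCoord_eq_sum, Finset.mul_sum,
    Finset.mul_sum]
  refine Finset.sum_congr rfl fun r _ => ?_
  linear_combination (extend N κ c (rep r) * (starRingEnd ℂ) (extend N κ c (rep r + n.1)) *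
    (ec (inner ℝ (latVec n.2) (node N κ (rep r)) +
      inner ℝ (latVec n.1) (latVec n.2) / (2 * N)) * antiWickFactor N n)) * normalization

end AntiWick

/-! ### Superpositions of coherent states -/

section Resolution

variable {d : ℕ} {N : ℕ+} {κ : Phase d}

lemma exists_isCompact_cube_subset (d : ℕ) : ∃ K : Set (Phase d), IsCompact K ∧ cube d ⊆ K :=
  ⟨Metric.closedBall 0 (√(Fintype.card (Fin d))), isCompact_closedBall _ _,
    fun _ ha => mem_closedBall_zero_iff.mpr (norm_le_of_mem_cube ha)⟩

lemma integrableOn_cube {E : Type*} [NormedAddCommGroup E] {f : Phase d → E}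
    (hf : Continuous f) : IntegrableOn f (cube d) := by
  obtain ⟨K, hK, hs⟩ := exists_isCompact_cube_subset d
  exact (hf.continuousOn.integrableOn_compact hK).mono_set hs

lemma exists_bound_cube {E : Type*} [NormedAddCommGroup E] {f : Phase d → E}
    (hf : Continuous f) : ∃ C, ∀ a ∈ cube d, ‖f a‖ ≤ C := by
  obtain ⟨K, hK, hs⟩ := exists_isCompact_cube_subset d
  obtain ⟨C, hC⟩ := hK.exists_bound_of_continuousOn hf.continuousOn
  exact ⟨C, fun a ha => hC a (hs ha)⟩

variable (N κ) in
/-- The Husimi density `(2πħ)^{-d} |⟨η^a_{ħ,κ}, c⟩|²` on the torus of the vector with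
coordinates `c`. -/
def husimi (c : Coord d N) (a : Phase d) : ℝ :=
  (N : ℝ) ^ d * ‖inner ℂ (cohCoord N κ a) c‖ ^ 2

@[fun_prop] lemma continuous_husimi (c : Coord d N) : Continuous (husimi N κ c) :=
  continuous_const.mul ((continuous_overlap c).norm.pow 2)

lemma husimi_nonneg (c : Coord d N) (a : Phase d) : 0 ≤ husimi N κ c a :=
  mul_nonneg (pow_nonneg (Nat.cast_nonneg _) _) (sq_nonneg _)

lemma shiftCoord_zero (c : Coord d N) : shiftCoord N κ 0 c = c := by
  have shiftSeq_zero : shiftSeq N κ 0 (extend N κ c) = extend N κ c := by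
    funext j
    simp [shiftSeq, intVec_eq_latVec]
  rw [shiftCoord, shiftSeq_zero, restr_extend]

lemma integral_char_mul_husimi (n : (Fin d → ℤ) × (Fin d → ℤ)) (c : Coord d N) :
    ∫ a in cube d, ec (-symp (intPhase n) a) * (husimi N κ c a : ℂ) =
      antiWickFactor N n * inner ℂ c (shiftCoord N κ n c) := by
  rw [← integral_cube_char_mul_normSq_overlap, ← integral_const_mul]
  simp only [husimi, Complex.ofReal_mul, mul_left_comm]

lemma integral_husimi (c : Coord d N) : ∫ a in cube d, husimi N κ c a = ‖c‖ ^ 2 := by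
  have h := integral_char_mul_husimi (κ := κ) 0 c
  simp only [shiftCoord_zero, inner_self_eq_norm_sq_to_K, antiWickFactor, symp, intPhase,
    intVec_eq_latVec, Prod.fst_zero, Prod.snd_zero, map_zero, inner_zero_left, sub_zero, neg_zero,
    ec_zero, one_mul, norm_zero, integral_complex_ofReal, ne_eq, OfNat.ofNat_ne_zero,
    not_false_eq_true, zero_pow, add_zero, mul_zero, zero_div, Real.exp_zero,
    Complex.ofReal_one] at h
  exact Complex.ofReal_injective (h.trans (Complex.ofReal_pow _ _).symm)

variable (N κ) in
/-- The restricted superposition `(2πħ)^{-d} ∫ χ(a) ⟨η^a_{ħ,κ}, c⟩ η^a_{ħ,κ} da` in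
coordinates; this is the anti-Wick quantization of `χ` applied to `c`. -/
def superpose (χ : Phase d → ℝ) (c : Coord d N) : Coord d N :=
  (N : ℝ) ^ d • ∫ a in cube d,
    ((χ a : ℂ) * inner ℂ (cohCoord N κ a) c) • cohCoord N κ a

lemma superposition_synth (χ : Phase d → ℝ) (c : Coord d N) :
    superposition N κ χ (synth N κ c) = superpose N κ χ c := by
  have inv_planck : (2 * Real.pi * hbar N)⁻¹ = (N : ℝ) := by
    have := (natCast_pos N).ne'
    rw [hbar]
    field_simp
  simp only [superposition, superpose, hInner, coords_coherent, coords_synth]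
  rw [← inv_pow, inv_planck]

lemma integrableOn_superpose {χ : Phase d → ℝ} (hχ : Continuous χ) (c : Coord d N) :
    IntegrableOn (fun a => ((χ a : ℂ) * inner ℂ (cohCoord N κ a) c) • cohCoord N κ a) (cube d) :=
  integrableOn_cube <| ((Complex.continuous_ofReal.comp hχ).mul (continuous_overlap c)).smul
    continuous_cohCoord

lemma inner_superpose {χ : Phase d → ℝ} (hχ : Continuous χ) (v c : Coord d N) :
    inner ℂ v (superpose N κ χ c) = ((N : ℝ) ^ d : ℝ) * ∫ a in cube d,
      (χ a : ℂ) * inner ℂ (cohCoord N κ a) c * inner ℂ v (cohCoord N κ a) := by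
  rw [superpose, inner_smul_right_eq_smul, Complex.real_smul,
    ← integral_inner (integrableOn_superpose hχ c)]
  simp only [inner_smul_right]

lemma inner_self_superpose {χ : Phase d → ℝ} (hχ : Continuous χ) (c : Coord d N) :
    inner ℂ c (superpose N κ χ c) = ((∫ a in cube d, χ a * husimi N κ c a : ℝ) : ℂ) := by
  rw [inner_superpose hχ, ← integral_complex_ofReal, ← integral_const_mul]
  congr 1
  funext a
  rw [husimi, ← inner_conj_symm c, mul_assoc (χ a : ℂ), Complex.mul_conj,
    Complex.normSq_eq_norm_sq]
  push_cast
  ring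

lemma superpose_add {χ χ' : Phase d → ℝ} (hχ : Continuous χ) (hχ' : Continuous χ')
    (c : Coord d N) :
    superpose N κ (fun a => χ a + χ' a) c = superpose N κ χ c + superpose N κ χ' c := by
  rw [superpose, superpose, superpose, ← smul_add,
    ← integral_add (integrableOn_superpose hχ c) (integrableOn_superpose hχ' c)]
  simp only [Complex.ofReal_add, add_mul, add_smul]

variable (N κ) in
/-- The restricted superposition as a linear operator. -/
def superposeLin {χ : Phase d → ℝ} (hχ : Continuous χ) : Coord d N →ₗ[ℂ] Coord d N where
  toFun := superpose N κ χ
  map_add' c c' := by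
    rw [superpose, superpose, superpose, ← smul_add,
      ← integral_add (integrableOn_superpose hχ c) (integrableOn_superpose hχ c')]
    simp only [inner_add_right, mul_add, add_smul]
  map_smul' t c := by
    rw [superpose, superpose, RingHom.id_apply, smul_comm t, ← integral_smul t]
    simp only [inner_smul_right, smul_smul, mul_left_comm]

/-- The resolution of the identity: both sides have the same quadratic form, because the Husimi
density has total mass `‖c‖²`. -/
theorem superpose_one (c : Coord d N) : superpose N κ (fun _ => 1) c = c := by
  have eq_id : superposeLin N κ (χ := fun _ => 1) continuous_const = LinearMap.id := by
    rw [← ext_inner_map]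
    intro c
    change inner ℂ (superpose N κ (fun _ => 1) c) c = inner ℂ c c
    rw [← inner_conj_symm, inner_self_superpose continuous_const, Complex.conj_ofReal]
    simp only [one_mul, integral_husimi, inner_self_eq_norm_sq_to_K]
    norm_cast
  exact LinearMap.congr_fun eq_id c

lemma sub_superpose {χ : Phase d → ℝ} (hχ : Continuous χ) (c : Coord d N) :
    c - superpose N κ χ c = superpose N κ (fun a => 1 - χ a) c := by
  have hχ' : Continuous fun a => 1 - χ a := continuous_const.sub hχ
  rw [sub_eq_iff_eq_add', ← superpose_add hχ hχ']
  simp only [add_sub_cancel, superpose_one]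

/-- By the resolution of the identity the error is `u = ∫ (1 - χ) ⟨η, c⟩ η`; the Cauchy-Schwarz
inequality for `⟨u, u⟩` leaves the total mass `‖u‖²` of the Husimi density of `u`. -/
theorem norm_sub_superpose_sq_le {χ : Phase d → ℝ} (hχ : Continuous χ) (c : Coord d N) :
    ‖c - superpose N κ χ c‖ ^ 2 ≤ ∫ a in cube d, (1 - χ a) ^ 2 * husimi N κ c a := by
  have hχ' : Continuous fun a => 1 - χ a := continuous_const.sub hχ
  set u := c - superpose N κ χ c with hu
  have normSq_u : ‖u‖ ^ 2 = ‖∫ a in cube d, ((N : ℝ) ^ d : ℝ) *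
      (((1 - χ a : ℝ) : ℂ) * inner ℂ (cohCoord N κ a) c * inner ℂ u (cohCoord N κ a))‖ := by
    rw [integral_const_mul, ← inner_superpose hχ', ← sub_superpose hχ, ← hu,
      inner_self_eq_norm_sq_to_K]
    simp
  have outside : IntegrableOn (fun a => (1 - χ a) ^ 2 * husimi N κ c a) (cube d) :=
    integrableOn_cube (by fun_prop)
  have husimi_u : IntegrableOn (husimi N κ u) (cube d) := integrableOn_cube (by fun_prop)
  have normSq_le :
      ‖u‖ ^ 2 ≤ ∫ a in cube d, ((1 - χ a) ^ 2 * husimi N κ c a + husimi N κ u a) / 2 := by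
    rw [normSq_u]
    refine norm_integral_le_of_norm_le ((outside.add husimi_u).div_const 2)
      (Eventually.of_forall fun a => ?_)
    simp only [norm_mul, Complex.norm_real, husimi]
    rw [norm_inner_symm u, Real.norm_of_nonneg (by positivity), Real.norm_eq_abs]
    have amgm := two_mul_le_add_sq (|1 - χ a| * ‖inner ℂ (cohCoord N κ a) c‖)
      ‖inner ℂ (cohCoord N κ a) u‖
    rw [mul_pow, sq_abs] at amgm
    have := mul_le_mul_of_nonneg_left amgm (by positivity : (0 : ℝ) ≤ (N : ℝ) ^ d)
    linarith
  rw [integral_div, integral_add outside husimi_u, integral_husimi] at normSq_le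
  linarith

theorem integral_one_sub_mul_husimi_le {χ : Phase d → ℝ} (hχ : Continuous χ) (c : Coord d N) :
    ∫ a in cube d, (1 - χ a) * husimi N κ c a ≤ ‖c‖ * ‖c - superpose N κ χ c‖ :=
  have hχ' : Continuous fun a => 1 - χ a := continuous_const.sub hχ
  calc ∫ a in cube d, (1 - χ a) * husimi N κ c a
      ≤ ‖((∫ a in cube d, (1 - χ a) * husimi N κ c a : ℝ) : ℂ)‖ :=
        (le_abs_self _).trans_eq (Complex.norm_real _).symm
    _ = ‖(inner ℂ c (c - superpose N κ χ c) : ℂ)‖ := by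
        rw [sub_superpose hχ, inner_self_superpose hχ']
    _ ≤ ‖c‖ * ‖c - superpose N κ χ c‖ := norm_inner_le_norm _ _

end Resolution

/-! ### Weyl quantization versus anti-Wick quantization -/

section QuantizationError

variable {d : ℕ} {N : ℕ+} {κ : Phase d}

variable (N κ) in
/-- The expectation value `⟨Ψ, Op^W(f) Ψ⟩` for the vector `Ψ ∈ 𝓗_ħ(κ)` with coordinates `c`. -/
def weylExpectation (f : Phase d → ℂ) (c : Coord d N) : ℂ :=
  inner ℂ c (coords N κ (opW N f (synth N κ c)))

/-- An upper bound for the operator norm of the difference between the Weyl and the anti-Wick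
quantization of `f`. -/
def quantError (f : Phase d → ℂ) (N : ℕ+) : ℝ :=
  ∑' n : (Fin d → ℤ) × (Fin d → ℤ),
    ‖sympFourier f ((2 * Real.pi) • intPhase n)‖ * |1 - antiWickFactor N n|

lemma quantError_nonneg (f : Phase d → ℂ) (N : ℕ+) : 0 ≤ quantError f N :=
  tsum_nonneg fun _ => by positivity

lemma abs_one_sub_antiWickFactor_le_one (n : (Fin d → ℤ) × (Fin d → ℤ)) :
    |1 - antiWickFactor N n| ≤ 1 := by
  have pos : 0 < antiWickFactor N n := Real.exp_pos _
  have le_one : antiWickFactor N n ≤ 1 :=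
    Real.exp_le_one_iff.mpr (neg_nonpos.mpr (by positivity))
  rw [abs_of_nonneg (sub_nonneg.mpr le_one)]
  linarith

lemma tendsto_antiWickFactor (n : (Fin d → ℤ) × (Fin d → ℤ)) :
    Tendsto (fun N => antiWickFactor N n) atTop (𝓝 1) := by
  have tendsto_cast : Tendsto (fun N : ℕ+ => ((N : ℕ) : ℝ)) atTop atTop :=
    tendsto_natCast_atTop_atTop.comp tendsto_PNat_val_atTop_atTop
  have exponent : Tendsto (fun N : ℕ+ => -(Real.pi * (‖latVec n.1‖ ^ 2 + ‖latVec n.2‖ ^ 2) /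
      (2 * ((N : ℕ) : ℝ)))) atTop (𝓝 0) := by
    simpa only [neg_zero] using
      (tendsto_const_nhds.div_atTop (tendsto_cast.const_mul_atTop two_pos)).neg
  simpa only [Real.exp_zero, Function.comp_def, antiWickFactor] using
    (Real.continuous_exp.tendsto 0).comp exponent

namespace TorusSmooth

variable {f : Phase d → ℂ}

variable (N) in
lemma summable_quantError (hf : TorusSmooth f) :
    Summable fun n : (Fin d → ℤ) × (Fin d → ℤ) =>
      ‖sympFourier f ((2 * Real.pi) • intPhase n)‖ * |1 - antiWickFactor N n| :=
  Summable.of_nonneg_of_le (fun _ => by positivity)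
    (fun n => mul_le_of_le_one_right (norm_nonneg _) (abs_one_sub_antiWickFactor_le_one n))
    hf.summable_sympFourier.norm

theorem tendsto_quantError (hf : TorusSmooth f) : Tendsto (quantError f) atTop (𝓝 0) := by
  have term_tendsto (n : (Fin d → ℤ) × (Fin d → ℤ)) : Tendsto (fun N =>
      ‖sympFourier f ((2 * Real.pi) • intPhase n)‖ * |1 - antiWickFactor N n|) atTop (𝓝 0) := by
    simpa using ((tendsto_antiWickFactor n).const_sub 1).abs.const_mul
      ‖sympFourier f ((2 * Real.pi) • intPhase n)‖
  rw [← tsum_zero (β := (Fin d → ℤ) × (Fin d → ℤ)) (α := ℝ)]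
  refine tendsto_tsum_of_dominated_convergence hf.summable_sympFourier.norm term_tendsto
    (Eventually.of_forall fun N n => ?_)
  rw [norm_mul, norm_norm, Real.norm_eq_abs, abs_abs]
  exact mul_le_of_le_one_right (norm_nonneg _) (abs_one_sub_antiWickFactor_le_one n)

lemma hasSum_integral_mul_husimi (hf : TorusSmooth f) (c : Coord d N) :
    HasSum (fun n => sympFourier f ((2 * Real.pi) • intPhase n) *
      (antiWickFactor N n * inner ℂ c (shiftCoord N κ n c)))
      (∫ a in cube d, f a * (husimi N κ c a : ℂ)) := by
  obtain ⟨C, hC⟩ := exists_bound_cube (continuous_husimi (κ := κ) c)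
  have series (a : Phase d) := (hf.hasSum_sympFourier a).mul_right (husimi N κ c a : ℂ)
  simp only [← integral_char_mul_husimi, ← integral_const_mul, ← mul_assoc,
    ← fun a => (series a).tsum_eq]
  refine hasSum_integral_of_norm_le (hf.summable_sympFourier.norm.mul_right C) (fun n => ?_)
    fun n => ae_cube fun a ha => ?_
  · have := Complex.continuous_ofReal.comp (continuous_husimi (κ := κ) c)
    unfold symp
    exact Continuous.aestronglyMeasurable (by fun_prop)
  · rw [norm_mul, norm_mul, norm_ec, mul_one, Complex.norm_real]
    exact mul_le_mul_of_nonneg_left (hC a ha) (norm_nonneg _)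

theorem norm_weylExpectation_sub_integral_husimi_le (hf : TorusSmooth f) (c : Coord d N) :
    ‖weylExpectation N κ f c - ∫ a in cube d, f a * (husimi N κ c a : ℂ)‖ ≤
      ‖c‖ ^ 2 * quantError f N := by
  have weyl := (innerSL ℂ c).hasSum (hasSum_coords_opW_synth (κ := κ) hf c)
  have difference := weyl.sub (hf.hasSum_integral_mul_husimi (κ := κ) c)
  rw [innerSL_apply_apply] at difference
  rw [weylExpectation, ← difference.tsum_eq, quantError, ← tsum_mul_left]
  refine tsum_of_norm_bounded ((hf.summable_quantError N).mul_left _).hasSum fun n => ?_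
  have inner_shift_le : ‖inner ℂ c (shiftCoord N κ n c)‖ ≤ ‖c‖ ^ 2 := by
    simpa only [norm_shiftCoord, sq] using norm_inner_le_norm (𝕜 := ℂ) c (shiftCoord N κ n c)
  calc _ = ‖inner ℂ c (shiftCoord N κ n c) *
        (sympFourier f ((2 * Real.pi) • intPhase n) * ((1 - antiWickFactor N n : ℝ) : ℂ))‖ := by
        rw [innerSL_apply_apply, inner_smul_right]
        push_cast
        ring_nf
    _ ≤ ‖c‖ ^ 2 *
        (‖sympFourier f ((2 * Real.pi) • intPhase n)‖ * |1 - antiWickFactor N n|) := by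
        rw [norm_mul, norm_mul, Complex.norm_real, Real.norm_eq_abs]
        gcongr

end TorusSmooth

end QuantizationError

/-! ### Cutoffs near the origin of the torus -/

section Cutoff

variable {d : ℕ}

/-- The smooth periodic function `∑ sin² (π x_i)`, a substitute for the squared distance of `x`
to the lattice `ℤ^{2d}`. -/
def sinSq (x : Phase d) : ℝ :=
  ∑ i, (Real.sin (Real.pi * x.1 i) ^ 2 + Real.sin (Real.pi * x.2 i) ^ 2)

lemma contDiff_sinSq : ContDiff ℝ ∞ (sinSq (d := d)) := by
  have fst (i : Fin d) : ContDiff ℝ ∞ fun x : Phase d => x.1 i :=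
    (EuclideanSpace.proj (𝕜 := ℝ) i).contDiff.comp contDiff_fst
  have snd (i : Fin d) : ContDiff ℝ ∞ fun x : Phase d => x.2 i :=
    (EuclideanSpace.proj (𝕜 := ℝ) i).contDiff.comp contDiff_snd
  exact ContDiff.sum fun i _ =>
    ((contDiff_const.mul (fst i)).sin.pow 2).add ((contDiff_const.mul (snd i)).sin.pow 2)

lemma sin_pi_mul_add_int_sq (t : ℝ) (n : ℤ) :
    Real.sin (Real.pi * (t + n)) ^ 2 = Real.sin (Real.pi * t) ^ 2 := by
  rw [mul_add, mul_comm Real.pi (n : ℝ), Real.sin_add_int_mul_pi, mul_pow, ← zpow_natCast,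
    ← zpow_mul, mul_comm n, zpow_mul]
  norm_num

lemma sinSq_add_intPhase (x : Phase d) (n : (Fin d → ℤ) × (Fin d → ℤ)) :
    sinSq (x + intPhase n) = sinSq x := by
  simp [sinSq, intPhase, intVec, sin_pi_mul_add_int_sq]

lemma four_mul_sub_round_sq_le (t : ℝ) :
    4 * (t - round t) ^ 2 ≤ Real.sin (Real.pi * t) ^ 2 := by
  have abs_pi_mul : |Real.pi * (t - round t)| = Real.pi * |t - round t| := by
    rw [abs_mul, abs_of_pos Real.pi_pos]
  have jordan := Real.mul_abs_le_abs_sin (x := Real.pi * (t - round t))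
    (by nlinarith [abs_sub_round t, Real.pi_pos])
  rw [abs_pi_mul, ← mul_assoc, div_mul_cancel₀ _ Real.pi_ne_zero] at jordan
  have squared := pow_le_pow_left₀ (by positivity) jordan 2
  rw [mul_pow, sq_abs, sq_abs, ← sin_pi_mul_add_int_sq _ (round t), sub_add_cancel] at squared
  linarith

/-- A smooth periodic cutoff that is `1` at the lattice and vanishes at distance `> δ` from it. -/
def cutoff (δ : ℝ) (x : Phase d) : ℝ := Real.smoothTransition (2 - sinSq x / δ ^ 2)

lemma torusSmooth_cutoff (δ : ℝ) : TorusSmooth (cutoff (d := d) δ) :=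
  ⟨Real.smoothTransition.contDiff.comp (contDiff_const.sub (contDiff_sinSq.div_const _)),
    fun x n => by rw [cutoff, cutoff, sinSq_add_intPhase]⟩

lemma cutoff_zero (δ : ℝ) : cutoff (d := d) δ 0 = 1 :=
  Real.smoothTransition.one_of_one_le (by simp [sinSq])

lemma exists_near_of_cutoff_ne_zero {δ : ℝ} (hδ : 0 < δ) {x : Phase d} (h : cutoff δ x ≠ 0) :
    ∃ n : (Fin d → ℤ) × (Fin d → ℤ),
      ‖x.1 - intVec n.1‖ ^ 2 + ‖x.2 - intVec n.2‖ ^ 2 ≤ δ ^ 2 := by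
  have sinSq_lt : sinSq x < 2 * δ ^ 2 := by
    contrapose! h
    refine Real.smoothTransition.zero_of_nonpos (sub_nonpos.mpr ?_)
    rwa [le_div_iff₀ (by positivity)]
  refine ⟨(fun i => round (x.1 i), fun i => round (x.2 i)), ?_⟩
  rw [EuclideanSpace.norm_sq_eq, EuclideanSpace.norm_sq_eq, ← Finset.sum_add_distrib]
  have le_sinSq : 4 * ∑ i, (‖(x.1 - intVec fun i => round (x.1 i)) i‖ ^ 2 +
      ‖(x.2 - intVec fun i => round (x.2 i)) i‖ ^ 2) ≤ sinSq x := by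
    rw [Finset.mul_sum]
    refine Finset.sum_le_sum fun i _ => ?_
    simp only [intVec, PiLp.sub_apply, Real.norm_eq_abs, sq_abs, mul_add]
    exact add_le_add (four_mul_sub_round_sq_le _) (four_mul_sub_round_sq_le _)
  nlinarith [sq_nonneg δ]

lemma isCutoffFamily_cutoff {r : ℕ+ → ℝ} (pos : ∀ N, 0 < r N) (tendsto : Tendsto r atTop (𝓝 0)) :
    IsCutoffFamily (d := d) r fun N => cutoff (r N) where
  pos := pos
  tendsto := tendsto
  smooth _ := torusSmooth_cutoff _
  nonneg _ _ := Real.smoothTransition.nonneg _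
  le_one _ _ := Real.smoothTransition.le_one _
  support N _ h := exists_near_of_cutoff_ne_zero (pos N) h

end Cutoff

/-- Take for `k N` the largest `k ≤ N` with `|F k N| ≤ 1 / (k + 1)`. -/
lemma exists_tendsto_diagonal {F : ℕ → ℕ+ → ℝ} (hF : ∀ k, Tendsto (F k) atTop (𝓝 0)) :
    ∃ k : ℕ+ → ℕ, Tendsto k atTop atTop ∧ Tendsto (fun N => F (k N) N) atTop (𝓝 0) := by
  classical
  let P (N : ℕ+) (k : ℕ) : Prop := |F k N| ≤ 1 / ((k : ℝ) + 1)
  let k (N : ℕ+) : ℕ := Nat.findGreatest (P N) N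
  have tendsto_k : Tendsto k atTop atTop := by
    refine tendsto_atTop.mpr fun K => ?_
    have small : ∀ᶠ N in atTop, |F K N| < 1 / ((K : ℝ) + 1) :=
      (tendsto_zero_iff_abs_tendsto_zero _ |>.mp (hF K)).eventually_lt_const (by positivity)
    filter_upwards [small, tendsto_PNat_val_atTop_atTop.eventually_ge_atTop K] with N hF hK
    exact Nat.le_findGreatest hK hF.le
  refine ⟨k, tendsto_k,
    squeeze_zero_norm' ?_ (tendsto_one_div_add_atTop_nhds_zero_nat.comp tendsto_k)⟩
  filter_upwards [tendsto_k.eventually_ge_atTop 1] with N hN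
  exact Nat.findGreatest_of_ne_zero (P := P N) rfl (Nat.one_le_iff_ne_zero.mp hN)

/-! ### Concentration and localization -/

section Concentration

variable {d : ℕ} {κ : ℕ+ → Phase d} {c : ∀ N, Coord d N}

lemma TorusSmooth.tendsto_weylExpectation_sub {f : Phase d → ℂ} (hf : TorusSmooth f) {C : ℝ}
    (hc : ∀ᶠ N in atTop, ‖c N‖ ^ 2 ≤ C) :
    Tendsto (fun N => weylExpectation N (κ N) f (c N) -
      ∫ a in cube d, f a * (husimi N (κ N) (c N) a : ℂ)) atTop (𝓝 0) := by
  have bound_tendsto : Tendsto (fun N => C * quantError f N) atTop (𝓝 0) := by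
    simpa only [mul_zero] using hf.tendsto_quantError.const_mul C
  refine squeeze_zero_norm' ?_ bound_tendsto
  filter_upwards [hc] with N hN
  exact (hf.norm_weylExpectation_sub_integral_husimi_le (c N)).trans
    (mul_le_mul_of_nonneg_right hN (quantError_nonneg f N))

lemma torusSmooth_one : TorusSmooth (fun _ : Phase d => (1 : ℂ)) := ⟨contDiff_const, fun _ _ => rfl⟩

lemma eventually_normSq_le_of_tendsto_weylExpectation_one
    (h : Tendsto (fun N => weylExpectation N (κ N) (fun _ => 1) (c N)) atTop (𝓝 1)) :
    ∀ᶠ N in atTop, ‖c N‖ ^ 2 ≤ 4 := by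
  have expectation_lt : ∀ᶠ N in atTop, ‖weylExpectation N (κ N) (fun _ => 1) (c N)‖ < 2 :=
    h.norm.eventually_lt_const (by norm_num)
  have error_lt : ∀ᶠ N in atTop, quantError (fun _ : Phase d => (1 : ℂ)) N < 1 / 2 :=
    torusSmooth_one.tendsto_quantError.eventually_lt_const (by norm_num)
  filter_upwards [expectation_lt, error_lt] with N expectation_lt error_lt
  have error_le :=
    torusSmooth_one.norm_weylExpectation_sub_integral_husimi_le (κ := κ N) (c N)
  simp only [one_mul, integral_complex_ofReal, integral_husimi] at error_le
  have triangle := norm_sub_norm_le ((‖c N‖ ^ 2 : ℝ) : ℂ)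
    (weylExpectation N (κ N) (fun _ => 1) (c N))
  rw [norm_sub_rev, Complex.norm_real, Real.norm_of_nonneg (sq_nonneg _)] at triangle
  nlinarith [sq_nonneg ‖c N‖]

lemma tendsto_integral_mul_husimi
    (h : ∀ f : Phase d → ℂ, TorusSmooth f →
      Tendsto (fun N => weylExpectation N (κ N) f (c N)) atTop (𝓝 (f 0)))
    {g : Phase d → ℝ} (hg : TorusSmooth g) :
    Tendsto (fun N => ∫ a in cube d, g a * husimi N (κ N) (c N) a) atTop (𝓝 (g 0)) := by
  have hgC : TorusSmooth fun a : Phase d => (g a : ℂ) :=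
    ⟨Complex.ofRealCLM.contDiff.comp hg.1, fun x n => congrArg Complex.ofReal (hg.2 x n)⟩
  have bounded := eventually_normSq_le_of_tendsto_weylExpectation_one (h _ torusSmooth_one)
  have limit := (h _ hgC).sub (hgC.tendsto_weylExpectation_sub (κ := κ) bounded)
  simp only [sub_sub_cancel, sub_zero, ← Complex.ofReal_mul, integral_complex_ofReal] at limit
  exact (Complex.continuous_re.tendsto _).comp limit

theorem exists_cutoff_of_concentrates
    (h : ∀ f : Phase d → ℂ, TorusSmooth f →
      Tendsto (fun N => weylExpectation N (κ N) f (c N)) atTop (𝓝 (f 0))) :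
    ∃ (r : ℕ+ → ℝ) (χ : ℕ+ → Phase d → ℝ), IsCutoffFamily r χ ∧
      Tendsto (fun N => ‖c N - superpose N (κ N) (χ N) (c N)‖) atTop (𝓝 0) := by
  have outside_tendsto (k : ℕ) : Tendsto (fun N => ∫ a in cube d,
      (1 - cutoff (1 / ((k : ℝ) + 1)) a) ^ 2 * husimi N (κ N) (c N) a) atTop (𝓝 0) := by
    obtain ⟨smooth, periodic⟩ := torusSmooth_cutoff (d := d) (1 / ((k : ℝ) + 1))
    have := tendsto_integral_mul_husimi (κ := κ) h
      (g := fun a => (1 - cutoff (1 / ((k : ℝ) + 1)) a) ^ 2)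
      ⟨(contDiff_const.sub smooth).pow 2, fun x n => by simp only [periodic]⟩
    simpa [cutoff_zero] using this
  obtain ⟨k, tendsto_k, diagonal⟩ := exists_tendsto_diagonal outside_tendsto
  refine ⟨fun N => 1 / ((k N : ℝ) + 1), fun N => cutoff (1 / ((k N : ℝ) + 1)),
    isCutoffFamily_cutoff (fun N => by positivity)
      (tendsto_one_div_add_atTop_nhds_zero_nat.comp tendsto_k), ?_⟩
  have normSq_tendsto := squeeze_zero (fun N => sq_nonneg _) (fun N =>
    norm_sub_superpose_sq_le (torusSmooth_cutoff (1 / ((k N : ℝ) + 1))).1.continuous (c N))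
    diagonal
  simpa [Real.sqrt_sq_eq_abs] using normSq_tendsto.sqrt

lemma TorusSmooth.exists_norm_sub_apply_zero_le {f : Phase d → ℂ} (hf : TorusSmooth f) {ε : ℝ}
    (hε : 0 < ε) :
    ∃ ρ > 0, ∀ r < ρ, 0 ≤ r → ∀ (a : Phase d) (n : (Fin d → ℤ) × (Fin d → ℤ)),
      ‖a.1 - intVec n.1‖ ^ 2 + ‖a.2 - intVec n.2‖ ^ 2 ≤ r ^ 2 → ‖f a - f 0‖ ≤ ε := by
  obtain ⟨ρ, hρ, near⟩ :=
    Metric.continuousAt_iff.mp (hf.1.continuous.continuousAt (x := (0 : Phase d))) ε hε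
  refine ⟨ρ, hρ, fun r hr hr0 a n ha => ?_⟩
  have fst_le : ‖a.1 - intVec n.1‖ ≤ r :=
    le_of_sq_le_sq (by linarith [sq_nonneg ‖a.2 - intVec n.2‖]) hr0
  have snd_le : ‖a.2 - intVec n.2‖ ≤ r :=
    le_of_sq_le_sq (by linarith [sq_nonneg ‖a.1 - intVec n.1‖]) hr0
  have translate : f a = f (a - intPhase n) := by
    rw [← hf.2 (a - intPhase n) n, sub_add_cancel]
  rw [translate, ← dist_eq_norm]
  refine (near ?_).le
  rw [dist_zero_right]
  exact (norm_prod_le_iff.mpr ⟨fst_le, snd_le⟩).trans_lt hr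

lemma norm_integral_mul_husimi_le {N : ℕ+} {κ : Phase d} {c : Coord d N} {χ : Phase d → ℝ}
    (hχ : Continuous χ) (hχ1 : ∀ a, χ a ≤ 1) {g : Phase d → ℂ} {ε M : ℝ} (hε : 0 ≤ ε)
    (hgε : ∀ a, χ a ≠ 0 → ‖g a‖ ≤ ε) (hgM : ∀ a ∈ cube d, ‖g a‖ ≤ M) :
    ‖∫ a in cube d, g a * (husimi N κ c a : ℂ)‖ ≤
      ε * ‖c‖ ^ 2 + M * ∫ a in cube d, (1 - χ a) * husimi N κ c a := by
  have inside : IntegrableOn (husimi N κ c) (cube d) := integrableOn_cube (by fun_prop)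
  have outside : IntegrableOn (fun a => (1 - χ a) * husimi N κ c a) (cube d) :=
    integrableOn_cube (by fun_prop)
  have norm_g_le (a : Phase d) (ha : a ∈ cube d) : ‖g a‖ ≤ ε + M * (1 - χ a) := by
    by_cases h0 : χ a = 0
    · rw [h0, sub_zero, mul_one]
      exact (hgM a ha).trans (le_add_of_nonneg_left hε)
    · have hM : 0 ≤ M := (norm_nonneg _).trans (hgM a ha)
      exact (hgε a h0).trans
        (le_add_of_nonneg_right (mul_nonneg hM (sub_nonneg.mpr (hχ1 a))))
  rw [← integral_husimi (κ := κ), ← integral_const_mul, ← integral_const_mul,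
    ← integral_add (inside.const_mul ε) (outside.const_mul M)]
  refine norm_integral_le_of_norm_le ((inside.const_mul ε).add (outside.const_mul M))
    (ae_cube fun a ha => ?_)
  rw [norm_mul, Complex.norm_real, Real.norm_of_nonneg (husimi_nonneg c a), ← mul_assoc, ← add_mul]
  exact mul_le_mul_of_nonneg_right (norm_g_le a ha) (husimi_nonneg c a)

namespace IsCutoffFamily

variable {r : ℕ+ → ℝ} {χ : ℕ+ → Phase d → ℝ}

lemma tendsto_integral_one_sub_mul_husimi (hχ : IsCutoffFamily r χ)
    (hB : Tendsto (fun N => ‖c N - superpose N (κ N) (χ N) (c N)‖) atTop (𝓝 0))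
    (hc : Tendsto (fun N => ‖c N‖) atTop (𝓝 1)) :
    Tendsto (fun N => ∫ a in cube d, (1 - χ N a) * husimi N (κ N) (c N) a) atTop (𝓝 0) := by
  have bound_tendsto := hc.mul hB
  rw [mul_zero] at bound_tendsto
  refine squeeze_zero (fun N => integral_nonneg fun a => ?_)
    (fun N => integral_one_sub_mul_husimi_le (hχ.smooth N).1.continuous (c N)) bound_tendsto
  exact mul_nonneg (sub_nonneg.mpr (hχ.le_one N a)) (husimi_nonneg _ _)

lemma tendsto_integral_sub_mul_husimi (hχ : IsCutoffFamily r χ)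
    (hB : Tendsto (fun N => ‖c N - superpose N (κ N) (χ N) (c N)‖) atTop (𝓝 0))
    (hc : Tendsto (fun N => ‖c N‖) atTop (𝓝 1)) {f : Phase d → ℂ} (hf : TorusSmooth f) :
    Tendsto (fun N => ∫ a in cube d, (f a - f 0) * (husimi N (κ N) (c N) a : ℂ))
      atTop (𝓝 0) := by
  obtain ⟨M, hM⟩ := exists_bound_cube (hf.1.continuous.sub (continuous_const (y := f 0)))
  rw [Metric.tendsto_nhds]
  intro ε hε
  obtain ⟨ρ, hρ, near⟩ := hf.exists_norm_sub_apply_zero_le (half_pos hε)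
  have bound_tendsto : Tendsto (fun N => ε / 2 * ‖c N‖ ^ 2 +
      M * ∫ a in cube d, (1 - χ N a) * husimi N (κ N) (c N) a) atTop (𝓝 (ε / 2)) := by
    simpa using ((hc.pow 2).const_mul (ε / 2)).add
      ((hχ.tendsto_integral_one_sub_mul_husimi hB hc).const_mul M)
  filter_upwards [hχ.tendsto.eventually_lt_const hρ,
    bound_tendsto.eventually_lt_const (half_lt_self hε)] with N hr bound_lt
  rw [dist_zero_right]
  refine lt_of_le_of_lt (norm_integral_mul_husimi_le (hχ.smooth N).1.continuous (hχ.le_one N)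
    (half_pos hε).le (fun a ha => ?_) hM) bound_lt
  obtain ⟨n, hn⟩ := hχ.support N a ha
  exact near (r N) hr (hχ.pos N).le a n hn

theorem concentrates (hχ : IsCutoffFamily r χ)
    (hB : Tendsto (fun N => ‖c N - superpose N (κ N) (χ N) (c N)‖) atTop (𝓝 0))
    (hc : Tendsto (fun N => ‖c N‖) atTop (𝓝 1)) {f : Phase d → ℂ} (hf : TorusSmooth f) :
    Tendsto (fun N => weylExpectation N (κ N) f (c N)) atTop (𝓝 (f 0)) := by
  have normSq_tendsto : Tendsto (fun N => ‖c N‖ ^ 2) atTop (𝓝 1) := by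
    simpa only [one_pow] using hc.pow 2
  have bounded : ∀ᶠ N in atTop, ‖c N‖ ^ 2 ≤ 2 :=
    (normSq_tendsto.eventually_lt_const one_lt_two).mono fun _ => le_of_lt
  have mass_tendsto : Tendsto (fun N => f 0 * ((‖c N‖ ^ 2 : ℝ) : ℂ)) atTop (𝓝 (f 0)) := by
    simpa using ((Complex.continuous_ofReal.tendsto _).comp normSq_tendsto).const_mul (f 0)
  have limit := ((hf.tendsto_weylExpectation_sub (κ := κ) bounded).add
    (hχ.tendsto_integral_sub_mul_husimi hB hc hf)).add mass_tendsto
  rw [zero_add, zero_add] at limit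
  refine limit.congr fun N => ?_
  have integrable {g : Phase d → ℂ} (hg : Continuous g) :
      IntegrableOn (fun a => g a * (husimi N (κ N) (c N) a : ℂ)) (cube d) :=
    integrableOn_cube (hg.mul (Complex.continuous_ofReal.comp (continuous_husimi _)))
  simp only [sub_mul]
  rw [integral_sub (integrable hf.1.continuous) (integrable continuous_const), integral_const_mul,
    integral_complex_ofReal, integral_husimi]
  ring

end IsCutoffFamily

end Concentration

end TorusQuantum

end

open TorusQuantum

theorem lemma3p12 (d : ℕ) (hd : 1 ≤ d) (κ : ℕ+ → Phase d)
    (hκ : ∀ N j, (κ N).1 j ∈ Set.Ico (0 : ℝ) (2 * Real.pi) ∧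
      (κ N).2 j ∈ Set.Ico (0 : ℝ) (2 * Real.pi))
    (Ψ : ℕ+ → 𝓢'(Config d, ℂ)) (hΨ : ∀ N, Ψ N ∈ hilb N (κ N)) :
    (ConcentratesAtZero κ Ψ →
      ∃ (r : ℕ+ → ℝ) (χ : ℕ+ → Phase d → ℝ),
        IsCutoffFamily r χ ∧ ApproxBySuperposition κ Ψ χ) ∧
    (∀ (r : ℕ+ → ℝ) (χ : ℕ+ → Phase d → ℝ),
      IsCutoffFamily r χ → ApproxBySuperposition κ Ψ χ →
      Tendsto (fun N => hNorm N (κ N) (Ψ N)) atTop (𝓝 1) →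
      ConcentratesAtZero κ Ψ) := by
  choose c hc using fun N => exists_eq_synth (hΨ N)
  obtain rfl : Ψ = fun N => synth N (κ N) (c N) := funext hc
  simp only [ConcentratesAtZero, ApproxBySuperposition, hInner, hNorm, coords_synth,
    superposition_synth]
  exact ⟨exists_cutoff_of_concentrates, fun r χ hχ hB hc f hf => hχ.concentrates hB hc hf⟩
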